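/- Let $k$ be a finite field, let $a,b$ be positive integers with $ab\ge 4$, and let $n_i,m_i,s_i,t_i$ ($i=1,2$) be integers with $$\begin{pmatrix}s_1&t_1\\s_2&t_2\end{pmatrix}\begin{pmatrix}n_1&n_2\\m_1&m_2\end{pmatrix}=\begin{pmatrix}2&-a\\-b&2\end{pmatrix}=:A.$$ Let $\Lambda=\mathbb Z e_1\oplus\mathbb Z e_2$ with dual basis $e_1^\vee,e_2^\vee$ of $\Lambda^\vee=\operatorname{Hom}(\Lambda,\mathbb Z)$, and put $\alpha_i=n_ie_1+m_ie_2\in\Lambda$, $h_i=s_ie_1^\vee+t_ie_2^\vee\in\Lambda^\vee$. Let $G$ be Tits' Kac--Moody group over $k$ attached to the datum $(A,\Lambda,(\alpha_i),(h_i))$, with its canonical homomorphisms $\eta\colon T=\operatorname{Hom}(\Lambda,k^\times)\to G$ and $\phi_i\colon SL_2(k)\to G$ (so that $\phi_i\begin{pmatrix}r&0\\0&r^{-1}\end{pmatrix}=\eta(\lambda\mapsto r^{h_i(\lambda)})$, and $\eta(\tau)$ conjugates $\phi_i\begin{pmatrix}1&r\\0&1\end{pmatrix}$ to $\phi_i\begin{pmatrix}1&\tau(\alpha_i)r\\0&1\end{pmatrix}$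 and $\phi_i\begin{pmatrix}1&0\\r&1\end{pmatrix}$ to $\phi_i\begin{pmatrix}1&0\\\tau(\alpha_i)^{-1}r&1\end{pmatrix}$). Fix $i\in\{1,2\}$, write $n,m,s,t,\alpha,h,\phi$ for $n_i,m_i,s_i,t_i,\alpha_i,h_i,\phi_i$, let $H\subseteq G$ be the subgroup generated by $\eta(T)$ and $\phi(SL_2(k))$, and let $\omega\colon\Lambda\to\Lambda$, $\omega(\lambda)=\lambda-h(\lambda)\alpha$. Let $$\overline\eta\colon T\to PGL_2(k)\times k^\times,\qquad \overline\eta(\tau)=\left(\left[\begin{pmatrix}\tau(e_1)&0\\0&1\end{pmatrix}\right],\tau(e_2)\right),$$ and let $\overline\omega\colon\Lambda\to\Lambda$ be given by $\overline\omega(x_1e_1+x_2e_2)=-x_1e_1+x_2e_2$. Assume that $H$ is not monic, that is, that $\phi$ is not injective. Then $s$ and $t$ are even, the matrix $$M=\begin{pmatrix}n&-t/2\\m&s/2\end{pmatrix}$$ (acting on column vectors, with respect to $e_1,e_2$) defines an automorphism $M$ of $\Lambda$, and: 1. there is a group isomorphism $\gamma\colon H\to PGL_2(k)\times k^\times$ such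 that $\gamma(\eta(\tau))=\overline\eta(\tau\circ M)$ for all $\tau\in T$; that is, $\gamma\circ\eta=\overline\eta\circ\gamma|_T$, where $\gamma|_T\colon T\to T$, $\tau\mapsto\tau\circ M$, is the automorphism of $T$ induced by $M$; 2. $M^{-1}\omega M=\overline\omega$. -/

import Mathlib

open scoped MatrixGroups

noncomputable section

/-- A Kac-Moody datum: a generalized Cartan matrix `A`, a free abelian group `Λ` of finite rank,
and elements `α i ∈ Λ`, `h i ∈ Λᵛ` with `⟨h i, α j⟩ = A i j`. -/
structure KacMoodyDatum (ι Λ : Type*) [AddCommGroup Λ] [Module.Free ℤ Λ] [Module.Finite ℤ Λ] where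
  A : Matrix ι ι ℤ
  α : ι → Λ
  h : ι → Module.Dual ℤ Λ
  diag : ∀ i, A i i = 2
  offDiag : ∀ i j, i ≠ j → A i j ≤ 0
  zero_symm : ∀ i j, A i j = 0 → A j i = 0
  pairing : ∀ i j, h i (α j) = A i j

namespace KacMoody

section LieAlgebra

variable {ι : Type*} [Fintype ι] [DecidableEq ι] (A : Matrix ι ι ℤ)

/-- The Kac-Moody Lie algebra of `A` over `ℚ`: generators `e i`, `f i`, `h i` and the Chevalley-Serre
relations `[h i, h j] = 0`, `[e i, f j] = δ_ij h i`, `[h i, e j] = A i j e j`,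
`[h i, f j] = - A i j f j`, `ad (e i) ^ (1 - A i j) (e j) = 0 = ad (f i) ^ (1 - A i j) (f j)`. -/
abbrev LieAlg : Type _ := Matrix.ToLieAlgebra ℚ A

/-- The Chevalley generator `e i`. -/
def e (i : ι) : LieAlg A :=
  LieSubmodule.Quotient.mk' (CartanMatrix.Relations.toIdeal ℚ A)
    (FreeLieAlgebra.of ℚ (CartanMatrix.Generators.E i))

/-- The Chevalley generator `f i`, with `[e i, f i] = h i`. -/
def f (i : ι) : LieAlg A :=
  LieSubmodule.Quotient.mk' (CartanMatrix.Relations.toIdeal ℚ A)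
    (FreeLieAlgebra.of ℚ (CartanMatrix.Generators.F i))

/-- The exponential `x ↦ ∑ n, (ad y) ^ n x / n !`. It is used for locally nilpotent `ad y` only, so
that all the sums are finite. -/
def expAd (y x : LieAlg A) : LieAlg A :=
  ∑ᶠ n : ℕ, ((n.factorial : ℚ)⁻¹) • ((LieAlgebra.ad ℚ (LieAlg A) y) ^ n) x

/-- The automorphism `exp (ad e i) ∘ exp (ad (- f i)) ∘ exp (ad e i)` of the Lie algebra, which lifts
the simple reflection with index `i`. -/
def sStar (i : ι) (x : LieAlg A) : LieAlg A :=
  expAd A (e A i) (expAd A (-f A i) (expAd A (e A i) x))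

/-- The simple reflection `a_j ↦ a_j - A i j a_i` of the root lattice `ι → ℤ`; the simple root `a_i`
is `Pi.single i 1`. -/
def simpleReflection (i : ι) (v : ι → ℤ) : ι → ℤ :=
  v - (∑ j, A i j * v j) • Pi.single i (1 : ℤ)

/-- The action of a word in the simple reflections, that is, of an element of the Weyl group. -/
def weylAct (w : List ι) (v : ι → ℤ) : ι → ℤ :=
  w.foldr (simpleReflection A) v

/-- `IsRootVector A c E`: `c` is a (real) root and `E` is one of its two distinguished root vectors
`± E_c`, that is, the pair `(c, E)` is obtained from `(a_i, e i)` by the Weyl group (acting on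
the Lie algebra through the `sStar i`) and a sign. -/
inductive IsRootVector : (ι → ℤ) → LieAlg A → Prop
  | pos (i : ι) : IsRootVector (Pi.single i 1) (e A i)
  | neg (i : ι) : IsRootVector (-Pi.single i 1) (f A i)
  | opp {c : ι → ℤ} {E : LieAlg A} : IsRootVector c E → IsRootVector c (-E)
  | refl (i : ι) {c : ι → ℤ} {E : LieAlg A} :
      IsRootVector c E → IsRootVector (simpleReflection A i c) (sStar A i E)

/-- The real root vectors `± E_c`. -/
def RootVector : Type _ := {E : LieAlg A // ∃ c, IsRootVector A c E}

/-- `{c, d}` is a prenilpotent pair of roots: some element of the Weyl group makes both positive and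
some element makes both negative. -/
def IsPrenilpotent (c d : ι → ℤ) : Prop :=
  (∃ w : List ι, 0 ≤ weylAct A w c ∧ 0 ≤ weylAct A w d) ∧
    ∃ w : List ι, weylAct A w c ≤ 0 ∧ weylAct A w d ≤ 0

/-- The formal exponential `exp (z r ^ p s ^ q E) = ∑ n, (z E) ^ n / n ! * r ^ (n p) s ^ (n q)`, a power
series in two commuting variables `r`, `s` over the universal enveloping algebra. Here
`(p, q) ≠ (0, 0)`, so that at most one `n` contributes to each monomial, and this `n` is at most
the total degree. -/
def formalExp (p q : ℕ) (z : ℤ) (E : LieAlg A) :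
    MvPowerSeries (Fin 2) (UniversalEnvelopingAlgebra ℚ (LieAlg A)) :=
  fun d => ∑ n ∈ Finset.range (d 0 + d 1 + 1),
    if d 0 = n * p ∧ d 1 = n * q then
      ((n.factorial : ℚ)⁻¹) • (z • UniversalEnvelopingAlgebra.ι ℚ E) ^ n
    else 0

/-- One factor `x_G (z r ^ p s ^ q)` of a commutator formula. -/
structure CommTerm where
  p : ℕ
  q : ℕ
  z : ℤ
  G : RootVector A

/-- The commutator formula
`[exp (r E), exp (s F)] = ∏ exp (z r ^ p s ^ q G)`, the product being taken over the list `l` of terms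
`(p, q, z, G)`, where `p, q ≥ 1` and `G` is a root vector for the root `p c + q d`,
as an identity of power series in `r`, `s` over the universal enveloping algebra. -/
def CommutatorFormula (c d : ι → ℤ) (E F : LieAlg A) (l : List (CommTerm A)) : Prop :=
  (∀ x ∈ l, 1 ≤ x.p ∧ 1 ≤ x.q ∧ IsRootVector A (x.p • c + x.q • d) x.G.1) ∧
    formalExp A 1 0 1 E * formalExp A 0 1 1 F * formalExp A 1 0 (-1) E * formalExp A 0 1 (-1) F =
      (l.map fun x => formalExp A x.p x.q x.z x.G.1).prod

variable {A}

/-- The root vector `e i`. -/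
def RootVector.e (i : ι) : RootVector A := ⟨KacMoody.e A i, _, .pos i⟩

/-- The root vector `f i`. -/
def RootVector.f (i : ι) : RootVector A := ⟨KacMoody.f A i, _, .neg i⟩

/-- The opposite `-E` of a root vector `E` (it belongs to the same root). -/
def RootVector.opp (E : RootVector A) : RootVector A := ⟨-E.1, E.2.imp fun _ h => h.opp⟩

/-- The root vector `sStar i E`. -/
def RootVector.refl (i : ι) (E : RootVector A) : RootVector A :=
  ⟨sStar A i E.1, _, E.2.choose_spec.refl i⟩

end LieAlgebra

section SL2

variable {k : Type*} [Field k]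

/-- The matrix `(1 r; 0 1)` in `SL₂(k)`. -/
def upper (r : k) : SL(2, k) := ⟨!![1, r; 0, 1], by simp⟩

/-- The matrix `(1 0; r 1)` in `SL₂(k)`. -/
def lower (r : k) : SL(2, k) := ⟨!![1, 0; r, 1], by simp⟩

/-- The matrix `(u 0; 0 u⁻¹)` in `SL₂(k)`. -/
def diagSL (u : kˣ) : SL(2, k) := ⟨!![(u : k), 0; 0, ((u⁻¹ : kˣ) : k)], by simp⟩

/-- The matrix `(0 1; -1 0)` in `SL₂(k)`. -/
def weylSL : SL(2, k) := ⟨!![0, 1; -1, 0], by simp⟩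

end SL2

section Torus

variable (k : Type*) [Field k] (Λ : Type*) [AddCommGroup Λ]

/-- The torus `T = Hom(Λ, kˣ)`. -/
abbrev Torus : Type _ := Multiplicative Λ →* kˣ

variable {k Λ}

/-- The endomorphism `τ ↦ τ ∘ g` of the torus induced by an endomorphism `g` of `Λ`. -/
def torusMap (g : Λ →ₗ[ℤ] Λ) : Torus k Λ →* Torus k Λ :=
  MonoidHom.compHom' (AddMonoidHom.toMultiplicative g.toAddMonoidHom)

/-- The element `x ↦ u ^ (h x)` of the torus. -/
def cocharacter (h : Module.Dual ℤ Λ) (u : kˣ) : Torus k Λ :=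
  MonoidHom.mk' (fun x => u ^ h x.toAdd) fun x y => by simp [zpow_add]

end Torus

end KacMoody

namespace KacMoodyDatum

section

open KacMoody

variable {ι Λ : Type*} [Fintype ι] [DecidableEq ι] [AddCommGroup Λ] [Module.Free ℤ Λ]
  [Module.Finite ℤ Λ] (D : KacMoodyDatum ι Λ) (k : Type*) [Field k]

/-- The reflection `ω i : x ↦ x - ⟨h i, x⟩ α i` of `Λ`. -/
def reflection (i : ι) : Λ →ₗ[ℤ] Λ := LinearMap.id - (D.h i).smulRight (D.α i)

/-- Generators of the Kac-Moody group over `k`: the elements of the torus, the elements of one copy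
of `SL₂(k)` for each index `i`, and the elements `x_E (r)` of the root groups. -/
inductive Gen
  | torus (τ : Torus k Λ)
  | sl (i : ι) (g : SL(2, k))
  | root (E : RootVector D.A) (r : k)

/-- The generator given by an element of the torus. -/
def genT (τ : Torus k Λ) : FreeGroup (D.Gen k) := FreeGroup.of (.torus τ)

/-- The generator given by an element of the `i`-th copy of `SL₂(k)`. -/
def genS (i : ι) (g : SL(2, k)) : FreeGroup (D.Gen k) := FreeGroup.of (.sl i g)

/-- The generator `x_E (r)`. -/
def genX (E : RootVector D.A) (r : k) : FreeGroup (D.Gen k) := FreeGroup.of (.root E r)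

/-- Tits' defining relations `u = v` of the Kac-Moody group over the field `k`.
The `i`-th copy of `SL₂(k)` is generated by the root groups of `± a_i`, with `x_{e i} (r) = (1 r; 0 1)`
and `x_{-f i} (r) = (1 0; -r 1)`; the element `x_{e i} (1) x_{-f i} (1) x_{e i} (1)` is `(0 1; -1 0)`. -/
inductive Rel : FreeGroup (D.Gen k) → FreeGroup (D.Gen k) → Prop
  | torus_mul (τ τ' : Torus k Λ) : Rel (D.genT k (τ * τ')) (D.genT k τ * D.genT k τ')
  | sl_mul (i : ι) (g g' : SL(2, k)) : Rel (D.genS k i (g * g')) (D.genS k i g * D.genS k i g')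
  | root_add (E : RootVector D.A) (r r' : k) :
      Rel (D.genX k E (r + r')) (D.genX k E r * D.genX k E r')
  | root_opp (E : RootVector D.A) (r : k) : Rel (D.genX k E.opp r) (D.genX k E (-r))
  | root_e (i : ι) (r : k) : Rel (D.genX k (RootVector.e i) r) (D.genS k i (upper r))
  | root_f (i : ι) (r : k) : Rel (D.genX k (RootVector.f i) r) (D.genS k i (lower r))
  | sl_diag (i : ι) (u : kˣ) : Rel (D.genS k i (diagSL u)) (D.genT k (cocharacter (D.h i) u))
  | torus_root_e (i : ι) (τ : Torus k Λ) (r : k) :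
      Rel (D.genT k τ * D.genS k i (upper r) * (D.genT k τ)⁻¹)
        (D.genS k i (upper ((τ (.ofAdd (D.α i)) : kˣ) * r)))
  | torus_root_f (i : ι) (τ : Torus k Λ) (r : k) :
      Rel (D.genT k τ * D.genS k i (lower r) * (D.genT k τ)⁻¹)
        (D.genS k i (lower (((τ (.ofAdd (D.α i)))⁻¹ : kˣ) * r)))
  | weyl_torus (i : ι) (τ : Torus k Λ) :
      Rel (D.genS k i weylSL * D.genT k τ * (D.genS k i weylSL)⁻¹)
        (D.genT k (torusMap (D.reflection i) τ))
  | weyl_root (i : ι) (E : RootVector D.A) (r : k) :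
      Rel (D.genS k i weylSL * D.genX k E r * (D.genS k i weylSL)⁻¹) (D.genX k (E.refl i) r)
  | commutator (c d : ι → ℤ) (E F : RootVector D.A) (l : List (CommTerm D.A))
      (hE : IsRootVector D.A c E.1) (hF : IsRootVector D.A d F.1)
      (hcd : IsPrenilpotent D.A c d) (hl : CommutatorFormula D.A c d E.1 F.1 l) (r s : k) :
      Rel (D.genX k E r * D.genX k F s * (D.genX k E r)⁻¹ * (D.genX k F s)⁻¹)
        (l.map fun x => D.genX k x.G ((x.z : k) * r ^ x.p * s ^ x.q)).prod

/-- The Kac-Moody group `G_D(k)` over the field `k`. -/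
abbrev KMGroup : Type _ := PresentedGroup {x | ∃ u v, D.Rel k u v ∧ x = u * v⁻¹}

/-- A defining relation holds in the Kac-Moody group. -/
theorem Rel.mk_eq {u v : FreeGroup (D.Gen k)} (h : D.Rel k u v) :
    (PresentedGroup.mk _ u : D.KMGroup k) = PresentedGroup.mk _ v :=
  PresentedGroup.mk_eq_mk_of_mul_inv_mem ⟨u, v, h, rfl⟩

/-- The canonical homomorphism from the torus to the Kac-Moody group. -/
def η : Torus k Λ →* D.KMGroup k :=
  MonoidHom.mk' (fun τ => PresentedGroup.mk _ (D.genT k τ)) fun τ τ' => by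
    rw [← map_mul]; exact Rel.mk_eq D k (.torus_mul τ τ')

/-- The canonical homomorphism `φ i : SL₂(k) → G_D(k)`. -/
def φ (i : ι) : SL(2, k) →* D.KMGroup k :=
  MonoidHom.mk' (fun g => PresentedGroup.mk _ (D.genS k i g)) fun g g' => by
    rw [← map_mul]; exact Rel.mk_eq D k (.sl_mul i g g')

/-- The Lévi subgroup `H i`, generated by the torus and the image of `φ i`. -/
def levi (i : ι) : Subgroup (D.KMGroup k) := (D.η k).range ⊔ (D.φ k i).range

/-- The canonical homomorphism from the torus to `H i`. -/
def ηLevi (i : ι) : Torus k Λ →* D.levi k i :=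
  (D.η k).codRestrict (D.levi k i) fun τ => Subgroup.mem_sup_left ⟨τ, rfl⟩

/-- `H i` is monic if `φ i` is injective. -/
def IsMonic (i : ι) : Prop := Function.Injective (D.φ k i)

/-- The datum of rank two with `Λ = ℤ e₁ ⊕ ℤ e₂`, `α i = n i e₁ + m i e₂`, `h i = s i e₁ᵛ + t i e₂ᵛ` and
generalized Cartan matrix `(2 -a; -b 2)`. -/
def rankTwo (a b : ℤ) (ha : 0 < a) (hb : 0 < b) (n m s t : Fin 2 → ℤ)
    (hA : !![s 0, t 0; s 1, t 1] * !![n 0, n 1; m 0, m 1] = !![2, -a; -b, 2]) :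
    KacMoodyDatum (Fin 2) (Fin 2 → ℤ) where
  A := !![2, -a; -b, 2]
  α i := ![n i, m i]
  h i := s i • LinearMap.proj 0 + t i • LinearMap.proj 1
  diag i := by fin_cases i <;> rfl
  offDiag i j hij := by fin_cases i <;> fin_cases j <;> simp_all <;> omega
  zero_symm i j h := by fin_cases i <;> fin_cases j <;> simp_all
  pairing i j := by
    rw [← hA]
    fin_cases i <;> fin_cases j <;> simp [Matrix.mul_apply, Fin.sum_univ_two]

end

end KacMoodyDatum

/-- The homomorphism `T → PGL₂(k) × kˣ` which sends `(ζ, τ) = (τ(e₁), τ(e₂))` to the pair of the class of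
the diagonal matrix `(ζ 0; 0 1)` and of `τ`. -/
def etaBar {k : Type*} [Field k] (τ : KacMoody.Torus k (Fin 2 → ℤ)) :
    PGL(2, k) × kˣ :=
  (Matrix.ProjGenLinGroup.mk
      (Matrix.GeneralLinearGroup.mkOfDetNeZero
        !![((τ (.ofAdd ![1, 0]) : kˣ) : k), 0; 0, 1] (by simp)),
    τ (.ofAdd ![0, 1]))

end

/-!
The theorem rests on the determination of the kernel of `(g, τ) ↦ φ i g * η τ`, a homomorphism
from the semidirect product of `SL₂(k)` and the torus `T` onto the Lévi subgroup (`leviMap`). The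
relation `φ i (diagSL a) = η (h i (a))` of the Kac-Moody group puts the pairs
`(diagSL a, h i (a)⁻¹)` into this kernel; the main point is that there is nothing else
(`η_mul_φ_eq_one_iff`). Given this, a non-trivial element of the kernel of `φ i` is `diagSL a`
with `a ≠ 1` and `a ^ h i (x) = 1` for all `x ∈ Λ`. Taking `x = α i` one finds `a = -1 ≠ 1`, so
`h i` has even values, which means that `s i` and `t i` are even (`even_h_of_not_isMonic`). Then
`M` has determinant `(s i * n i + t i * m i) / 2 = 1`, it maps `e₁` to `α i`, and `h i ∘ M` is
twice the first coordinate. The last fact is the assertion on reflections, and it also shows that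
`PGL₂(k) × kˣ` is the quotient of the semidirect product by the same kernel, through
`(g, τ) ↦ [g] etaBar (τ ∘ M)` (`pglMap_eq_one_iff`). The isomorphism `γ` compares the two
quotients.

That the presentation of the Kac-Moody group does not force further relations is shown by letting
the group act on the reductions of integrable highest weight modules, for an arbitrary generalized
Cartan matrix and an arbitrary field.

* For `m : ι → ℕ` the Chevalley generators act on the functions on words in the alphabet `ι`:
  `e i` is dual to the multiplication of words by `i`, and `f i` is determined by
  `[e j, f i] = δ_ij h i` and by the vanishing of its values at the empty word. An operator that
  commutes with all `e k` and vanishes at the empty word is zero (`eq_zero_of_lie_opE`). This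
  yields the Serre relations for the `f i`; those for the `e i` hold on the submodule `HW A m`
  generated by the indicator function `v` of the empty word. In this module
  `f i ^ (m i + 1) v = 0`, since all `e k` kill this vector, so that all `e i` and `f i` are
  locally nilpotent.
* The divided powers of the `f i` generate from `v` a lattice `hwLattice A m`. The divided powers
  of the `e i` preserve it, by the formula for the product of divided powers of `e` and `f` in
  `sl₂` (`kostant`), and so do those of all real root vectors, as the operators
  `exp (e i) exp (-f i) exp (e i)` preserve the lattice and implement the Weyl group
  (`weylQ_mul_rep`).
* Thus root groups act on the tensor product of the lattice with `k` by the exponential series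
  `∑ r ^ n E ^ n / n !`. Commutator formulas, which are identities of power series over the
  universal enveloping algebra, can be evaluated there (`rootOp_commutator`). The group `SL₂(k)`
  acts since the operators for `upper r`, `diagSL u` and `weylSL` satisfy relations that suffice
  to multiply Bruhat normal forms (`SL2Relations`, `sl2Relations`). The torus acts through the
  grading by `∑ i, ν i α i`, with a highest weight `lam ∈ Λ`.
* There need not be a `lam` with `h i (lam) = m i`. If these numbers differ by integers `c i`,
  then the relations hold up to scalars which are the same for all modules with the same `c`, and
  the group acts projectively on a family of such modules (`projRep`). An element of `SL₂(k)` that acts by a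
  diagonal operator is diagonal if `m i ≠ 0` (`exists_eq_diagSL`), and the comparison of two
  modules whose highest weights differ by `x` eliminates the scalars from the value of the
  character `x` of the torus.
-/

noncomputable section

namespace KacMoody

/-! ### Locally finite sums of endomorphisms -/

section LocallyFinite

open Finset

variable {R W A : Type*} [CommRing R] [AddCommGroup W] [Module R W]

/-- A family of endomorphisms is locally finite if each vector is killed by almost all members. -/
def LocFin (P : A → Module.End R W) : Prop := ∀ w, (Function.support fun a => P a w).Finite

open Classical in
/-- The sum `w ↦ ∑ a, P a w` of a locally finite family of endomorphisms; it is `0` by convention if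
the family is not locally finite. -/
def lsum (P : A → Module.End R W) : Module.End R W :=
  if hP : LocFin P then
    { toFun := fun w => ∑ᶠ a, P a w
      map_add' := fun v w => by
        rw [← finsum_add_distrib (hP v) (hP w)]; exact finsum_congr fun a => map_add _ _ _
      map_smul' := fun r w => by
        rw [RingHom.id_apply, smul_finsum' r (hP w)]; exact finsum_congr fun a => map_smul _ _ _ }
  else 0

theorem lsum_apply {P : A → Module.End R W} (hP : LocFin P) (w : W) :
    lsum P w = ∑ᶠ a, P a w := by
  rw [lsum, dif_pos hP]; rfl

/-- Sums of locally finite families are compatible with additive maps that intertwine the families,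
possibly between modules over different rings. -/
theorem lsum_intertwine {R' W' : Type*} [CommRing R'] [AddCommGroup W'] [Module R' W']
    {P : A → Module.End R W} {Q : A → Module.End R' W'} (hP : LocFin P) (hQ : LocFin Q)
    (X : W →+ W') (w : W) (h : ∀ a, X (P a w) = Q a (X w)) : X (lsum P w) = lsum Q (X w) := by
  rw [lsum_apply hP, lsum_apply hQ, X.map_finsum (hP w)]
  exact finsum_congr h

theorem lsum_eq_sum {P : A → Module.End R W} (hP : LocFin P) {w : W} {S : Finset A}
    (h : ∀ a ∉ S, P a w = 0) : lsum P w = ∑ a ∈ S, P a w := by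
  rw [lsum_apply hP]
  exact finsum_eq_sum_of_support_subset _ fun a ha => by
    by_contra hS; exact ha (h a hS)

theorem lsum_eq_single {P : A → Module.End R W} (hP : LocFin P) {w : W} (a : A)
    (h : ∀ b, b ≠ a → P b w = 0) : lsum P w = P a w := by
  rw [lsum_apply hP]; exact finsum_eq_single _ _ h

variable [AddCommMonoid A] [HasAntidiagonal A]

theorem finsum_sum_antidiagonal {M : Type*} [AddCommMonoid M] (g : A × A → M)
    (hg : (Function.support g).Finite) :
    (Function.support fun n => ∑ p ∈ antidiagonal n, g p).Finite ∧
      ∑ᶠ n, ∑ p ∈ antidiagonal n, g p = ∑ᶠ p, g p := by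
  classical
  have hsub : (Function.support fun n => ∑ p ∈ antidiagonal n, g p) ⊆
      ((hg.toFinset.image fun p : A × A => p.1 + p.2 : Finset A) : Set A) := by
    intro n hn
    obtain ⟨p, hp, hp0⟩ := Finset.exists_ne_zero_of_sum_ne_zero hn
    simp only [coe_image, Set.mem_image]
    exact ⟨p, by simpa using hp0, HasAntidiagonal.mem_antidiagonal.mp hp⟩
  refine ⟨(Finset.finite_toSet _).subset hsub, ?_⟩
  rw [finsum_eq_sum_of_support_subset _ hsub, finsum_eq_sum _ hg,
    ← Finset.sum_fiberwise_of_maps_to (t := hg.toFinset.image fun p : A × A => p.1 + p.2)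
      (g := fun p : A × A => p.1 + p.2) fun p hp => Finset.mem_image_of_mem _ hp]
  refine Finset.sum_congr rfl fun n _ => ?_
  symm
  refine Finset.sum_subset_zero_on_sdiff (fun p hp => ?_) (fun p hp => ?_) fun _ _ => rfl
  · simpa using (Finset.mem_filter.mp hp).2
  · simp only [mem_sdiff, HasAntidiagonal.mem_antidiagonal, mem_filter, Set.Finite.mem_toFinset,
      Function.mem_support, not_and] at hp
    by_contra h; exact hp.2 h hp.1

/-- The Cauchy product of locally finite sums. -/
theorem lsum_mul_antidiagonal {P Q : A → Module.End R W} (hP : LocFin P) (hQ : LocFin Q) :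
    LocFin (fun n => ∑ p ∈ antidiagonal n, P p.1 * Q p.2) ∧
      lsum P * lsum Q = lsum fun n => ∑ p ∈ antidiagonal n, P p.1 * Q p.2 := by
  classical
  have hfin (w : W) : (Function.support fun p : A × A => P p.1 (Q p.2 w)).Finite := by
    refine ((hQ w).biUnion fun b _ => (hP (Q b w)).image fun a => (a, b)).subset ?_
    rintro ⟨a, b⟩ h
    simp only [Set.mem_iUnion, Set.mem_image, Function.mem_support, Prod.mk.injEq] at h ⊢
    exact ⟨b, fun h0 => h (by simp [h0]), a, h, rfl, rfl⟩
  have hL : LocFin (fun n => ∑ p ∈ antidiagonal n, P p.1 * Q p.2) := fun w => by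
    simpa using (finsum_sum_antidiagonal _ (hfin w)).1
  refine ⟨hL, LinearMap.ext fun w => ?_⟩
  rw [lsum_apply hL]
  have h1 := (finsum_sum_antidiagonal _ (hfin w)).2
  simp only [LinearMap.sum_apply, Module.End.mul_apply]
  rw [h1, lsum_apply hP, lsum_apply hQ]
  have h2 : ∀ a, P a (∑ᶠ b, Q b w) = ∑ᶠ b, P a (Q b w) := fun a =>
    (P a).toAddMonoidHom.map_finsum (hQ w)
  simp_rw [h2]
  exact (finsum_curry _ (hfin w)).symm

omit [AddCommMonoid A] [HasAntidiagonal A] in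
theorem locFin_single [DecidableEq A] (a : A) (T : Module.End R W) :
    LocFin (fun b => if b = a then T else 0) ∧ lsum (fun b => if b = a then T else 0) = T := by
  have h : LocFin (fun b => if b = a then T else 0) := fun w =>
    (Set.finite_singleton a).subset fun b hb => by
      by_contra hne; exact hb (by simp [show b ≠ a from hne])
  refine ⟨h, LinearMap.ext fun w => ?_⟩
  rw [lsum_eq_single h a fun b hb => by simp [hb]]; simp

end LocallyFinite

section DividedPowers

open Finset

variable {R W : Type*} [CommRing R] [AddCommGroup W] [Module R W]

/-- The exponential series `∑ n, r ^ n D n` of a sequence `D` of divided powers. -/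
def dexp (D : ℕ → Module.End R W) (r : R) : Module.End R W := lsum fun n => r ^ n • D n

/-- A locally nilpotent sequence of divided powers. -/
structure IsDividedPowers (D : ℕ → Module.End R W) : Prop where
  zero : D 0 = 1
  mul : ∀ a b, D a * D b = ((a + b).choose a) • D (a + b)
  nil : ∀ w, ∃ N, ∀ n, N ≤ n → D n w = 0

namespace IsDividedPowers

variable {D : ℕ → Module.End R W} (hD : IsDividedPowers D)
include hD

theorem locFin (r : R) : LocFin fun n => r ^ n • D n := fun w => by
  obtain ⟨N, hN⟩ := hD.nil w
  refine (Set.finite_Iio N).subset fun n hn => ?_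
  by_contra h
  exact hn (by simp [hN n (not_lt.mp h)])

theorem dexp_zero : dexp D 0 = 1 := LinearMap.ext fun w => by
  rw [dexp, lsum_eq_single (hD.locFin 0) 0 fun b hb => by simp [hb]]
  simp [hD.zero]

theorem dexp_add (r s : R) : dexp D (r + s) = dexp D r * dexp D s := by
  rw [dexp, dexp, dexp, (lsum_mul_antidiagonal (hD.locFin r) (hD.locFin s)).2]
  congr 1
  ext1 n
  rw [(Commute.all r s).add_pow', sum_smul]
  refine sum_congr rfl fun p hp => ?_
  rw [HasAntidiagonal.mem_antidiagonal] at hp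
  rw [smul_mul_smul_comm, hD.mul, hp, smul_comm, smul_assoc]

theorem dexp_mul_neg (r : R) : dexp D r * dexp D (-r) = 1 := by
  rw [← hD.dexp_add, add_neg_cancel, hD.dexp_zero]

theorem dexp_neg_mul (r : R) : dexp D (-r) * dexp D r = 1 := by
  rw [← hD.dexp_add, neg_add_cancel, hD.dexp_zero]

end IsDividedPowers

/-- An additive map which intertwines two sequences of divided powers intertwines the
exponentials. -/
theorem dexp_intertwine {R' W' : Type*} [CommRing R'] [AddCommGroup W'] [Module R' W']
    {D : ℕ → Module.End R W} {D' : ℕ → Module.End R' W'} (hD : IsDividedPowers D)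
    (hD' : IsDividedPowers D') {r : R} {r' : R'} (X : W →+ W') (w : W)
    (h : ∀ n, X (r ^ n • D n w) = r' ^ n • D' n (X w)) : X (dexp D r w) = dexp D' r' (X w) :=
  lsum_intertwine (hD.locFin r) (hD'.locFin r') X w h

end DividedPowers

/-! ### Homomorphisms out of `SL₂` -/

section SL2Hom

variable {k : Type*} [Field k]

theorem coe_upper (r : k) : (upper r : Matrix (Fin 2) (Fin 2) k) = !![1, r; 0, 1] := rfl

theorem coe_lower (r : k) : (lower r : Matrix (Fin 2) (Fin 2) k) = !![1, 0; r, 1] := rfl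

theorem coe_diagSL (u : kˣ) :
    (diagSL u : Matrix (Fin 2) (Fin 2) k) = !![(u : k), 0; 0, ((u⁻¹ : kˣ) : k)] := rfl

theorem coe_weylSL : ((weylSL : SL(2, k)) : Matrix (Fin 2) (Fin 2) k) = !![0, 1; -1, 0] := rfl

theorem weylSL_conj_upper (r : k) : weylSL * upper (-r) * weylSL⁻¹ = lower r := by
  rw [mul_inv_eq_iff_eq_mul]
  ext i j; fin_cases i <;> fin_cases j <;>
    simp [coe_upper, coe_lower, coe_weylSL, Matrix.mul_apply, Fin.sum_univ_two,
      Matrix.SpecialLinearGroup.coe_mul]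

theorem weylSL_eq : (weylSL : SL(2, k)) = upper 1 * lower (-1) * upper 1 := by
  ext i j; fin_cases i <;> fin_cases j <;>
    simp [coe_upper, coe_lower, coe_weylSL, Matrix.mul_apply, Fin.sum_univ_two,
      Matrix.SpecialLinearGroup.coe_mul]

theorem eq_diag_mul_upper (g : SL(2, k)) (hc : g 1 0 = 0) (ha : g 0 0 ≠ 0) :
    g = diagSL (Units.mk0 (g 0 0) ha) * upper (g 0 1 / g 0 0) := by
  have hd : g 0 0 * g 1 1 = 1 := by
    have := g.det_coe; rw [Matrix.det_fin_two, hc] at this; simpa using this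
  ext i j; fin_cases i <;> fin_cases j <;>
    simp [coe_upper, coe_diagSL, Matrix.mul_apply, Fin.sum_univ_two, hc, mul_div_cancel₀, ha,
      Matrix.SpecialLinearGroup.coe_mul]
  exact eq_inv_of_mul_eq_one_right hd

theorem eq_upper_mul_weyl (g : SL(2, k)) (hc : g 1 0 ≠ 0) :
    g = upper (g 0 0 / g 1 0) * weylSL * diagSL (-Units.mk0 (g 1 0) hc) *
      upper (g 1 1 / g 1 0) := by
  have hd : g 0 0 * g 1 1 - g 0 1 * g 1 0 = 1 := by
    have := g.det_coe; rwa [Matrix.det_fin_two] at this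
  ext i j; fin_cases i <;> fin_cases j <;>
    simp [coe_upper, coe_diagSL, coe_weylSL, Matrix.mul_apply, Fin.sum_univ_two,
      Matrix.SpecialLinearGroup.coe_mul] <;>
    field_simp
  linear_combination -hd

/-- `SL₂(k)` is generated by `upper r`, `diagSL u` and `weylSL`. -/
theorem sl2_induction {p : SL(2, k) → Prop} (hmul : ∀ g g', p g → p g' → p (g * g'))
    (hx : ∀ r, p (upper r)) (hh : ∀ u, p (diagSL u)) (hw : p weylSL) (g : SL(2, k)) : p g := by
  by_cases hc : g 1 0 = 0
  · have ha : g 0 0 ≠ 0 := fun h => by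
      have := g.det_coe; rw [Matrix.det_fin_two, hc, h] at this; simp at this
    rw [eq_diag_mul_upper g hc ha]
    exact hmul _ _ (hh _) (hx _)
  · rw [eq_upper_mul_weyl g hc]
    exact hmul _ _ (hmul _ _ (hmul _ _ (hx _) hw) (hh _)) (hx _)

theorem diagSL_eq (u : kˣ) :
    diagSL u = upper (u : k) * lower (-(u : k)⁻¹) * upper (u : k) * weylSL⁻¹ := by
  rw [eq_mul_inv_iff_mul_eq]
  ext i j; fin_cases i <;> fin_cases j <;>
    simp [coe_upper, coe_lower, coe_diagSL, coe_weylSL, Matrix.mul_apply, Fin.sum_univ_two,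
      Matrix.SpecialLinearGroup.coe_mul]

/-- `SL₂(k)` is generated by the root groups. -/
theorem sl2_induction' {p : SL(2, k) → Prop} (hmul : ∀ g g', p g → p g' → p (g * g'))
    (hinv : ∀ g, p g → p g⁻¹)
    (hx : ∀ r, p (upper r)) (hy : ∀ r, p (lower r)) (g : SL(2, k)) : p g := by
  have hw : p weylSL := by
    rw [weylSL_eq]; exact hmul _ _ (hmul _ _ (hx _) (hy _)) (hx _)
  refine sl2_induction hmul hx (fun u => ?_) hw g
  rw [diagSL_eq]
  exact hmul _ _ (hmul _ _ (hmul _ _ (hx _) (hy _)) (hx _)) (hinv _ hw)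

/-- Elements `x r`, `h u`, `w` of a group which satisfy the relations that hold between the elements
`upper r`, `diagSL u` and `weylSL` of `SL₂(k)`. -/
structure SL2Relations {X : Type*} [Group X] (x : k → X) (h : kˣ →* X) (w : X) : Prop where
  x_add : ∀ r s, x (r + s) = x r * x s
  h_x : ∀ u r, h u * x r = x ((u : k) ^ 2 * r) * h u
  w_h : ∀ u, w * h u = h u⁻¹ * w
  w_w : w * w = h (-1)
  w_x_w : ∀ u : kˣ, w * x ((u⁻¹ : kˣ) : k) = x (-(u : k)) * h u * w * x (-(u : k)) * w

variable {X : Type*} [Group X] {x : k → X} {h : kˣ →* X} {w : X}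

open Classical in
/-- The map given by the Bruhat normal form of the elements of `SL₂(k)`. -/
def bruhatMap (x : k → X) (h : kˣ →* X) (w : X) (g : SL(2, k)) : X :=
  if hc : g 1 0 = 0 then
    if ha : g 0 0 = 0 then 1 else h (Units.mk0 (g 0 0) ha) * x (g 0 1 / g 0 0)
  else x (g 0 0 / g 1 0) * w * h (-Units.mk0 (g 1 0) hc) * x (g 1 1 / g 1 0)

theorem bruhatMap_of_eq_zero {g : SL(2, k)} (hc : g 1 0 = 0) (u : kˣ) (hu : g 0 0 = u) :
    bruhatMap x h w g = h u * x (g 0 1 / u) := by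
  have hu0 : g 0 0 ≠ 0 := hu ▸ u.ne_zero
  have h1 : Units.mk0 (g 0 0) hu0 = u := Units.ext hu
  rw [bruhatMap, dif_pos hc, dif_neg hu0, h1, hu]

theorem bruhatMap_of_ne_zero {g : SL(2, k)} (u : kˣ) (hu : g 1 0 = -u) :
    bruhatMap x h w g = x (-g 0 0 / u) * w * h u * x (-g 1 1 / u) := by
  have hu0 : g 1 0 ≠ 0 := hu ▸ neg_ne_zero.mpr u.ne_zero
  have h1 : -Units.mk0 (g 1 0) hu0 = u := Units.ext (by simp [hu])
  rw [bruhatMap, dif_neg hu0, h1, hu, div_neg, div_neg, neg_div, neg_div]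

namespace SL2Relations

variable (S : SL2Relations x h w)
include S

theorem x_zero : x 0 = 1 := by
  have := S.x_add 0 0; rw [add_zero] at this; exact left_eq_mul.mp this

theorem bruhatMap_upper_mul (r : k) (g : SL(2, k)) :
    bruhatMap x h w (upper r * g) = x r * bruhatMap x h w g := by
  have h00 : (upper r * g) 0 0 = g 0 0 + r * g 1 0 := by
    simp [coe_upper, Matrix.mul_apply, Fin.sum_univ_two,
      Matrix.SpecialLinearGroup.coe_mul]
  have h01 : (upper r * g) 0 1 = g 0 1 + r * g 1 1 := by
    simp [coe_upper, Matrix.mul_apply, Fin.sum_univ_two,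
      Matrix.SpecialLinearGroup.coe_mul]
  have h10 : (upper r * g) 1 0 = g 1 0 := by
    simp [coe_upper, Matrix.mul_apply, Fin.sum_univ_two,
      Matrix.SpecialLinearGroup.coe_mul]
  have h11 : (upper r * g) 1 1 = g 1 1 := by
    simp [coe_upper, Matrix.mul_apply, Fin.sum_univ_two,
      Matrix.SpecialLinearGroup.coe_mul]
  have hd : g 0 0 * g 1 1 - g 0 1 * g 1 0 = 1 := by
    have := g.det_coe; rwa [Matrix.det_fin_two] at this
  by_cases hc : g 1 0 = 0
  · have ha : g 0 0 ≠ 0 := fun h0 => by simp [hc, h0] at hd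
    rw [hc, mul_zero, sub_zero] at hd
    rw [bruhatMap_of_eq_zero hc (Units.mk0 _ ha) rfl,
      bruhatMap_of_eq_zero (h10.trans hc) (Units.mk0 _ ha) (by rw [h00, hc]; simp), h01,
      ← mul_assoc]
    have h1 := S.h_x (Units.mk0 _ ha) (r * g 1 1 / g 0 0)
    rw [show ((Units.mk0 _ ha : kˣ) : k) ^ 2 * (r * g 1 1 / g 0 0) = r by
      simp only [Units.val_mk0]; field_simp; linear_combination r * hd] at h1
    rw [← h1, mul_assoc, ← S.x_add]
    congr 2
    simp only [Units.val_mk0]; ring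
  · have hu : g 1 0 = -((-Units.mk0 _ hc : kˣ) : k) := by simp
    rw [bruhatMap_of_ne_zero _ hu, bruhatMap_of_ne_zero _ (h10.trans hu), h00, h11,
      ← mul_assoc, ← mul_assoc, ← mul_assoc, ← S.x_add]
    congr 4
    simp only [Units.val_neg, Units.val_mk0]; field_simp; ring

theorem bruhatMap_diag_mul (u : kˣ) (g : SL(2, k)) :
    bruhatMap x h w (diagSL u * g) = h u * bruhatMap x h w g := by
  have h00 : (diagSL u * g) 0 0 = u * g 0 0 := by
    simp [coe_diagSL, Matrix.mul_apply, Fin.sum_univ_two,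
      Matrix.SpecialLinearGroup.coe_mul]
  have h01 : (diagSL u * g) 0 1 = u * g 0 1 := by
    simp [coe_diagSL, Matrix.mul_apply, Fin.sum_univ_two,
      Matrix.SpecialLinearGroup.coe_mul]
  have h10 : (diagSL u * g) 1 0 = (u : k)⁻¹ * g 1 0 := by
    simp [coe_diagSL, Matrix.mul_apply, Fin.sum_univ_two,
      Matrix.SpecialLinearGroup.coe_mul]
  have h11 : (diagSL u * g) 1 1 = (u : k)⁻¹ * g 1 1 := by
    simp [coe_diagSL, Matrix.mul_apply, Fin.sum_univ_two,
      Matrix.SpecialLinearGroup.coe_mul]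
  have hd : g 0 0 * g 1 1 - g 0 1 * g 1 0 = 1 := by
    have := g.det_coe; rwa [Matrix.det_fin_two] at this
  by_cases hc : g 1 0 = 0
  · have ha : g 0 0 ≠ 0 := fun h0 => by simp [hc, h0] at hd
    rw [bruhatMap_of_eq_zero hc (Units.mk0 _ ha) rfl,
      bruhatMap_of_eq_zero (by rw [h10, hc, mul_zero]) (u * Units.mk0 _ ha) (by rw [h00]; simp),
      h01, map_mul, mul_assoc]
    congr 3
    simp only [Units.val_mul, Units.val_mk0]; field_simp
  · have hu : g 1 0 = -((-Units.mk0 _ hc : kˣ) : k) := by simp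
    have e1 : -(u * g 0 0) / ((u⁻¹ * -Units.mk0 _ hc : kˣ) : k) =
        (u : k) ^ 2 * (-g 0 0 / ((-Units.mk0 _ hc : kˣ) : k)) := by
      simp only [Units.val_neg, Units.val_mul, Units.val_inv_eq_inv_val, Units.val_mk0]; field_simp
    have e2 : -((u : k)⁻¹ * g 1 1) / ((u⁻¹ * -Units.mk0 _ hc : kˣ) : k) =
        -g 1 1 / ((-Units.mk0 _ hc : kˣ) : k) := by
      simp only [Units.val_neg, Units.val_mul, Units.val_inv_eq_inv_val, Units.val_mk0]; field_simp
    rw [bruhatMap_of_ne_zero _ hu, bruhatMap_of_ne_zero (u⁻¹ * -Units.mk0 _ hc) (by rw [h10]; simp),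
      h00, h11, e1, e2, map_mul, ← mul_assoc, ← mul_assoc, ← mul_assoc, ← mul_assoc, S.h_x,
      mul_assoc (x _) (h u) w, show h u * w = w * h u⁻¹ by rw [S.w_h, inv_inv], ← mul_assoc]

theorem bruhatMap_weyl_mul (g : SL(2, k)) :
    bruhatMap x h w (weylSL * g) = w * bruhatMap x h w g := by
  have h00 : ((weylSL * g : SL(2, k)) : Matrix (Fin 2) (Fin 2) k) 0 0 = g 1 0 := by
    simp [coe_weylSL, Matrix.mul_apply, Fin.sum_univ_two,
      Matrix.SpecialLinearGroup.coe_mul]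
  have h01 : ((weylSL * g : SL(2, k)) : Matrix (Fin 2) (Fin 2) k) 0 1 = g 1 1 := by
    simp [coe_weylSL, Matrix.mul_apply, Fin.sum_univ_two,
      Matrix.SpecialLinearGroup.coe_mul]
  have h10 : ((weylSL * g : SL(2, k)) : Matrix (Fin 2) (Fin 2) k) 1 0 = -g 0 0 := by
    simp [coe_weylSL, Matrix.mul_apply, Fin.sum_univ_two,
      Matrix.SpecialLinearGroup.coe_mul]
  have h11 : ((weylSL * g : SL(2, k)) : Matrix (Fin 2) (Fin 2) k) 1 1 = -g 0 1 := by
    simp [coe_weylSL, Matrix.mul_apply, Fin.sum_univ_two,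
      Matrix.SpecialLinearGroup.coe_mul]
  have hd : g 0 0 * g 1 1 - g 0 1 * g 1 0 = 1 := by
    have := g.det_coe; rwa [Matrix.det_fin_two] at this
  by_cases hc : g 1 0 = 0
  · have ha : g 0 0 ≠ 0 := fun h0 => by simp [hc, h0] at hd
    rw [bruhatMap_of_eq_zero hc (Units.mk0 _ ha) rfl,
      bruhatMap_of_ne_zero (Units.mk0 _ ha) (by rw [h10]; simp), h00, h11, hc, neg_zero, zero_div,
      S.x_zero, one_mul, neg_neg, mul_assoc]
  · have hu : g 1 0 = -((-Units.mk0 _ hc : kˣ) : k) := by simp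
    rw [bruhatMap_of_ne_zero _ hu]
    by_cases ha : g 0 0 = 0
    · rw [bruhatMap_of_eq_zero (by rw [h10, ha, neg_zero]) (Units.mk0 _ hc) (by rw [h00]; simp), ha,
        neg_zero, zero_div, S.x_zero, one_mul, ← mul_assoc, ← mul_assoc, S.w_w, ← map_mul, h01]
      simp [neg_div_neg_eq]
    · have hv : ((Units.mk0 _ ha / Units.mk0 _ hc : kˣ) : k) = g 0 0 / g 1 0 := by simp
      have h1 := S.w_x_w (Units.mk0 _ hc / Units.mk0 _ ha)
      have hw1 : w * h (-1) = h (-1) * w := by rw [S.w_h, inv_neg, inv_one]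
      have hx1 (r) : h (-1) * x r = x r * h (-1) := by rw [S.h_x]; simp
      have key : w * (x (-g 0 0 / ((-Units.mk0 _ hc : kˣ) : k)) * w) =
          x (-(g 1 0 / g 0 0)) * w * h (-Units.mk0 _ ha / Units.mk0 _ hc) *
            x (-(g 1 0 / g 0 0)) := by
        rw [← mul_assoc, show -g 0 0 / ((-Units.mk0 _ hc : kˣ) : k) =
          (((Units.mk0 _ hc / Units.mk0 _ ha : kˣ)⁻¹ : kˣ) : k) by simp [neg_div_neg_eq], h1]
        have h2 : -((Units.mk0 _ hc / Units.mk0 _ ha : kˣ) : k) = -(g 1 0 / g 0 0) := by simp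
        have h3 : h (Units.mk0 _ hc / Units.mk0 _ ha) * w =
            w * h (Units.mk0 _ ha / Units.mk0 _ hc) := by rw [S.w_h, inv_div]
        rw [h2, mul_assoc (x _) (h _) w, h3]
        simp only [mul_assoc, S.w_w]
        rw [← hx1, neg_div, neg_eq_neg_one_mul (Units.mk0 _ ha / Units.mk0 _ hc), mul_comm (-1),
          map_mul, mul_assoc]
      rw [bruhatMap_of_ne_zero (Units.mk0 _ ha) (by rw [h10]; simp), h00, h11, neg_neg]
      rw [← mul_assoc, ← mul_assoc, key]
      have h4 := S.h_x (-Units.mk0 _ hc) (-(1 / (g 0 0 * g 1 0)))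
      rw [show ((-Units.mk0 _ hc : kˣ) : k) ^ 2 * (-(1 / (g 0 0 * g 1 0))) = -(g 1 0 / g 0 0) by
        simp only [Units.val_neg, Units.val_mk0]; field_simp] at h4
      rw [mul_assoc _ (x (-(g 1 0 / g 0 0))), ← h4, ← mul_assoc, mul_assoc _ (h _) (h _),
        ← map_mul, mul_assoc _ (x _) (x _), ← S.x_add]
      congr 2
      · simp [neg_div]
      · simp
      · simp only [Units.val_neg, Units.val_mk0]; field_simp; linear_combination -hd

theorem bruhatMap_one : bruhatMap x h w 1 = 1 := by
  rw [bruhatMap_of_eq_zero (by simp) 1 (by simp)]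
  simp [S.x_zero]

/-- The homomorphism `SL₂(k) → X` with `upper r ↦ x r`, `diagSL u ↦ h u` and `weylSL ↦ w`. -/
def toHom : SL(2, k) →* X :=
  MonoidHom.mk' (bruhatMap x h w) fun g => by
    have h1 := S.bruhatMap_one
    refine sl2_induction (p := fun g => ∀ g', bruhatMap x h w (g * g') =
      bruhatMap x h w g * bruhatMap x h w g') ?_ ?_ ?_ ?_ g
    · intro a b ha hb g'; rw [mul_assoc, ha, hb, ha, mul_assoc]
    · intro r g'
      rw [S.bruhatMap_upper_mul, ← mul_one (upper r), S.bruhatMap_upper_mul, h1, mul_one]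
    · intro u g'
      rw [S.bruhatMap_diag_mul, ← mul_one (diagSL u), S.bruhatMap_diag_mul, h1, mul_one]
    · intro g'; rw [S.bruhatMap_weyl_mul, ← mul_one weylSL, S.bruhatMap_weyl_mul, h1, mul_one]

theorem toHom_upper (r : k) : S.toHom (upper r) = x r :=
  (congrArg _ (mul_one _).symm).trans
    ((S.bruhatMap_upper_mul r 1).trans (by rw [S.bruhatMap_one, mul_one]))

theorem toHom_diagSL (u : kˣ) : S.toHom (diagSL u) = h u :=
  (congrArg _ (mul_one _).symm).trans
    ((S.bruhatMap_diag_mul u 1).trans (by rw [S.bruhatMap_one, mul_one]))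

theorem toHom_weylSL : S.toHom weylSL = w :=
  (congrArg _ (mul_one _).symm).trans
    ((S.bruhatMap_weyl_mul 1).trans (by rw [S.bruhatMap_one, mul_one]))

end SL2Relations

end SL2Hom

/-! ### A coinduced module for the Chevalley generators -/

/-- The axioms of a generalized Cartan matrix. -/
class IsGCM {ι : Type*} (A : Matrix ι ι ℤ) : Prop where
  diag : ∀ i, A i i = 2
  offDiag : ∀ i j, i ≠ j → A i j ≤ 0
  zero_symm : ∀ i j, A i j = 0 → A j i = 0

/-- The action of `h` and `e` on the vectors `f ^ p y`, for a vector `y` of weight `c` killed by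
`e`. In particular `e` kills `f ^ (c + 1) y` if `0 ≤ c`. In the adjoint action this makes the Serre
elements highest weight vectors; it is also used in the highest weight modules. -/
theorem lie_iterate_sl2 {L M : Type*} [LieRing L] [AddCommGroup M] [LieRingModule L M]
    {e h f : L} {y : M} {c : ℤ} (hef : ⁅e, f⁆ = h) (hhf : ⁅h, f⁆ = -((2 : ℤ) • f))
    (hey : ⁅e, y⁆ = 0) (hhy : ⁅h, y⁆ = c • y) (p : ℕ) :
    ⁅h, (fun z : M => ⁅f, z⁆)^[p] y⁆ = (c - 2 * p) • (fun z : M => ⁅f, z⁆)^[p] y ∧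
      ⁅e, (fun z : M => ⁅f, z⁆)^[p + 1] y⁆ =
        ((p + 1 : ℤ) * (c - p)) • (fun z : M => ⁅f, z⁆)^[p] y := by
  have hh (p : ℕ) :
      ⁅h, (fun z : M => ⁅f, z⁆)^[p] y⁆ = (c - 2 * p) • (fun z : M => ⁅f, z⁆)^[p] y := by
    induction p with
    | zero => simpa using hhy
    | succ p ih =>
      rw [Function.iterate_succ_apply', leibniz_lie, hhf, ih, neg_lie, zsmul_lie, lie_zsmul]
      push_cast
      module
  refine ⟨hh p, ?_⟩
  induction p with
  | zero =>
    rw [Function.iterate_succ_apply', leibniz_lie, hef]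
    simp [hhy, hey]
  | succ p ih =>
    rw [Function.iterate_succ_apply', leibniz_lie, hef, hh, ih, lie_zsmul,
      ← Function.iterate_succ_apply' (fun z : M => ⁅f, z⁆)]
    push_cast
    module

section Coinduced

attribute [local instance] LieRing.ofAssociativeRing

variable {ι : Type*} [DecidableEq ι] (A : Matrix ι ι ℤ) (m : ι → ℕ)

/-- The operator `e i` on functions on words; it is dual to the multiplication of words by `i`. The
functions on words are the dual of the free algebra on the `e i`, that is, the coinduced module,
and all relations except those between the `e i` hold on it. -/
def opE (i : ι) : Module.End ℚ (List ι → ℚ) := LinearMap.funLeft ℚ ℚ fun u => i :: u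

/-- The weight of `h i` on the functions supported at the word `u`: the word stands for a vector
`f u₁ f u₂ ⋯ v`, where `v` is a highest weight vector with `h i v = m i v`. -/
def wordWeight (i : ι) (u : List ι) : ℤ := m i - (u.map (A i)).sum

/-- The operator `h i` on functions on words. -/
def opH (i : ι) : Module.End ℚ (List ι → ℚ) where
  toFun φ u := wordWeight A m i u * φ u
  map_add' _ _ := funext fun _ => mul_add _ _ _
  map_smul' _ _ := funext fun _ => mul_left_comm _ _ _

/-- The value of `f i φ` at a word, by recursion on the word; the recursion forces
`[e j, f i] = δ i j h i`. -/
def opFAux (i : ι) : List ι → (List ι → ℚ) → ℚ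
  | [], _ => 0
  | j :: u, φ => opFAux i u (fun v => φ (j :: v)) + if i = j then wordWeight A m i u * φ u else 0

/-- The operator `f i` on functions on words. -/
def opF (i : ι) : Module.End ℚ (List ι → ℚ) where
  toFun φ u := opFAux A m i u φ
  map_add' φ ψ := funext fun u => by
    induction u generalizing φ ψ with
    | nil => simp [opFAux]
    | cons j u ih =>
      simp only [opFAux, Pi.add_apply] at ih ⊢
      have := ih (fun v => φ (j :: v)) (fun v => ψ (j :: v))
      simp only [Pi.add_def] at this ⊢
      rw [this]; split_ifs <;> ring
  map_smul' r φ := funext fun u => by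
    induction u generalizing φ with
    | nil => simp [opFAux]
    | cons j u ih =>
      simp only [opFAux, Pi.smul_apply, RingHom.id_apply, smul_eq_mul] at ih ⊢
      have := ih (fun v => φ (j :: v))
      simp only [Pi.smul_def, smul_eq_mul] at this ⊢
      rw [this]; split_ifs <;> ring

theorem opE_apply (i : ι) (φ : List ι → ℚ) (u : List ι) : opE i φ u = φ (i :: u) := rfl

theorem opH_apply (i : ι) (φ : List ι → ℚ) (u : List ι) :
    opH A m i φ u = wordWeight A m i u * φ u := rfl

theorem opF_nil (i : ι) (φ : List ι → ℚ) : opF A m i φ [] = 0 := rfl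

theorem opF_cons (i j : ι) (φ : List ι → ℚ) (u : List ι) :
    opF A m i φ (j :: u) =
      opF A m i (opE j φ) u + if i = j then opH A m i φ u else 0 := rfl

theorem lie_opE_opF (j i : ι) : ⁅opE j, opF A m i⁆ = if i = j then opH A m i else 0 := by
  ext φ u
  rw [Ring.lie_def]
  simp only [LinearMap.sub_apply, Module.End.mul_apply, Pi.sub_apply, opE_apply, opF_cons]
  split_ifs <;> simp

theorem lie_opH_opH (i j : ι) : ⁅opH A m i, opH A m j⁆ = 0 := by
  ext φ u
  rw [Ring.lie_def]
  simp only [LinearMap.sub_apply, Module.End.mul_apply, Pi.sub_apply, opH_apply]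
  simp [mul_left_comm]

theorem wordWeight_cons (i j : ι) (u : List ι) :
    wordWeight A m i (j :: u) = wordWeight A m i u - A i j := by
  simp [wordWeight]; ring

theorem lie_opH_opE (i j : ι) : ⁅opH A m i, opE j⁆ = A i j • opE j := by
  ext φ u
  rw [Ring.lie_def]
  simp only [LinearMap.sub_apply, Module.End.mul_apply, Pi.sub_apply, opH_apply, opE_apply,
    wordWeight_cons, LinearMap.smul_apply, Pi.smul_apply]
  rw [zsmul_eq_mul]
  push_cast; ring

/-- An operator that commutes with all `e k` and whose values vanish at the empty word is zero. The
relations between the operators `f i` follow from this. -/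
theorem eq_zero_of_lie_opE {T : Module.End ℚ (List ι → ℚ)} (h0 : ∀ φ, T φ [] = 0)
    (hT : ∀ k : ι, ⁅opE k, T⁆ = 0) : T = 0 := by
  ext φ u
  induction u generalizing φ with
  | nil => exact h0 φ
  | cons k u ih =>
    have h1 : opE k (T φ) = T (opE k φ) := by
      have := LinearMap.congr_fun (hT k) φ
      rwa [Ring.lie_def, LinearMap.sub_apply, LinearMap.zero_apply, sub_eq_zero] at this
    have := congrFun h1 u
    rw [opE_apply] at this
    rw [this, ih (opE k φ)]; rfl

theorem lie_opH_opF (i j : ι) : ⁅opH A m i, opF A m j⁆ = -(A i j • opF A m j) := by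
  rw [← sub_eq_zero]
  refine eq_zero_of_lie_opE (fun φ => ?_) fun k => ?_
  · rw [Ring.lie_def]
    simp [opH_apply, opF_nil]
  · rw [sub_neg_eq_add, lie_add, leibniz_lie, lie_zsmul, lie_opE_opF, ← lie_skew (opE k),
      lie_opH_opE]
    rw [neg_lie, zsmul_lie, lie_opE_opF]
    split_ifs with h
    · subst h; rw [lie_opH_opH]; module
    · simp

variable [IsGCM A]

/-- The Serre relations between the operators `f i` hold on all functions, since the Serre elements
commute with all `e k`. -/
theorem serre_opF (i j : ι) :
    (fun z : Module.End ℚ (List ι → ℚ) => ⁅opF A m i, z⁆)^[(-A i j).toNat]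
      ⁅opF A m i, opF A m j⁆ = 0 := by
  rcases eq_or_ne i j with hij | hij
  · rw [hij, lie_self]
    exact Function.iterate_fixed (lie_zero _) _
  have hA : ((-A i j).toNat : ℤ) = -A i j :=
    Int.toNat_of_nonneg (neg_nonneg.mpr (IsGCM.offDiag i j hij))
  set n := (-A i j).toNat with hn
  set ad := fun z : Module.End ℚ (List ι → ℚ) => ⁅opF A m i, z⁆ with had
  change ad^[n] (ad (opF A m j)) = 0
  rw [← Function.iterate_succ_apply]
  have hnil (p : ℕ) : ∀ φ, ad^[p] (opF A m j) φ [] = 0 := by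
    induction p with
    | zero => exact fun φ => opF_nil A m j φ
    | succ p ih =>
      intro φ
      rw [Function.iterate_succ_apply', had]
      change (⁅opF A m i, ad^[p] (opF A m j)⁆ : Module.End ℚ (List ι → ℚ)) φ [] = 0
      rw [Ring.lie_def, LinearMap.sub_apply, Pi.sub_apply, Module.End.mul_apply,
        Module.End.mul_apply, opF_nil, ih, sub_zero]
  refine eq_zero_of_lie_opE (hnil _) fun k => ?_
  rcases eq_or_ne i k with rfl | hik
  · have h := (lie_iterate_sl2 (e := opE i) (h := opH A m i) (f := opF A m i) (y := opF A m j)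
      (c := -A i j) (by simp [lie_opE_opF]) (by rw [lie_opH_opF, IsGCM.diag (A := A)])
      (by simp [lie_opE_opF, hij.symm]) (by rw [lie_opH_opF, neg_smul]) n).2
    rw [h, hA, sub_self, mul_zero, zero_smul]
  · have hk (p : ℕ) : ⁅opE k, ad^[p] (opF A m j)⁆ = ad^[p] ⁅opE k, opF A m j⁆ := by
      induction p with
      | zero => rfl
      | succ p ih =>
        rw [Function.iterate_succ_apply', Function.iterate_succ_apply', ← ih, had]
        simp only [leibniz_lie (opE k), lie_opE_opF, hik, if_false, zero_lie, zero_add]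
    rw [hk, lie_opE_opF]
    split_ifs with hjk
    · rw [Function.iterate_succ_apply]
      have h1 : ad (opH A m j) = A j i • opF A m i := by
        rw [had]; simp only; rw [← lie_skew, lie_opH_opF, neg_neg]
      rw [h1]
      rcases Nat.eq_zero_or_pos n with h0 | hpos
      · rw [h0, Nat.cast_zero, eq_comm, neg_eq_zero] at hA
        rw [IsGCM.zero_symm i j hA, zero_smul]
        exact Function.iterate_fixed (lie_zero _) _
      · obtain ⟨q, hq⟩ := Nat.exists_eq_succ_of_ne_zero hpos.ne'
        rw [hq, Function.iterate_succ_apply, had]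
        simp only [lie_zsmul, lie_self, smul_zero]
        exact Function.iterate_fixed (lie_zero _) _
    · exact Function.iterate_fixed (lie_zero _) _

/-- The Serre elements for the `e i` commute with all operators `f k`. -/
theorem lie_opF_serre_opE (i j k : ι) :
    ⁅opF A m k, (fun z : Module.End ℚ (List ι → ℚ) => ⁅opE i, z⁆)^[(-A i j).toNat]
      ⁅opE i, opE j⁆⁆ = 0 := by
  rcases eq_or_ne i j with hij | hij
  · rw [hij, lie_self, Function.iterate_fixed (lie_zero _), lie_zero]
  have hA : ((-A i j).toNat : ℤ) = -A i j :=
    Int.toNat_of_nonneg (neg_nonneg.mpr (IsGCM.offDiag i j hij))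
  set n := (-A i j).toNat with hn
  set ad := fun z : Module.End ℚ (List ι → ℚ) => ⁅opE i, z⁆ with had
  change ⁅opF A m k, ad^[n] (ad (opE j))⁆ = 0
  rw [← Function.iterate_succ_apply]
  rcases eq_or_ne k i with rfl | hik
  · have h := (lie_iterate_sl2 (e := opF A m k) (h := -opH A m k) (f := opE k) (y := opE j)
      (c := -A k j) (by rw [← lie_skew, lie_opE_opF, if_pos rfl])
      (by rw [neg_lie, lie_opH_opE, IsGCM.diag (A := A)])
      (by rw [← lie_skew, lie_opE_opF, if_neg hij, neg_zero])
      (by rw [neg_lie, lie_opH_opE, neg_smul]) n).2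
    rw [h, hA, sub_self, mul_zero, zero_smul]
  · have hk (p : ℕ) : ⁅opF A m k, ad^[p] (opE j)⁆ = ad^[p] ⁅opF A m k, opE j⁆ := by
      induction p with
      | zero => rfl
      | succ p ih =>
        rw [Function.iterate_succ_apply', Function.iterate_succ_apply', ← ih, had]
        simp only [leibniz_lie (opF A m k)]
        rw [← lie_skew (opF A m k) (opE i), lie_opE_opF, if_neg hik, neg_zero, zero_lie, zero_add]
    rw [hk, ← lie_skew, lie_opE_opF]
    split_ifs with hjk
    · subst hjk
      rw [Function.iterate_succ_apply]
      have h1 : ad (-opH A m k) = A k i • opE i := by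
        rw [had]; simp only; rw [lie_neg, lie_skew, lie_opH_opE]
      rw [h1]
      rcases Nat.eq_zero_or_pos n with h0 | hpos
      · rw [h0, Nat.cast_zero, eq_comm, neg_eq_zero] at hA
        rw [IsGCM.zero_symm i k hA, zero_smul]
        exact Function.iterate_fixed (lie_zero _) _
      · obtain ⟨q, hq⟩ := Nat.exists_eq_succ_of_ne_zero hpos.ne'
        rw [hq, Function.iterate_succ_apply, had]
        simp only [lie_zsmul, lie_self, smul_zero]
        exact Function.iterate_fixed (lie_zero _) _
    · rw [neg_zero]; exact Function.iterate_fixed (lie_zero _) _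

end Coinduced

/-! ### The highest weight modules -/

section HighestWeight

attribute [local instance] LieRing.ofAssociativeRing

variable {ι : Type*} [DecidableEq ι] (A : Matrix ι ι ℤ) (m : ι → ℕ)

/-- The highest weight vector: the indicator function of the empty word. -/
def hwVec : List ι → ℚ := Pi.single [] 1

/-- The vector `f u₁ f u₂ ⋯ v`, for the highest weight vector `v`. -/
def wordVec (u : List ι) : List ι → ℚ := u.foldr (fun i x => opF A m i x) hwVec

/-- The space of the highest weight module: the span of the vectors `f u₁ f u₂ ⋯ v`. -/
def hwSubmodule : Submodule ℚ (List ι → ℚ) := Submodule.span ℚ (Set.range (wordVec A m))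

/-- The integrable highest weight module with highest weight `m`, that is, the submodule of the
coinduced module that the highest weight vector generates. -/
abbrev HW : Type _ := hwSubmodule A m

theorem wordVec_cons (i : ι) (u : List ι) : wordVec A m (i :: u) = opF A m i (wordVec A m u) := rfl

theorem wordVec_mem (u : List ι) : wordVec A m u ∈ hwSubmodule A m :=
  Submodule.subset_span ⟨u, rfl⟩

theorem opE_hwVec (i : ι) : opE i (hwVec : List ι → ℚ) = 0 := by
  ext u; simp [opE_apply, hwVec]

theorem opH_hwVec (i : ι) : opH A m i hwVec = (m i : ℚ) • hwVec := by
  ext u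
  rcases eq_or_ne u [] with rfl | hu
  · simp [opH_apply, hwVec, wordWeight]
  · simp [opH_apply, hwVec, hu]

theorem opE_opF (j i : ι) (φ : List ι → ℚ) :
    opE j (opF A m i φ) = opF A m i (opE j φ) + if i = j then opH A m i φ else 0 := by
  have := LinearMap.congr_fun (lie_opE_opF A m j i) φ
  rw [Ring.lie_def, LinearMap.sub_apply, sub_eq_iff_eq_add'] at this
  rw [Module.End.mul_apply, Module.End.mul_apply] at this
  rw [this]; split_ifs <;> rfl

theorem opH_opF (i j : ι) (φ : List ι → ℚ) :
    opH A m i (opF A m j φ) = opF A m j (opH A m i φ) - (A i j : ℚ) • opF A m j φ := by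
  have := LinearMap.congr_fun (lie_opH_opF A m i j) φ
  rw [Ring.lie_def, LinearMap.sub_apply, sub_eq_iff_eq_add'] at this
  rw [Module.End.mul_apply, Module.End.mul_apply] at this
  rw [this, sub_eq_add_neg]
  rw [LinearMap.neg_apply, LinearMap.smul_apply, Int.cast_smul_eq_zsmul]

theorem opH_wordVec (i : ι) (u : List ι) :
    opH A m i (wordVec A m u) = (wordWeight A m i u : ℚ) • wordVec A m u := by
  induction u with
  | nil => simpa [wordWeight, wordVec] using opH_hwVec A m i
  | cons j u ih =>
    rw [wordVec_cons, opH_opF, ih, map_smul, wordWeight_cons, ← sub_smul]; push_cast; rfl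

theorem opE_wordVec_mem (i : ι) (u : List ι) : opE i (wordVec A m u) ∈ hwSubmodule A m := by
  induction u with
  | nil => rw [wordVec, List.foldr_nil, opE_hwVec]; exact zero_mem _
  | cons j u ih =>
    rw [wordVec_cons, opE_opF]
    refine add_mem ?_ ?_
    · have : hwSubmodule A m ≤ (hwSubmodule A m).comap (opF A m j) :=
        Submodule.span_le.mpr
          (by rintro _ ⟨v, rfl⟩; exact wordVec_mem A m (j :: v))
      exact this ih
    · split_ifs
      · rw [opH_wordVec]; exact Submodule.smul_mem _ _ (wordVec_mem A m u)
      · exact zero_mem _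

theorem opF_mem (i : ι) : ∀ φ ∈ hwSubmodule A m, opF A m i φ ∈ hwSubmodule A m :=
  Submodule.span_le (p := (hwSubmodule A m).comap (opF A m i)).mpr
    (by rintro _ ⟨v, rfl⟩; exact wordVec_mem A m (i :: v))

theorem opH_mem (i : ι) : ∀ φ ∈ hwSubmodule A m, opH A m i φ ∈ hwSubmodule A m :=
  Submodule.span_le (p := (hwSubmodule A m).comap (opH A m i)).mpr (by
    rintro _ ⟨v, rfl⟩
    change opH A m i _ ∈ hwSubmodule A m
    rw [opH_wordVec]; exact Submodule.smul_mem _ _ (wordVec_mem A m v))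

theorem opE_mem (i : ι) : ∀ φ ∈ hwSubmodule A m, opE i φ ∈ hwSubmodule A m :=
  Submodule.span_le (p := (hwSubmodule A m).comap (opE i)).mpr
    (by rintro _ ⟨v, rfl⟩; exact opE_wordVec_mem A m i v)

/-- The action of `e i` on the highest weight module. -/
def hwE (i : ι) : Module.End ℚ (HW A m) := (opE i).restrict (opE_mem A m i)

/-- The action of `f i` on the highest weight module. -/
def hwF (i : ι) : Module.End ℚ (HW A m) := (opF A m i).restrict (opF_mem A m i)

/-- The action of `h i` on the highest weight module. -/
def hwH (i : ι) : Module.End ℚ (HW A m) := (opH A m i).restrict (opH_mem A m i)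

variable {A m}

theorem coe_hwE (i : ι) (x : HW A m) : (hwE A m i x : List ι → ℚ) = opE i x := rfl

theorem coe_hwF (i : ι) (x : HW A m) : (hwF A m i x : List ι → ℚ) = opF A m i x := rfl

theorem coe_hwH (i : ι) (x : HW A m) : (hwH A m i x : List ι → ℚ) = opH A m i x := rfl

/-- Restriction of operators to an invariant submodule is compatible with brackets. -/
theorem coe_lie_restrict {X Y : Module.End ℚ (HW A m)} {X' Y' : Module.End ℚ (List ι → ℚ)}
    (hX : ∀ x, (X x : List ι → ℚ) = X' x) (hY : ∀ x, (Y x : List ι → ℚ) = Y' x) (x : HW A m) :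
    ((⁅X, Y⁆ : Module.End ℚ (HW A m)) x : List ι → ℚ) =
      (⁅X', Y'⁆ : Module.End ℚ (List ι → ℚ)) x := by
  change ((X (Y x) - Y (X x) : HW A m) : List ι → ℚ) = X' (Y' x) - Y' (X' x)
  rw [Submodule.coe_sub, hX, hY, hY, hX]

theorem lie_hwE_hwF (i j : ι) : ⁅hwE A m i, hwF A m j⁆ = if i = j then hwH A m i else 0 := by
  ext1 x; apply Subtype.ext
  rw [coe_lie_restrict (coe_hwE i) (coe_hwF j), lie_opE_opF]
  by_cases h : i = j
  · subst h; simp [coe_hwH]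
  · simp [h, Ne.symm h]

theorem lie_hwH_hwH (i j : ι) : ⁅hwH A m i, hwH A m j⁆ = 0 := by
  ext1 x; apply Subtype.ext
  rw [coe_lie_restrict (coe_hwH i) (coe_hwH j), lie_opH_opH]; rfl

theorem lie_hwH_hwE (i j : ι) : ⁅hwH A m i, hwE A m j⁆ = A i j • hwE A m j := by
  ext1 x; apply Subtype.ext
  rw [coe_lie_restrict (coe_hwH i) (coe_hwE j), lie_opH_opE]; rfl

theorem lie_hwH_hwF (i j : ι) : ⁅hwH A m i, hwF A m j⁆ = -(A i j • hwF A m j) := by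
  ext1 x; apply Subtype.ext
  rw [coe_lie_restrict (coe_hwH i) (coe_hwF j), lie_opH_opF]; rfl

theorem coe_lie_iterate {X Y : Module.End ℚ (HW A m)} {X' Y' : Module.End ℚ (List ι → ℚ)}
    (hX : ∀ x, (X x : List ι → ℚ) = X' x) (hY : ∀ x, (Y x : List ι → ℚ) = Y' x) (n : ℕ)
    (x : HW A m) :
    ((fun z : Module.End ℚ (HW A m) => ⁅X, z⁆)^[n] Y x : List ι → ℚ) =
      (fun z : Module.End ℚ (List ι → ℚ) => ⁅X', z⁆)^[n] Y' x := by
  induction n generalizing x with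
  | zero => exact hY x
  | succ n ih =>
    rw [Function.iterate_succ_apply', Function.iterate_succ_apply']
    exact coe_lie_restrict hX ih x

section

variable [IsGCM A]

theorem serre_hwF (i j : ι) :
    (fun z : Module.End ℚ (HW A m) => ⁅hwF A m i, z⁆)^[(-A i j).toNat]
      ⁅hwF A m i, hwF A m j⁆ = 0 := by
  ext1 x; apply Subtype.ext
  rw [coe_lie_iterate (coe_hwF i) (coe_lie_restrict (coe_hwF i) (coe_hwF j)), serre_opF]; rfl

/-- The Serre relations between the operators `e i` hold on the highest weight module because the
Serre elements kill the highest weight vector and commute with all `f k`. -/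
theorem serre_hwE (i j : ι) :
    (fun z : Module.End ℚ (HW A m) => ⁅hwE A m i, z⁆)^[(-A i j).toNat]
      ⁅hwE A m i, hwE A m j⁆ = 0 := by
  set S := (fun z : Module.End ℚ (List ι → ℚ) => ⁅opE i, z⁆)^[(-A i j).toNat] ⁅opE i, opE j⁆
    with hS
  have h0 : S hwVec = 0 := by
    have key (n : ℕ) : (fun z : Module.End ℚ (List ι → ℚ) => ⁅opE i, z⁆)^[n] ⁅opE i, opE j⁆
        hwVec = 0 := by
      induction n with
      | zero =>
        change (⁅opE i, opE j⁆ : Module.End ℚ (List ι → ℚ)) hwVec = 0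
        rw [Ring.lie_def, LinearMap.sub_apply, Module.End.mul_apply, Module.End.mul_apply,
          opE_hwVec, opE_hwVec, map_zero, map_zero, sub_zero]
      | succ n ih =>
        rw [Function.iterate_succ_apply', Ring.lie_def, LinearMap.sub_apply, Module.End.mul_apply,
          Module.End.mul_apply, ih, opE_hwVec, map_zero, map_zero, sub_zero]
    exact key _
  have hw (u : List ι) : S (wordVec A m u) = 0 := by
    induction u with
    | nil => exact h0
    | cons k u ih =>
      have := LinearMap.congr_fun (lie_opF_serre_opE A m i j k) (wordVec A m u)
      rw [Ring.lie_def, LinearMap.sub_apply, Module.End.mul_apply, Module.End.mul_apply, ih,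
        map_zero, zero_sub, LinearMap.zero_apply, neg_eq_zero] at this
      exact this
  have hle : hwSubmodule A m ≤ LinearMap.ker S :=
    Submodule.span_le.mpr (by rintro _ ⟨u, rfl⟩; exact hw u)
  ext1 x; apply Subtype.ext
  rw [coe_lie_iterate (coe_hwE i) (coe_lie_restrict (coe_hwE i) (coe_hwE j))]
  exact hle x.2

theorem map_ad_pow {L L' : Type*} [LieRing L] [LieAlgebra ℚ L] [LieRing L'] [LieAlgebra ℚ L']
    (F : L →ₗ⁅ℚ⁆ L') (x y : L) (n : ℕ) :
    F (((LieAlgebra.ad ℚ L x) ^ n) y) = (fun z => ⁅F x, z⁆)^[n] (F y) := by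
  induction n with
  | zero => rfl
  | succ n ih =>
    rw [Function.iterate_succ_apply', pow_succ', Module.End.mul_apply, LieAlgebra.ad_apply,
      LieHom.map_lie, ih]

variable (A m)

/-- The images of the generators under the representation on the highest weight module. -/
def hwGen : CartanMatrix.Generators ι → Module.End ℚ (HW A m)
  | .H i => hwH A m i
  | .E i => hwE A m i
  | .F i => hwF A m i

theorem toIdeal_le_ker :
    CartanMatrix.Relations.toIdeal ℚ A ≤ (FreeLieAlgebra.lift ℚ (hwGen A m)).ker := by
  refine LieSubmodule.lieSpan_le.mpr ?_
  have hof (g) : FreeLieAlgebra.lift ℚ (hwGen A m) (FreeLieAlgebra.of ℚ g) = hwGen A m g :=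
    FreeLieAlgebra.lift_of_apply _ _
  rintro _ (((((⟨⟨i, j⟩, rfl⟩ | ⟨⟨i, j⟩, rfl⟩) | ⟨⟨i, j⟩, rfl⟩) | ⟨⟨i, j⟩, rfl⟩) |
    ⟨⟨i, j⟩, rfl⟩) | ⟨⟨i, j⟩, rfl⟩)
  all_goals rw [SetLike.mem_coe, LieHom.mem_ker]
  · simp only [CartanMatrix.Relations.HH, Function.uncurry, Function.comp, LieHom.map_lie, hof]
    exact lie_hwH_hwH i j
  · simp only [CartanMatrix.Relations.EF, Function.uncurry, Function.comp]
    have := lie_hwE_hwF (A := A) (m := m) i j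
    split_ifs with h
    · rw [if_pos h] at this
      simp only [map_sub, LieHom.map_lie, hof]
      subst h; exact sub_eq_zero.mpr this
    · rw [if_neg h] at this
      simp only [LieHom.map_lie, hof]; exact this
  · simp only [CartanMatrix.Relations.HE, Function.uncurry, Function.comp, map_sub, map_zsmul,
      LieHom.map_lie, hof]
    exact sub_eq_zero.mpr (lie_hwH_hwE i j)
  · simp only [CartanMatrix.Relations.HF, Function.uncurry, Function.comp, map_add, map_zsmul,
      LieHom.map_lie, hof]
    change ⁅hwH A m i, hwF A m j⁆ + A i j • hwF A m j = 0
    rw [lie_hwH_hwF]; exact neg_add_cancel (A i j • hwF A m j)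
  · simp only [CartanMatrix.Relations.adE, Function.uncurry, Function.comp, map_ad_pow,
      LieHom.map_lie, hof]
    exact serre_hwE i j
  · simp only [CartanMatrix.Relations.adF, Function.uncurry, Function.comp, map_ad_pow,
      LieHom.map_lie, hof]
    exact serre_hwF i j

/-- The representation of the Kac-Moody Lie algebra on the highest weight module. -/
def hwRep : LieAlg A →ₗ⁅ℚ⁆ Module.End ℚ (HW A m) where
  toLinearMap := Submodule.liftQ (CartanMatrix.Relations.toIdeal ℚ A).toSubmodule
    (FreeLieAlgebra.lift ℚ (hwGen A m)).toLinearMap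
    fun _ hx => toIdeal_le_ker A m hx
  map_lie' {x y} := by
    obtain ⟨x, rfl⟩ := Submodule.Quotient.mk_surjective _ x
    obtain ⟨y, rfl⟩ := Submodule.Quotient.mk_surjective _ y
    exact (FreeLieAlgebra.lift ℚ (hwGen A m)).map_lie x y

theorem hwRep_e (i : ι) : hwRep A m (e A i) = hwE A m i :=
  FreeLieAlgebra.lift_of_apply (hwGen A m) (.E i)

theorem hwRep_f (i : ι) : hwRep A m (f A i) = hwF A m i :=
  FreeLieAlgebra.lift_of_apply (hwGen A m) (.F i)

end

end HighestWeight

/-! ### Exponentials of locally nilpotent operators -/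

section Exponentials

open Finset

attribute [local instance] LieRing.ofAssociativeRing

variable {V : Type*} [AddCommGroup V] [Module ℚ V]

/-- Local nilpotency of an operator. -/
def LocNil (X : Module.End ℚ V) : Prop := ∀ v, ∃ N, (X ^ N) v = 0

/-- The divided power `X ^ n / n !`. -/
def dpQ (X : Module.End ℚ V) (n : ℕ) : Module.End ℚ V := ((n.factorial : ℚ)⁻¹) • X ^ n

theorem LocNil.neg {X : Module.End ℚ V} (hX : LocNil X) : LocNil (-X) := fun v => by
  obtain ⟨N, hN⟩ := hX v
  refine ⟨N, ?_⟩
  rw [neg_pow, Module.End.mul_apply, hN, map_zero]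

theorem pow_apply_eq_zero_of_le {X : Module.End ℚ V} {v : V} {N n : ℕ} (h : (X ^ N) v = 0)
    (hn : N ≤ n) : (X ^ n) v = 0 := by
  rw [← Nat.sub_add_cancel hn, pow_add, Module.End.mul_apply, h, map_zero]

theorem isDividedPowers_dpQ {X : Module.End ℚ V} (hX : LocNil X) : IsDividedPowers (dpQ X) where
  zero := by simp [dpQ]
  mul a b := by
    rw [dpQ, dpQ, dpQ, smul_mul_smul_comm, ← pow_add, ← Nat.cast_smul_eq_nsmul ℚ, smul_smul]
    congr 1
    have h := Nat.add_choose_mul_factorial_mul_factorial a b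
    have ha := Nat.factorial_ne_zero a
    have hb := Nat.factorial_ne_zero b
    have hab := Nat.factorial_ne_zero (a + b)
    have h' : ((a + b).choose a : ℚ) * a.factorial * b.factorial = (a + b).factorial := by
      rw [Nat.choose_symm_add]; exact_mod_cast h
    field_simp
    linear_combination -h'
  nil w := by
    obtain ⟨N, hN⟩ := hX w
    exact ⟨N, fun n hn => by
      rw [dpQ, LinearMap.smul_apply, pow_apply_eq_zero_of_le hN hn, smul_zero]⟩

theorem dpQ_neg (X : Module.End ℚ V) (n : ℕ) : dpQ (-X) n = (-1 : ℚ) ^ n • dpQ X n := by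
  rw [dpQ, dpQ, smul_comm]
  congr 1
  rw [← neg_one_smul ℚ X, smul_pow]

theorem dexp_dpQ_neg (X : Module.End ℚ V) (r : ℚ) : dexp (dpQ (-X)) r = dexp (dpQ X) (-r) := by
  rw [dexp, dexp]
  congr 1; ext1 n
  rw [dpQ_neg, smul_smul, ← mul_pow]; congr 2; ring

theorem lsum_mul_right {A : Type*} {P : A → Module.End ℚ V} (hP : LocFin P) (Y : Module.End ℚ V) :
    lsum P * Y = lsum fun a => P a * Y := by
  ext1 w
  rw [Module.End.mul_apply, lsum_apply hP, lsum_apply fun w => hP (Y w)]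
  rfl

/-- The Leibniz rule for a power of an operator. -/
theorem pow_mul_eq_sum (X Y : Module.End ℚ V) (n : ℕ) :
    X ^ n * Y = ∑ p ∈ antidiagonal n, n.choose p.1 •
      ((fun z : Module.End ℚ V => ⁅X, z⁆)^[p.1] Y * X ^ p.2) := by
  set ad := fun z : Module.End ℚ V => ⁅X, z⁆ with had
  have hcomm : Commute (LinearMap.mulLeft ℚ X - LinearMap.mulRight ℚ X)
      (LinearMap.mulRight ℚ X) := (LinearMap.commute_mulLeft_right X X).sub_left (Commute.refl _)
  have h := hcomm.add_pow' n
  rw [sub_add_cancel, LinearMap.pow_mulLeft] at h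
  have hit (p : ℕ) (Z : Module.End ℚ V) :
      ((LinearMap.mulLeft ℚ X - LinearMap.mulRight ℚ X) ^ p) Z = ad^[p] Z := by
    rw [Module.End.pow_apply]; rfl
  have h' := LinearMap.congr_fun h Y
  rw [LinearMap.mulLeft_apply, LinearMap.sum_apply] at h'
  rw [h']
  refine sum_congr rfl fun p _ => ?_
  rw [(hcomm.pow_pow _ _).eq, LinearMap.smul_apply, Module.End.mul_apply, hit,
    LinearMap.pow_mulRight, LinearMap.mulRight_apply]

/-- Local nilpotency of `X` at a vector propagates along operators `Y` with `ad X` nilpotent at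
`Y`. -/
theorem exists_pow_apply_eq_zero {X Y : Module.End ℚ V} {N : ℕ}
    (hN : (fun z : Module.End ℚ V => ⁅X, z⁆)^[N] Y = 0) {v : V} (hv : ∃ M, (X ^ M) v = 0) :
    ∃ M, (X ^ M) (Y v) = 0 := by
  obtain ⟨M, hM⟩ := hv
  refine ⟨N + M, ?_⟩
  rw [← Module.End.mul_apply, pow_mul_eq_sum, LinearMap.sum_apply]
  refine sum_eq_zero fun p hp => ?_
  rw [HasAntidiagonal.mem_antidiagonal] at hp
  rcases le_or_gt N p.1 with h | h
  · have : (fun z : Module.End ℚ V => ⁅X, z⁆)^[p.1] Y = 0 := by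
      rw [← Nat.sub_add_cancel h, Function.iterate_add_apply, hN]
      exact Function.iterate_fixed (lie_zero _) _
    rw [this, zero_mul, smul_zero]; rfl
  · rw [LinearMap.smul_apply, Module.End.mul_apply, pow_apply_eq_zero_of_le hM (by omega), map_zero,
      smul_zero]

/-- Conjugation by an exponential is the exponential of the commutator. -/
theorem dexp_mul {X : Module.End ℚ V} (hX : LocNil X) (Y : Module.End ℚ V) {N : ℕ}
    (hN : (fun z : Module.End ℚ V => ⁅X, z⁆)^[N] Y = 0) :
    dexp (dpQ X) 1 * Y =
      (∑ n ∈ range N, ((n.factorial : ℚ)⁻¹) • (fun z : Module.End ℚ V => ⁅X, z⁆)^[n] Y) *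
        dexp (dpQ X) 1 := by
  set ad := fun z : Module.End ℚ V => ⁅X, z⁆ with had
  have hvan (n : ℕ) (hn : N ≤ n) : ad^[n] Y = 0 := by
    rw [← Nat.sub_add_cancel hn, Function.iterate_add_apply, hN]
    exact Function.iterate_fixed (lie_zero _) _
  have hD := isDividedPowers_dpQ hX
  let P : ℕ → Module.End ℚ V := fun n => ((n.factorial : ℚ)⁻¹) • ad^[n] Y
  have hP : LocFin P := fun w => (Set.finite_Iio N).subset fun n hn => by
    by_contra h
    exact hn (by simp only [P]; rw [hvan n (not_lt.mp h), smul_zero]; rfl)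
  have hPs : lsum P = ∑ n ∈ range N, P n := by
    ext1 w
    rw [lsum_eq_sum hP (S := range N), LinearMap.sum_apply]
    intro n hn
    simp only [P]; rw [hvan n (by simpa using hn), smul_zero]; rfl
  rw [← hPs, dexp, (lsum_mul_antidiagonal hP (hD.locFin 1)).2, lsum_mul_right (hD.locFin 1)]
  congr 1
  ext1 n
  rw [one_pow, one_smul, dpQ, smul_mul_assoc, pow_mul_eq_sum, smul_sum]
  refine sum_congr rfl fun p hp => ?_
  rw [HasAntidiagonal.mem_antidiagonal] at hp
  rw [one_pow, one_smul, dpQ, smul_mul_smul_comm, ← Nat.cast_smul_eq_nsmul ℚ, smul_smul]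
  congr 1
  have h := Nat.add_choose_mul_factorial_mul_factorial p.1 p.2
  rw [← Nat.choose_symm_add, hp] at h
  have ha := Nat.factorial_ne_zero p.1
  have hb := Nat.factorial_ne_zero p.2
  have hab := Nat.factorial_ne_zero n
  have h' : (n.choose p.1 : ℚ) * p.1.factorial * p.2.factorial = n.factorial := by
    exact_mod_cast h
  field_simp
  linear_combination h'

theorem dexp_mul_of_lie {X Y Z W : Module.End ℚ V} (hX : LocNil X) (h1 : ⁅X, Y⁆ = Z)
    (h2 : ⁅X, Z⁆ = W) (h3 : ⁅X, W⁆ = 0) :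
    dexp (dpQ X) 1 * Y = (Y + Z + (2⁻¹ : ℚ) • W) * dexp (dpQ X) 1 := by
  rw [dexp_mul hX (N := 3) Y]
  · congr 1
    simp only [sum_range_succ, range_zero, sum_empty, Function.iterate_succ,
      Function.iterate_zero, Function.comp, id, h1, h2, Nat.factorial]
    norm_num
  · simp only [Function.iterate_succ, Function.iterate_zero, Function.comp, id, h1, h2, h3]

/-- The operator `exp E exp (-F) exp E`, which represents the simple reflection. -/
def weylQ (E F : Module.End ℚ V) : Module.End ℚ V :=
  dexp (dpQ E) 1 * dexp (dpQ F) (-1) * dexp (dpQ E) 1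

/-- The inverse of `weylQ E F`. -/
def weylQInv (E F : Module.End ℚ V) : Module.End ℚ V :=
  dexp (dpQ E) (-1) * dexp (dpQ F) 1 * dexp (dpQ E) (-1)

section

variable {E F H : Module.End ℚ V} (hE : LocNil E) (hF : LocNil F)
include hE hF

theorem weylQ_mul_inv : weylQ E F * weylQInv E F = 1 := by
  have h1 := (isDividedPowers_dpQ hE).dexp_mul_neg 1
  have h2 := (isDividedPowers_dpQ hF).dexp_neg_mul 1
  calc weylQ E F * weylQInv E F
      = dexp (dpQ E) 1 * (dexp (dpQ F) (-1) * (dexp (dpQ E) 1 * dexp (dpQ E) (-1)) *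
        dexp (dpQ F) 1) * dexp (dpQ E) (-1) := by rw [weylQ, weylQInv]; noncomm_ring
    _ = 1 := by rw [h1, mul_one, h2, mul_one, h1]

variable (hEF : ⁅E, F⁆ = H) (hHE : ⁅H, E⁆ = (2 : ℤ) • E) (hHF : ⁅H, F⁆ = -((2 : ℤ) • F))
include hEF hHE hHF

/-- The operator `weylQ E F` acts on the Lie algebra spanned by `E`, `F`, `H` as the reflection. -/
theorem weylQ_conj : weylQ E F * E = -F * weylQ E F ∧ weylQ E F * H = -H * weylQ E F := by
  have hEH : ⁅E, H⁆ = -(E + E) := by rw [← lie_skew, hHE, two_zsmul]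
  have hFE : ⁅-F, E⁆ = H := by rw [neg_lie, lie_skew, hEF]
  have hFH : ⁅-F, H⁆ = -(F + F) := by rw [neg_lie, lie_skew, hHF, two_zsmul]
  have hEE : ⁅E, -(E + E)⁆ = 0 := by rw [lie_neg, lie_add, lie_self, add_zero, neg_zero]
  have hFF : ⁅-F, -(F + F)⁆ = 0 := by
    rw [neg_lie, lie_neg, lie_add, lie_self, add_zero, neg_zero, neg_zero]
  have a1 := dexp_mul_of_lie hE (lie_self E) (lie_zero E) (lie_zero E)
  have a2 := dexp_mul_of_lie hE hEH hEE (lie_zero E)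
  have a3 := dexp_mul_of_lie hE hEF hEH hEE
  have b2 := dexp_mul_of_lie hF.neg hFH hFF (lie_zero (-F))
  have b3 := dexp_mul_of_lie hF.neg hFE hFH hFF
  rw [dexp_dpQ_neg] at b2 b3
  rw [smul_zero, add_zero, add_zero] at a1
  rw [smul_zero, add_zero] at a2 b2
  constructor
  · calc weylQ E F * E
        = dexp (dpQ E) 1 * (dexp (dpQ F) (-1) * (dexp (dpQ E) 1 * E)) := by
          simp only [weylQ, mul_assoc]
      _ = dexp (dpQ E) 1 * (E + H + (2⁻¹ : ℚ) • -(F + F)) *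
          (dexp (dpQ F) (-1) * dexp (dpQ E) 1) := by
        rw [a1, ← mul_assoc (dexp (dpQ F) (-1)), b3]; simp only [mul_assoc]
      _ = (E + (H + -(E + E)) - (F + H + (2⁻¹ : ℚ) • -(E + E))) * weylQ E F := by
        rw [show E + H + (2⁻¹ : ℚ) • -(F + F) = E + H - F by module, mul_sub, mul_add, a1, a2, a3,
          ← add_mul, ← sub_mul]
        simp only [weylQ, mul_assoc]
      _ = -F * weylQ E F := by congr 1; module
  · calc weylQ E F * H
        = dexp (dpQ E) 1 * (dexp (dpQ F) (-1) * (dexp (dpQ E) 1 * H)) := by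
          simp only [weylQ, mul_assoc]
      _ = dexp (dpQ E) 1 * ((H + -(F + F)) - ((E + H + (2⁻¹ : ℚ) • -(F + F)) +
          (E + H + (2⁻¹ : ℚ) • -(F + F)))) * (dexp (dpQ F) (-1) * dexp (dpQ E) 1) := by
        rw [a2, ← mul_assoc (dexp (dpQ F) (-1)), ← sub_eq_add_neg, mul_sub, mul_add, b2, b3,
          ← add_mul, ← sub_mul]
        simp only [mul_assoc]
      _ = (-(H + -(E + E)) - (E + E)) * weylQ E F := by
        rw [show (H + -(F + F)) - ((E + H + (2⁻¹ : ℚ) • -(F + F)) +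
          (E + H + (2⁻¹ : ℚ) • -(F + F))) = -H - (E + E) by module, mul_sub, mul_neg, mul_add, a1,
          a2, ← add_mul, ← neg_mul, ← sub_mul]
        simp only [weylQ, mul_assoc]
      _ = -H * weylQ E F := by congr 1; module

end

end Exponentials

/-! ### Admissible lattices and reduction to a field -/

section Lattice

open Finset TensorProduct

variable {V : Type*} [AddCommGroup V] [Module ℚ V] (L : Submodule ℤ V)

/-- A locally nilpotent operator all of whose divided powers preserve the lattice `L`. -/
structure Admissible (X : Module.End ℚ V) : Prop where
  nil : LocNil X
  mem : ∀ n, ∀ x ∈ L, dpQ X n x ∈ L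

open Classical in
/-- The divided power `X ^ n / n !` as an endomorphism of the lattice `L`; it is `0` by convention
if `L` is not preserved. -/
def dpL (X : Module.End ℚ V) (n : ℕ) : Module.End ℤ L :=
  if h : ∀ x ∈ L, dpQ X n x ∈ L then ((dpQ X n).restrictScalars ℤ).restrict h else 0

variable {L}

theorem coe_dpL {X : Module.End ℚ V} (hX : Admissible L X) (n : ℕ) (x : L) :
    (dpL L X n x : V) = dpQ X n x := by
  rw [dpL, dif_pos (hX.mem n)]; rfl

theorem isDividedPowers_dpL {X : Module.End ℚ V} (hX : Admissible L X) :
    IsDividedPowers (dpL L X) where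
  zero := by
    ext x; rw [coe_dpL hX, (isDividedPowers_dpQ hX.nil).zero]; rfl
  mul a b := by
    ext x
    have := LinearMap.congr_fun ((isDividedPowers_dpQ hX.nil).mul a b) x
    rw [Module.End.mul_apply, LinearMap.smul_apply] at this
    rw [Module.End.mul_apply, LinearMap.smul_apply, coe_dpL hX, coe_dpL hX,
      AddSubmonoidClass.coe_nsmul, coe_dpL hX, this]
  nil x := by
    obtain ⟨N, hN⟩ := (isDividedPowers_dpQ hX.nil).nil x
    exact ⟨N, fun n hn => Subtype.ext (by rw [coe_dpL hX, hN n hn]; rfl)⟩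

theorem Admissible.neg {X : Module.End ℚ V} (hX : Admissible L X) : Admissible L (-X) where
  nil := hX.nil.neg
  mem n x hx := by
    rw [dpQ_neg, LinearMap.smul_apply]
    rcases neg_one_pow_eq_or ℚ n with h | h <;> rw [h]
    · rw [one_smul]; exact hX.mem n x hx
    · rw [neg_one_smul]; exact neg_mem (hX.mem n x hx)

/-- An exponential preserves admissible lattices. -/
theorem coe_dexp_dpL {X : Module.End ℚ V} (hX : Admissible L X) (r : ℤ) (x : L) :
    (dexp (dpL L X) r x : V) = dexp (dpQ X) (r : ℚ) x := by
  refine dexp_intertwine (isDividedPowers_dpL hX) (isDividedPowers_dpQ hX.nil)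
    L.subtype.toAddMonoidHom x fun n => ?_
  change ((r ^ n • dpL L X n x : L) : V) = (r : ℚ) ^ n • dpQ X n x
  rw [Submodule.coe_smul, coe_dpL hX, ← Int.cast_pow, Int.cast_smul_eq_zsmul]

/-- Admissibility is preserved under conjugation by an automorphism `T` of the lattice; `T'` is its
inverse. -/
theorem Admissible.conj {X Y T T' : Module.End ℚ V} (hX : Admissible L X) (hTT' : T * T' = 1)
    (hTX : T * X = Y * T) (hT : ∀ x ∈ L, T x ∈ L) (hT' : ∀ x ∈ L, T' x ∈ L) :
    Admissible L Y := by
  have hpow (n : ℕ) : Y ^ n = T * X ^ n * T' := by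
    have : SemiconjBy T (X ^ n) (Y ^ n) := SemiconjBy.pow_right hTX n
    rw [this.eq, mul_assoc, hTT', mul_one]
  constructor
  · intro v
    obtain ⟨N, hN⟩ := hX.nil (T' v)
    exact ⟨N, by rw [hpow, Module.End.mul_apply, Module.End.mul_apply, hN, map_zero]⟩
  · intro n x hx
    have : dpQ Y n = T * dpQ X n * T' := by
      rw [dpQ, dpQ, hpow, mul_smul_comm, smul_mul_assoc]
    rw [this]
    exact hT _ (hX.mem n _ (hT' x hx))

variable {k : Type*} [Field k]

theorem locFin_baseChange {A : Type*} {P : A → Module.End ℤ L} (hP : LocFin P) (c : A → k) :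
    LocFin fun a => c a • (P a).baseChange k := fun w => by
  induction w with
  | zero => simp
  | tmul b x =>
    refine (hP x).subset fun a ha h0 => ha ?_
    simp only [LinearMap.smul_apply, LinearMap.baseChange_tmul]
    rw [show P a x = 0 from h0, tmul_zero, smul_zero]
  | add v w hv hw =>
    refine (hv.union hw).subset fun a ha => ?_
    by_contra h
    rw [Set.mem_union, not_or] at h
    exact ha (by simp only [map_add]; rw [Function.notMem_support.mp h.1,
      Function.notMem_support.mp h.2, add_zero])

theorem isDividedPowers_baseChange {D : ℕ → Module.End ℤ L} (hD : IsDividedPowers D) :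
    IsDividedPowers fun n => (D n).baseChange k where
  zero := by simp [hD.zero]
  mul a b := by
    rw [← LinearMap.baseChange_mul, hD.mul]
    exact map_nsmul (LinearMap.baseChangeHom ℤ k L L) _ _
  nil w := by
    have h := locFin_baseChange (k := k) (P := D) (fun x => ?_) 1 w
    · obtain ⟨N, hN⟩ := h.bddAbove
      refine ⟨N + 1, fun n hn => ?_⟩
      by_contra h0
      have : n ≤ N := hN (by simpa using h0)
      omega
    · obtain ⟨N, hN⟩ := hD.nil x
      exact (Set.finite_Iio N).subset fun n hn => by
        by_contra h; exact hn (hN n (not_lt.mp h))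

theorem dexp_baseChange {D : ℕ → Module.End ℤ L} (hD : IsDividedPowers D) (r : ℤ) :
    (dexp D r).baseChange k = dexp (fun n => (D n).baseChange k) (r : k) := by
  ext x
  simp only [AlgebraTensorModule.curry_apply, curry_apply, LinearMap.restrictScalars_self,
    LinearMap.baseChange_tmul]
  refine dexp_intertwine hD (isDividedPowers_baseChange hD)
    (TensorProduct.mk ℤ k L 1).toAddMonoidHom x fun n => ?_
  change (1 : k) ⊗ₜ[ℤ] (r ^ n • D n x) = (r : k) ^ n • (1 : k) ⊗ₜ[ℤ] D n x
  rw [tmul_smul, ← Int.cast_pow, Int.cast_smul_eq_zsmul]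

variable (L) in
/-- The operator `exp (r X) = ∑ n, r ^ n (X ^ n / n !)` on the reduction `k ⊗ L` of the lattice. -/
def rootOp (X : Module.End ℚ V) (r : k) : Module.End k (k ⊗[ℤ] L) :=
  dexp (fun n => (dpL L X n).baseChange k) r

section

variable {X : Module.End ℚ V} (hX : Admissible L X)
include hX

theorem rootOp_add (r s : k) : rootOp L X (r + s) = rootOp L X r * rootOp L X s :=
  (isDividedPowers_baseChange (isDividedPowers_dpL hX)).dexp_add r s

theorem rootOp_neg (r : k) : rootOp L (-X) r = rootOp L X (-r) := by
  rw [rootOp, rootOp, dexp, dexp]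
  congr 1; ext1 n
  rcases n.even_or_odd with hn | hn
  · have : dpL L (-X) n = dpL L X n := by
      ext x
      rw [coe_dpL hX.neg, coe_dpL hX, dpQ_neg, hn.neg_one_pow, one_smul]
    rw [this, hn.neg_pow]
  · have : dpL L (-X) n = -dpL L X n := by
      ext x
      rw [coe_dpL hX.neg, LinearMap.neg_apply, Submodule.coe_neg, coe_dpL hX, dpQ_neg,
        hn.neg_one_pow, neg_one_smul, LinearMap.neg_apply]
    rw [this, hn.neg_pow, LinearMap.baseChange_neg, smul_neg]
    exact (neg_smul _ _).symm

theorem rootOp_mul_neg (r : k) : rootOp L X r * rootOp L X (-r) = 1 :=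
  (isDividedPowers_baseChange (isDividedPowers_dpL hX)).dexp_mul_neg r

theorem rootOp_neg_mul (r : k) : rootOp L X (-r) * rootOp L X r = 1 :=
  (isDividedPowers_baseChange (isDividedPowers_dpL hX)).dexp_neg_mul r

/-- An endomorphism of the lattice that intertwines `X` and `Y` intertwines their exponentials. -/
theorem rootOp_intertwine {Y TQ : Module.End ℚ V} (hY : Admissible L Y) {T : Module.End ℤ L}
    (hT : ∀ x : L, (T x : V) = TQ x) (h : TQ * X = Y * TQ) (r : k) :
    T.baseChange k * rootOp L X r = rootOp L Y r * T.baseChange k := by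
  have hdp (n : ℕ) : T * dpL L X n = dpL L Y n * T := by
    ext x
    have : TQ * X ^ n = Y ^ n * TQ := SemiconjBy.pow_right (show SemiconjBy TQ X Y from h) n
    rw [Module.End.mul_apply, Module.End.mul_apply, hT, coe_dpL hX, coe_dpL hY, hT, dpQ, dpQ,
      LinearMap.smul_apply, LinearMap.smul_apply, map_smul, ← Module.End.mul_apply, this]
    rfl
  refine LinearMap.ext fun w => ?_
  refine dexp_intertwine (isDividedPowers_baseChange (isDividedPowers_dpL hX))
    (isDividedPowers_baseChange (isDividedPowers_dpL hY)) (T.baseChange k).toAddMonoidHom w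
    fun n => ?_
  change T.baseChange k (r ^ n • (dpL L X n).baseChange k w) =
    r ^ n • (dpL L Y n).baseChange k (T.baseChange k w)
  rw [map_smul, ← Module.End.mul_apply, ← Module.End.mul_apply, ← LinearMap.baseChange_mul,
    ← LinearMap.baseChange_mul, hdp]

end

/-! ### The action of the simple reflections on the lattice -/

variable (L) in
/-- The operator `exp E exp (-F) exp E` on the lattice. -/
def weylL (E F : Module.End ℚ V) : Module.End ℤ L :=
  dexp (dpL L E) 1 * dexp (dpL L F) (-1) * dexp (dpL L E) 1

variable {E F : Module.End ℚ V} (hE : Admissible L E) (hF : Admissible L F)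
include hE hF

theorem coe_weylL (x : L) : (weylL L E F x : V) = weylQ E F x := by
  rw [weylL, weylQ]
  simp only [Module.End.mul_apply, coe_dexp_dpL hE, coe_dexp_dpL hF]
  norm_num

theorem weylQ_mem : ∀ x ∈ L, weylQ E F x ∈ L := fun x hx =>
  coe_weylL hE hF ⟨x, hx⟩ ▸ (weylL L E F ⟨x, hx⟩).2

theorem weylQInv_mem : ∀ x ∈ L, weylQInv E F x ∈ L := fun x hx => by
  have : ((dexp (dpL L E) (-1) * dexp (dpL L F) 1 * dexp (dpL L E) (-1)) ⟨x, hx⟩ : V) =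
      weylQInv E F x := by
    rw [weylQInv]
    simp only [Module.End.mul_apply, coe_dexp_dpL hE, coe_dexp_dpL hF]
    norm_num
  rw [← this]; exact Subtype.coe_prop _

theorem baseChange_weylL :
    (weylL L E F).baseChange k = rootOp L E 1 * rootOp L F (-1) * rootOp L E 1 := by
  rw [weylL, LinearMap.baseChange_mul, LinearMap.baseChange_mul,
    dexp_baseChange (isDividedPowers_dpL hE), dexp_baseChange (isDividedPowers_dpL hF)]
  simp [rootOp]

end Lattice

/-! ### Integrability of the highest weight modules -/

section Integrable

open Finset

attribute [local instance] LieRing.ofAssociativeRing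

variable {ι : Type*} [DecidableEq ι] (A : Matrix ι ι ℤ) (m : ι → ℕ)

theorem lie_lie_eq_zero {V : Type*} [AddCommGroup V] [Module ℚ V] {E H : Module.End ℚ V}
    (hHE : ⁅H, E⁆ = (2 : ℤ) • E) : ⁅E, ⁅E, H⁆⁆ = 0 := by
  rw [← lie_skew E H, hHE, lie_neg, lie_zsmul, lie_self, smul_zero, neg_zero]

/-- The highest weight vector of the highest weight module. -/
def hwv : HW A m := ⟨hwVec, wordVec_mem A m []⟩

variable {A m}

theorem hwE_hwv (i : ι) : hwE A m i (hwv A m) = 0 := Subtype.ext (opE_hwVec i)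

theorem HW.induction {p : HW A m → Prop} (h0 : p (hwv A m)) (hF : ∀ i x, p x → p (hwF A m i x))
    (hadd : ∀ x y, p x → p y → p (x + y)) (hsmul : ∀ (c : ℚ) x, p x → p (c • x)) (x : HW A m) :
    p x := by
  have hw (u : List ι) : p ⟨wordVec A m u, wordVec_mem A m u⟩ := by
    induction u with
    | nil => exact h0
    | cons i u ih => exact hF i _ ih
  obtain ⟨x, hx⟩ := x
  induction hx using Submodule.span_induction with
  | mem x hx => obtain ⟨u, rfl⟩ := hx; exact hw u
  | zero =>
    rw [show (⟨0, zero_mem _⟩ : HW A m) = (0 : ℚ) • hwv A m by rw [zero_smul]; rfl]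
    exact hsmul 0 _ h0
  | add x y hx hy h1 h2 => exact hadd _ _ h1 h2
  | smul c x hx h1 => exact hsmul c _ h1

/-- An operator `X` is locally nilpotent if it is nilpotent on the highest weight vector and
`ad X` is nilpotent on the operators `f j`. -/
theorem locNil_of_lie {X : Module.End ℚ (HW A m)} (h0 : ∃ N, (X ^ N) (hwv A m) = 0)
    (hF : ∀ j, ∃ N, (fun z : Module.End ℚ (HW A m) => ⁅X, z⁆)^[N] (hwF A m j) = 0) : LocNil X := by
  intro x
  induction x using HW.induction with
  | h0 => exact h0
  | hF i x ih => exact (hF i).elim fun N hN => exists_pow_apply_eq_zero hN ih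
  | hadd x y hx hy =>
    obtain ⟨a, ha⟩ := hx
    obtain ⟨b, hb⟩ := hy
    exact ⟨max a b, by rw [map_add, pow_apply_eq_zero_of_le ha (le_max_left _ _),
      pow_apply_eq_zero_of_le hb (le_max_right _ _), add_zero]⟩
  | hsmul c x hx => exact hx.imp fun a ha => by rw [map_smul, ha, smul_zero]

variable [IsGCM A]

variable (A m) in
theorem opE_opF_iterate (i : ι) (p : ℕ) :
    opE i ((opF A m i)^[p + 1] hwVec) = ((p + 1 : ℤ) * (m i - p)) • (opF A m i)^[p] hwVec :=
  (lie_iterate_sl2 (L := Module.End ℚ (List ι → ℚ)) (e := opE i) (h := opH A m i)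
    (f := opF A m i) (y := hwVec) (c := m i) (by rw [lie_opE_opF, if_pos rfl])
    (by rw [lie_opH_opF, IsGCM.diag (A := A)]) (opE_hwVec i)
    (by
      change opH A m i hwVec = _
      rw [opH_hwVec, ← Int.cast_natCast, Int.cast_smul_eq_zsmul]) p).2

omit [IsGCM A] in
theorem opE_opF_iterate_of_ne {k i : ι} (hki : k ≠ i) (p : ℕ) :
    opE k ((opF A m i)^[p] hwVec) = 0 := by
  induction p with
  | zero => exact opE_hwVec k
  | succ p ih =>
    rw [Function.iterate_succ_apply', opE_opF, ih, map_zero, if_neg hki.symm, add_zero]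

/-- The vector `f i ^ (m i + 1) v` vanishes, since it is killed by all `e k`. -/
theorem opF_iterate_eq_zero (i : ι) : (opF A m i)^[m i + 1] hwVec = 0 := by
  ext u
  cases u with
  | nil => rw [Function.iterate_succ_apply']; rfl
  | cons k u =>
    change opE k ((opF A m i)^[m i + 1] hwVec) u = 0
    rcases eq_or_ne k i with rfl | hk
    · rw [opE_opF_iterate, sub_self, mul_zero, zero_smul]; rfl
    · rw [opE_opF_iterate_of_ne hk]; rfl

theorem lie_hwH_hwE_self (i : ι) : ⁅hwH A m i, hwE A m i⁆ = (2 : ℤ) • hwE A m i := by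
  rw [lie_hwH_hwE, IsGCM.diag (A := A)]

theorem lie_hwH_hwF_self (i : ι) : ⁅hwH A m i, hwF A m i⁆ = -((2 : ℤ) • hwF A m i) := by
  rw [lie_hwH_hwF, IsGCM.diag (A := A)]

theorem locNil_hwE (i : ι) : LocNil (hwE A m i) := by
  refine locNil_of_lie ⟨1, by simpa using hwE_hwv i⟩ fun j => ⟨3, ?_⟩
  simp only [Function.iterate_succ, Function.iterate_zero, Function.comp, id, lie_hwE_hwF]
  split_ifs
  · exact lie_lie_eq_zero (lie_hwH_hwE_self i)
  · exact Function.iterate_fixed (f := fun z : Module.End ℚ (HW A m) => ⁅hwE A m i, z⁆)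
      (lie_zero _) 2

theorem locNil_hwF (i : ι) : LocNil (hwF A m i) := by
  refine locNil_of_lie ⟨m i + 1, ?_⟩ fun j =>
    ⟨(-A i j).toNat + 1, serre_hwF i j⟩
  apply Subtype.ext
  have (p : ℕ) : (((hwF A m i) ^ p) (hwv A m) : List ι → ℚ) = (opF A m i)^[p] hwVec := by
    induction p with
    | zero => rfl
    | succ p ih => rw [pow_succ', Module.End.mul_apply, coe_hwF, ih, Function.iterate_succ_apply']
  rw [this, opF_iterate_eq_zero]; rfl

end Integrable

/-! ### The adjoint action of the Chevalley generators -/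

section AdNilpotent

variable {ι : Type*} [DecidableEq ι] (A : Matrix ι ι ℤ)

/-- The Chevalley generator `h i`. -/
def h (i : ι) : LieAlg A :=
  LieSubmodule.Quotient.mk' (CartanMatrix.Relations.toIdeal ℚ A)
    (FreeLieAlgebra.of ℚ (CartanMatrix.Generators.H i))

/-- The quotient map from the free Lie algebra, as a homomorphism of Lie algebras. -/
def mkLie : FreeLieAlgebra ℚ (CartanMatrix.Generators ι) →ₗ⁅ℚ⁆ LieAlg A where
  toLinearMap := (LieSubmodule.Quotient.mk' (CartanMatrix.Relations.toIdeal ℚ A)).toLinearMap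
  map_lie' {_ _} := rfl

theorem mkLie_eq_zero {x : FreeLieAlgebra ℚ (CartanMatrix.Generators ι)}
    (hx : x ∈ CartanMatrix.Relations.toSet ℚ A) : mkLie A x = 0 :=
  (LieSubmodule.Quotient.mk_eq_zero (N := CartanMatrix.Relations.toIdeal ℚ A)).mpr
    (LieSubmodule.subset_lieSpan hx)

theorem lie_e_f (i j : ι) : ⁅e A i, f A j⁆ = if i = j then h A i else 0 := by
  have := mkLie_eq_zero A (x := CartanMatrix.Relations.EF ℚ (i, j)) (by
    simp [CartanMatrix.Relations.toSet])
  simp only [CartanMatrix.Relations.EF, Function.uncurry, Function.comp] at this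
  split_ifs at this ⊢ with hij
  · subst hij; rw [map_sub, LieHom.map_lie, sub_eq_zero] at this; exact this
  · rw [LieHom.map_lie] at this; exact this

theorem lie_h_e (i j : ι) : ⁅h A i, e A j⁆ = A i j • e A j := by
  have := mkLie_eq_zero A (x := CartanMatrix.Relations.HE ℚ A (i, j)) (by
    simp [CartanMatrix.Relations.toSet])
  simp only [CartanMatrix.Relations.HE, Function.uncurry, Function.comp, map_sub, LieHom.map_lie,
    map_zsmul, sub_eq_zero] at this
  exact this

theorem lie_h_f (i j : ι) : ⁅h A i, f A j⁆ = -(A i j • f A j) := by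
  have := mkLie_eq_zero A (x := CartanMatrix.Relations.HF ℚ A (i, j)) (by
    simp [CartanMatrix.Relations.toSet])
  simp only [CartanMatrix.Relations.HF, Function.uncurry, Function.comp, map_add, LieHom.map_lie,
    map_zsmul, add_eq_zero_iff_eq_neg] at this
  exact this

theorem serre_e (i j : ι) :
    ((LieAlgebra.ad ℚ (LieAlg A) (e A i)) ^ (-A i j).toNat) ⁅e A i, e A j⁆ = 0 := by
  have := mkLie_eq_zero A (x := CartanMatrix.Relations.adE ℚ A (i, j)) (by
    simp [CartanMatrix.Relations.toSet])
  simp only [CartanMatrix.Relations.adE, Function.uncurry, Function.comp, map_ad_pow,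
    LieHom.map_lie] at this
  rw [Module.End.pow_apply]
  exact this

theorem serre_f (i j : ι) :
    ((LieAlgebra.ad ℚ (LieAlg A) (f A i)) ^ (-A i j).toNat) ⁅f A i, f A j⁆ = 0 := by
  have := mkLie_eq_zero A (x := CartanMatrix.Relations.adF ℚ A (i, j)) (by
    simp [CartanMatrix.Relations.toSet])
  simp only [CartanMatrix.Relations.adF, Function.uncurry, Function.comp, map_ad_pow,
    LieHom.map_lie] at this
  rw [Module.End.pow_apply]
  exact this

theorem lieSubalgebra_eq_top {K : LieSubalgebra ℚ (LieAlg A)} (he : ∀ i, e A i ∈ K)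
    (hf : ∀ i, f A i ∈ K) : K = ⊤ := by
  have hh (i : ι) : h A i ∈ K := by
    have := K.lie_mem (he i) (hf i)
    rwa [lie_e_f, if_pos rfl] at this
  let g : CartanMatrix.Generators ι → K
    | .H i => ⟨h A i, hh i⟩
    | .E i => ⟨e A i, he i⟩
    | .F i => ⟨f A i, hf i⟩
  have hg : K.incl.comp (FreeLieAlgebra.lift ℚ g) = mkLie A := by
    refine FreeLieAlgebra.hom_ext fun x => ?_
    rw [LieHom.comp_apply, FreeLieAlgebra.lift_of_apply]
    cases x <;> rfl
  rw [eq_top_iff]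
  rintro x -
  obtain ⟨x, rfl⟩ := LieSubmodule.Quotient.surjective_mk' _ x
  have := LieHom.congr_fun hg x
  exact this ▸ (FreeLieAlgebra.lift ℚ g x).2

/-- `ad (e i)` is locally nilpotent. -/
theorem exists_ad_e_pow (i : ι) (x : LieAlg A) :
    ∃ N, ((LieAlgebra.ad ℚ (LieAlg A) (e A i)) ^ N) x = 0 := by
  rw [← LieSubalgebra.mem_engel_iff, lieSubalgebra_eq_top A (K := LieSubalgebra.engel ℚ (e A i))]
  · trivial
  · intro j
    exact (LieSubalgebra.mem_engel_iff _ _ _).mpr ⟨(-A i j).toNat + 1, by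
      rw [pow_succ, Module.End.mul_apply, LieAlgebra.ad_apply, serre_e]⟩
  · intro j
    refine (LieSubalgebra.mem_engel_iff _ _ _).mpr ⟨3, ?_⟩
    simp only [pow_succ, pow_zero, one_mul, Module.End.mul_apply, LieAlgebra.ad_apply, lie_e_f]
    split_ifs
    · rw [← lie_skew (e A i) (h A i), lie_h_e, lie_neg, lie_zsmul, lie_self, smul_zero, neg_zero]
    · rw [lie_zero, lie_zero]

/-- `ad (f i)` is locally nilpotent. -/
theorem exists_ad_f_pow (i : ι) (x : LieAlg A) :
    ∃ N, ((LieAlgebra.ad ℚ (LieAlg A) (f A i)) ^ N) x = 0 := by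
  rw [← LieSubalgebra.mem_engel_iff, lieSubalgebra_eq_top A (K := LieSubalgebra.engel ℚ (f A i))]
  · trivial
  · intro j
    refine (LieSubalgebra.mem_engel_iff _ _ _).mpr ⟨3, ?_⟩
    simp only [pow_succ, pow_zero, one_mul, Module.End.mul_apply, LieAlgebra.ad_apply]
    rw [← lie_skew (f A i) (e A j), lie_e_f]
    split_ifs with hij
    · subst hij
      rw [lie_neg, ← lie_skew (f A j) (h A j), neg_neg, lie_h_f, lie_neg, lie_zsmul, lie_self,
        smul_zero, neg_zero]
    · rw [neg_zero, lie_zero, lie_zero]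
  · intro j
    exact (LieSubalgebra.mem_engel_iff _ _ _).mpr ⟨(-A i j).toNat + 1, by
      rw [pow_succ, Module.End.mul_apply, LieAlgebra.ad_apply, serre_f]⟩

end AdNilpotent

/-! ### Implementing the Weyl group in representations -/

section SStar

open Finset

attribute [local instance] LieRing.ofAssociativeRing

variable {ι : Type*} [DecidableEq ι] {A : Matrix ι ι ℤ} {V : Type*} [AddCommGroup V] [Module ℚ V]
  (ρ : LieAlg A →ₗ⁅ℚ⁆ Module.End ℚ V)

theorem dexp_mul_rep {y : LieAlg A} (hρ : LocNil (ρ y)) (x : LieAlg A)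
    (hy : ∃ N, ((LieAlgebra.ad ℚ (LieAlg A) y) ^ N) x = 0) :
    dexp (dpQ (ρ y)) 1 * ρ x = ρ (expAd A y x) * dexp (dpQ (ρ y)) 1 := by
  obtain ⟨N, hN⟩ := hy
  rw [dexp_mul hρ (N := N) (ρ x) (by rw [← map_ad_pow, hN, map_zero]), expAd,
    finsum_eq_sum_of_support_subset (s := range N), map_sum]
  · congr 1
    refine sum_congr rfl fun n _ => ?_
    rw [map_smul, map_ad_pow]
  · intro n hn
    by_contra h
    rw [coe_range, Set.mem_Iio, not_lt] at h
    exact hn (by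
      change ((n.factorial : ℚ)⁻¹) • ((LieAlgebra.ad ℚ (LieAlg A) y) ^ n) x = 0
      rw [← Nat.sub_add_cancel h, pow_add, Module.End.mul_apply, hN, map_zero, smul_zero])

/-- The operator `exp (e i) exp (-f i) exp (e i)` implements the automorphism `sStar i`. -/
theorem weylQ_mul_rep (i : ι) (hE : LocNil (ρ (e A i))) (hF : LocNil (ρ (f A i))) (x : LieAlg A) :
    weylQ (ρ (e A i)) (ρ (f A i)) * ρ x =
      ρ (sStar A i x) * weylQ (ρ (e A i)) (ρ (f A i)) := by
  have h1 := dexp_mul_rep ρ hE x (exists_ad_e_pow A i _)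
  have h2 := dexp_mul_rep ρ (y := -f A i) (by rw [map_neg]; exact hF.neg) (expAd A (e A i) x) (by
    obtain ⟨N, hN⟩ := exists_ad_f_pow A i (expAd A (e A i) x)
    refine ⟨N, ?_⟩
    rw [map_neg, neg_pow, Module.End.mul_apply, hN, map_zero])
  have h3 := dexp_mul_rep ρ hE (expAd A (-f A i) (expAd A (e A i) x)) (exists_ad_e_pow A i _)
  rw [map_neg, dexp_dpQ_neg] at h2
  rw [weylQ, mul_assoc, h1, ← mul_assoc, mul_assoc _ _ (ρ (expAd A (e A i) x)), h2, ← mul_assoc,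
    h3, sStar]
  simp only [mul_assoc]

end SStar

/-! ### Products of divided powers in `sl₂` -/

section Kostant

open Finset

attribute [local instance] LieRing.ofAssociativeRing

variable {V : Type*} [AddCommGroup V] [Module ℚ V]

/-- Divided powers with exponents in `ℤ`, which vanish for negative exponents. -/
def dpZ (X : Module.End ℚ V) (q : ℤ) : Module.End ℚ V := if 0 ≤ q then dpQ X q.toNat else 0

theorem dpZ_natCast (X : Module.End ℚ V) (n : ℕ) : dpZ X n = dpQ X n := by simp [dpZ]

theorem mul_dpQ (X : Module.End ℚ V) (n : ℕ) :
    X * dpQ X n = ((n + 1 : ℕ) : ℚ) • dpQ X (n + 1) := by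
  rw [dpQ, dpQ, mul_smul_comm, ← pow_succ', smul_smul, Nat.factorial_succ]
  congr 1
  have := Nat.factorial_ne_zero n
  push_cast
  field_simp

variable {E F H : Module.End ℚ V} (hEF : ⁅E, F⁆ = H) (hHE : ⁅H, E⁆ = (2 : ℤ) • E)
  (hHF : ⁅H, F⁆ = -((2 : ℤ) • F))

include hHE in
theorem weight_dpQ {x : V} {μ : ℤ} (hx : H x = (μ : ℚ) • x) (n : ℕ) :
    H (dpQ E n x) = ((μ + 2 * n : ℤ) : ℚ) • dpQ E n x := by
  have hEx (y : V) : H (E y) = E (H y) + (2 : ℚ) • E y := by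
    have := LinearMap.congr_fun hHE y
    rw [Ring.lie_def, LinearMap.sub_apply, sub_eq_iff_eq_add'] at this
    rw [Module.End.mul_apply, Module.End.mul_apply] at this
    rw [this, LinearMap.smul_apply]; congr 1; module
  have (n : ℕ) : H ((E ^ n) x) = ((μ + 2 * n : ℤ) : ℚ) • (E ^ n) x := by
    induction n with
    | zero => simpa using hx
    | succ n ih =>
      rw [pow_succ', Module.End.mul_apply, hEx, ih, map_smul]; push_cast; module
  rw [dpQ, LinearMap.smul_apply, map_smul, this, smul_comm]

include hEF hHF in
theorem e_dpZ_f {y : V} {μ : ℤ} (hy : H y = (μ : ℚ) • y) (q : ℤ) :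
    E (dpZ F q y) = dpZ F q (E y) + ((μ - q + 1 : ℤ) : ℚ) • dpZ F (q - 1) y := by
  have hEFx (y : V) : E (F y) = F (E y) + H y := by
    have := LinearMap.congr_fun hEF y
    rw [Ring.lie_def, LinearMap.sub_apply, sub_eq_iff_eq_add'] at this
    exact this
  have hHFx (y : V) : H (F y) = F (H y) - (2 : ℚ) • F y := by
    have := LinearMap.congr_fun hHF y
    rw [Ring.lie_def, LinearMap.sub_apply, sub_eq_iff_eq_add'] at this
    rw [Module.End.mul_apply, Module.End.mul_apply] at this
    rw [this, LinearMap.neg_apply, LinearMap.smul_apply, sub_eq_add_neg]; congr 1; module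
  have hH (n : ℕ) : H ((F ^ n) y) = ((μ - 2 * n : ℤ) : ℚ) • (F ^ n) y := by
    induction n with
    | zero => simpa using hy
    | succ n ih =>
      rw [pow_succ', Module.End.mul_apply, hHFx, ih, map_smul]; push_cast; module
  have key (n : ℕ) : E ((F ^ (n + 1)) y) =
      (F ^ (n + 1)) (E y) + (((n + 1) * (μ - n) : ℤ) : ℚ) • (F ^ n) y := by
    induction n with
    | zero => simp [hEFx, hy]
    | succ n ih =>
      rw [pow_succ' F (n + 1), Module.End.mul_apply, hEFx, ih, hH, map_add, map_smul,
        Module.End.mul_apply, ← Module.End.mul_apply F (F ^ n), ← pow_succ']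
      push_cast; module
  rcases lt_trichotomy q 0 with hq | rfl | hq
  · rw [dpZ, if_neg (by omega), dpZ, if_neg (by omega)]; simp
  · simp [dpZ, dpQ]
  · obtain ⟨n, rfl⟩ : ∃ n : ℕ, q = (n + 1 : ℕ) := ⟨(q - 1).toNat, by omega⟩
    rw [dpZ_natCast, show ((n + 1 : ℕ) : ℤ) - 1 = n by push_cast; ring, dpZ_natCast, dpQ, dpQ,
      LinearMap.smul_apply, LinearMap.smul_apply, LinearMap.smul_apply, map_smul, key, smul_add,
      smul_smul, smul_smul, Nat.factorial_succ]
    congr 2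
    have := Nat.factorial_ne_zero n
    push_cast
    field_simp
    ring

theorem succ_mul_choose (N : ℤ) (k : ℕ) :
    ((k + 1 : ℕ) : ℤ) * Ring.choose N (k + 1) = (N - k) * Ring.choose N k := by
  have := Ring.choose_smul_choose N (Nat.le_succ k)
  rw [Nat.choose_succ_self_right, Nat.succ_sub (le_refl k), Nat.sub_self, Ring.choose_one_right,
    nsmul_eq_mul] at this
  rw [mul_comm (N - k)]
  exact this

include hEF hHE hHF in
/-- Kostant's commutation formula for divided powers, evaluated at a weight vector. -/
theorem kostant {x : V} {μ : ℤ} (hx : H x = (μ : ℚ) • x) (p : ℤ) (n : ℕ) :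
    dpQ E n (dpZ F p x) = ∑ q ∈ antidiagonal n,
      ((Ring.choose (μ + n - p) q.1 : ℤ) : ℚ) • dpZ F (p - q.1) (dpQ E q.2 x) := by
  induction n with
  | zero => simp [dpQ]
  | succ n ih =>
    have hn : ((n + 1 : ℕ) : ℚ) ≠ 0 := by positivity
    rw [← smul_right_inj hn, ← LinearMap.smul_apply, ← mul_dpQ, Module.End.mul_apply, ih, map_sum]
    set N : ℤ := μ + n - p with hN
    have hN1 : μ + ((n + 1 : ℕ) : ℤ) - p = N + 1 := by rw [hN]; push_cast; ring
    rw [hN1]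
    set T : ℕ × ℕ → V := fun q => dpZ F (p - q.1) (dpQ E q.2 x) with hT
    -- Each term contributes to the two neighbouring terms of the next diagonal.
    have step (q : ℕ × ℕ) (hq : q ∈ antidiagonal n) :
        E (((Ring.choose N q.1 : ℤ) : ℚ) • dpZ F (p - q.1) (dpQ E q.2 x)) =
          ((q.2 + 1 : ℕ) * (Ring.choose N q.1 : ℤ) : ℚ) • T (q.1, q.2 + 1) +
          ((Ring.choose N q.1 : ℤ) * (N + q.2 + 1) : ℚ) • T (q.1 + 1, q.2) := by
      rw [HasAntidiagonal.mem_antidiagonal] at hq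
      rw [map_smul, e_dpZ_f hEF hHF (weight_dpQ hHE hx q.2), ← Module.End.mul_apply E, mul_dpQ,
        LinearMap.smul_apply, map_smul, smul_add, smul_smul, smul_smul, hT]
      have : ((μ + 2 * q.2 - (p - q.1) + 1 : ℤ) : ℚ) = N + q.2 + 1 := by
        rw [hN, ← hq]; push_cast; ring
      rw [this]
      congr 1
      · rw [mul_comm]
      · congr 3; push_cast; ring
    rw [sum_congr rfl step, sum_add_distrib, smul_sum]
    have e1 : ∑ q ∈ antidiagonal n,
          ((q.2 + 1 : ℕ) * (Ring.choose N q.1 : ℤ) : ℚ) • T (q.1, q.2 + 1) =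
        ∑ q ∈ antidiagonal (n + 1), (q.2 * (Ring.choose N q.1 : ℤ) : ℚ) • T q := by
      rw [Nat.sum_antidiagonal_succ']; simp
    have e2 : ∑ q ∈ antidiagonal n,
          ((Ring.choose N q.1 : ℤ) * (N + q.2 + 1) : ℚ) • T (q.1 + 1, q.2) =
        ∑ q ∈ antidiagonal (n + 1),
          ((n + 1 : ℕ) * (Ring.choose (N + 1) q.1 : ℤ) -
            q.2 * (Ring.choose N q.1 : ℤ) : ℚ) • T q := by
      rw [Nat.sum_antidiagonal_succ]
      simp only [Ring.choose_zero_right]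
      rw [Int.cast_one, mul_one, sub_self, zero_smul, zero_add]
      refine sum_congr rfl fun q hq => ?_
      rw [HasAntidiagonal.mem_antidiagonal] at hq
      congr 1
      rw [Ring.choose_succ_succ]
      have h1 : (((q.1 + 1 : ℕ) : ℚ)) * (Ring.choose N (q.1 + 1) : ℤ) =
          (N - q.1) * (Ring.choose N q.1 : ℤ) := by
        exact_mod_cast succ_mul_choose N q.1
      have h2 : (n : ℚ) = q.1 + q.2 := by rw [← hq]; push_cast; rfl
      push_cast at h1 ⊢
      rw [h2]
      linear_combination -h1
    rw [e1, e2, ← sum_add_distrib]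
    refine sum_congr rfl fun q _ => ?_
    rw [← add_smul, smul_smul]
    congr 1
    ring

end Kostant

/-! ### The grading by the root lattice -/

section Grading

variable {ι : Type*} [DecidableEq ι] (A : Matrix ι ι ℤ) (m : ι → ℕ)

/-- The number of occurrences of each letter in a word, as an element of the root lattice. -/
def content (u : List ι) : ι → ℤ := (u.map fun i => Pi.single i (1 : ℤ)).sum

theorem content_cons (i : ι) (u : List ι) :
    content (i :: u) = Pi.single i (1 : ℤ) + content u := by
  rw [content, List.map_cons, List.sum_cons]; rfl

/-- The vectors of weight `λ - ν`, where `λ` is the highest weight and the degree `ν` stands for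
`∑ i, ν i α i`. The degree is kept, rather than the weight, since the simple roots may be linearly
dependent. -/
def IsHomog (ν : ι → ℤ) (φ : List ι → ℚ) : Prop := ∀ u, φ u ≠ 0 → content u = ν

/-- The pairing of `h i` with the weight `λ - ν`, where `λ` is the highest weight. -/
def weightAt [Fintype ι] (i : ι) (ν : ι → ℤ) : ℤ := m i - ∑ j, A i j * ν j

theorem wordWeight_eq [Fintype ι] (i : ι) (u : List ι) :
    wordWeight A m i u = weightAt A m i (content u) := by
  rw [wordWeight, weightAt]
  congr 1
  induction u with
  | nil => simp [content]
  | cons j u ih =>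
    rw [List.map_cons, List.sum_cons, ih, content_cons]
    simp [mul_add, Finset.sum_add_distrib, Pi.single_apply]

variable {A m}

theorem IsHomog.opE {ν : ι → ℤ} {φ : List ι → ℚ} (hφ : IsHomog ν φ) (i : ι) :
    IsHomog (ν - Pi.single i 1) (opE i φ) := fun u hu => by
  rw [← hφ (i :: u) hu, content_cons]; abel

theorem IsHomog.opF {ν : ι → ℤ} {φ : List ι → ℚ} (hφ : IsHomog ν φ) (i : ι) :
    IsHomog (ν + Pi.single i 1) (opF A m i φ) := fun u hu => by
  induction u generalizing φ ν with
  | nil => exact absurd (opF_nil A m i φ) hu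
  | cons j u ih =>
    rw [opF_cons] at hu
    by_cases h0 : KacMoody.opF A m i (KacMoody.opE j φ) u = 0
    · rw [h0, zero_add] at hu
      split_ifs at hu with hij
      · subst hij
        rw [content_cons, hφ u fun h => hu (by rw [opH_apply, h, mul_zero]), add_comm]
      · exact absurd rfl hu
    · rw [content_cons, ih (hφ.opE j) h0]; abel

theorem IsHomog.opH_apply [Fintype ι] {ν : ι → ℤ} {φ : List ι → ℚ} (hφ : IsHomog ν φ) (i : ι) :
    opH A m i φ = (weightAt A m i ν : ℚ) • φ := by
  ext u
  rw [KacMoody.opH_apply, Pi.smul_apply, smul_eq_mul]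
  by_cases h : φ u = 0
  · rw [h, mul_zero, mul_zero]
  · rw [wordWeight_eq, hφ u h]

theorem IsHomog.smul {ν : ι → ℤ} {φ : List ι → ℚ} (hφ : IsHomog ν φ) (c : ℚ) :
    IsHomog ν (c • φ) := fun u hu => hφ u fun h => hu (by rw [Pi.smul_apply, h, smul_zero])

theorem isHomog_hwv : IsHomog 0 (hwv A m : List ι → ℚ) := fun u hu => by
  rcases eq_or_ne u [] with rfl | h
  · rfl
  · exact absurd (Pi.single_eq_of_ne h _) hu

theorem IsHomog.hwF_pow {ν : ι → ℤ} {x : HW A m} (hx : IsHomog ν (x : List ι → ℚ)) (i : ι) (n : ℕ) :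
    IsHomog (ν + (n : ℤ) • Pi.single i 1) (dpQ (hwF A m i) n x : List ι → ℚ) := by
  refine IsHomog.smul ?_ _
  induction n with
  | zero => simpa using hx
  | succ n ih =>
    rw [pow_succ', Module.End.mul_apply, show ν + ((n + 1 : ℕ) : ℤ) • Pi.single i (1 : ℤ) =
      ν + (n : ℤ) • Pi.single i 1 + Pi.single i 1 by push_cast; module]
    exact ih.opF i

theorem IsHomog.hwE_pow {ν : ι → ℤ} {x : HW A m} (hx : IsHomog ν (x : List ι → ℚ)) (i : ι) (n : ℕ) :
    IsHomog (ν - (n : ℤ) • Pi.single i 1) (dpQ (hwE A m i) n x : List ι → ℚ) := by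
  refine IsHomog.smul ?_ _
  induction n with
  | zero => simpa using hx
  | succ n ih =>
    rw [pow_succ', Module.End.mul_apply, show ν - ((n + 1 : ℕ) : ℤ) • Pi.single i (1 : ℤ) =
      ν - (n : ℤ) • Pi.single i 1 - Pi.single i 1 by push_cast; module]
    exact ih.opE i

end Grading

/-! ### The lattice in a highest weight module -/

section HWLattice

open Finset

attribute [local instance] LieRing.ofAssociativeRing

variable {ι : Type*} [DecidableEq ι] (A : Matrix ι ι ℤ) (m : ι → ℕ)

/-- The vectors `f i₁ ^ (n₁) f i₂ ^ (n₂) ⋯ v`, products of divided powers applied to the highest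
weight vector. -/
def dpWord (l : List (ι × ℕ)) : HW A m := l.foldr (fun p x => dpQ (hwF A m p.1) p.2 x) (hwv A m)

/-- The Kostant lattice: the lattice spanned by the products of divided powers of the `f i`, applied
to the highest weight vector. -/
def hwLattice : Submodule ℤ (HW A m) := Submodule.span ℤ (Set.range (dpWord A m))

variable {A m}

theorem dpWord_mem (l : List (ι × ℕ)) : dpWord A m l ∈ hwLattice A m :=
  Submodule.subset_span ⟨l, rfl⟩

theorem hwv_mem : hwv A m ∈ hwLattice A m := dpWord_mem []

theorem mem_of_dpWord {X : Module.End ℚ (HW A m)} (h : ∀ l, X (dpWord A m l) ∈ hwLattice A m) :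
    ∀ x ∈ hwLattice A m, X x ∈ hwLattice A m :=
  Submodule.span_le (p := (hwLattice A m).comap (X.restrictScalars ℤ)).mpr
    (by rintro _ ⟨l, rfl⟩; exact h l)

theorem dpQ_hwF_mem (i : ι) (n : ℕ) : ∀ x ∈ hwLattice A m, dpQ (hwF A m i) n x ∈ hwLattice A m :=
  mem_of_dpWord fun l => dpWord_mem ((i, n) :: l)

theorem dpZ_hwF_mem (i : ι) (q : ℤ) : ∀ x ∈ hwLattice A m, dpZ (hwF A m i) q x ∈ hwLattice A m := by
  intro x hx
  rw [dpZ]; split_ifs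
  · exact dpQ_hwF_mem i _ x hx
  · exact zero_mem _

theorem exists_isHomog_dpWord (l : List (ι × ℕ)) :
    ∃ ν, IsHomog ν (dpWord A m l : List ι → ℚ) := by
  induction l with
  | nil => exact ⟨0, isHomog_hwv⟩
  | cons p l ih => exact ih.imp' _ fun ν hν => hν.hwF_pow p.1 p.2

theorem IsHomog.hwH_apply [Fintype ι] {ν : ι → ℤ} {x : HW A m} (hx : IsHomog ν (x : List ι → ℚ))
    (i : ι) : hwH A m i x = (weightAt A m i ν : ℚ) • x := Subtype.ext (hx.opH_apply i)

theorem commute_hwE_hwF {i j : ι} (hij : i ≠ j) : Commute (hwE A m i) (hwF A m j) := by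
  have := lie_hwE_hwF (A := A) (m := m) i j
  rw [if_neg hij] at this
  exact LinearMap.ext fun x => sub_eq_zero.mp (LinearMap.congr_fun this x)

variable [IsGCM A] [Fintype ι]

/-- The divided powers of `e i` preserve the lattice: they are moved past those of the `f j` by the
formula `kostant`, until they reach the highest weight vector, which they kill. -/
theorem dpQ_hwE_mem (i : ι) (n : ℕ) : ∀ x ∈ hwLattice A m, dpQ (hwE A m i) n x ∈ hwLattice A m := by
  refine mem_of_dpWord fun l => ?_
  induction l generalizing n with
  | nil =>
    cases n with
    | zero => simpa [dpQ] using dpWord_mem []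
    | succ n =>
      have : dpQ (hwE A m i) (n + 1) (dpWord A m []) = 0 := by
        rw [dpQ, LinearMap.smul_apply, pow_succ, Module.End.mul_apply]
        change _ • (hwE A m i ^ n) (hwE A m i (hwv A m)) = 0
        rw [hwE_hwv, map_zero, smul_zero]
      rw [this]; exact zero_mem _
  | cons p l ih =>
    obtain ⟨j, p⟩ := p
    change dpQ (hwE A m i) n (dpQ (hwF A m j) p (dpWord A m l)) ∈ _
    rcases eq_or_ne i j with rfl | hij
    · obtain ⟨ν, hν⟩ := exists_isHomog_dpWord (A := A) (m := m) l
      have hμ := hν.hwH_apply i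
      rw [← dpZ_natCast _ p, kostant (by simpa using lie_hwE_hwF i i) (lie_hwH_hwE_self i)
        (lie_hwH_hwF_self i) hμ]
      refine sum_mem fun q _ => ?_
      rw [Int.cast_smul_eq_zsmul]
      exact Submodule.smul_mem _ _ (dpZ_hwF_mem i _ _ (ih _))
    · have : dpQ (hwE A m i) n * dpQ (hwF A m j) p = dpQ (hwF A m j) p * dpQ (hwE A m i) n := by
        rw [dpQ, dpQ, smul_mul_smul_comm, smul_mul_smul_comm, mul_comm,
          ((commute_hwE_hwF hij).pow_pow n p).eq]
      rw [← Module.End.mul_apply, this]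
      exact dpQ_hwF_mem j p _ (ih n)

theorem admissible_hwE (i : ι) : Admissible (hwLattice A m) (hwE A m i) :=
  ⟨locNil_hwE i, dpQ_hwE_mem i⟩

theorem admissible_hwF (i : ι) : Admissible (hwLattice A m) (hwF A m i) :=
  ⟨locNil_hwF i, dpQ_hwF_mem i⟩

/-- All real root vectors act admissibly, because the lifts of the simple reflections preserve the
lattice and conjugate the operators of root vectors into each other. -/
theorem admissible_of_isRootVector {c : ι → ℤ} {E : LieAlg A}
    (hE : IsRootVector A c E) : Admissible (hwLattice A m) (hwRep A m E) := by
  induction hE with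
  | pos i => rw [hwRep_e]; exact admissible_hwE i
  | neg i => rw [hwRep_f]; exact admissible_hwF i
  | opp _ ih => rw [map_neg]; exact ih.neg
  | refl i _ ih =>
    have hE : Admissible (hwLattice A m) (hwRep A m (e A i)) := by
      rw [hwRep_e]; exact admissible_hwE i
    have hF : Admissible (hwLattice A m) (hwRep A m (f A i)) := by
      rw [hwRep_f]; exact admissible_hwF i
    exact ih.conj (weylQ_mul_inv hE.nil hF.nil) (weylQ_mul_rep _ i hE.nil hF.nil _)
      (weylQ_mem hE hF) (weylQInv_mem hE hF)

end HWLattice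

/-! ### Evaluation of the commutator formulas -/

section Evaluation

open Finset TensorProduct

attribute [local instance] LieRing.ofAssociativeRing

variable {U V k : Type*} [Ring U] [Algebra ℚ U] [AddCommGroup V] [Module ℚ V] [Field k]
  (Φ : U →ₐ[ℚ] Module.End ℚ V) (L : Submodule ℤ V) (r s : k)

/-- The coefficients of the power series `S` preserve the lattice `L`, and `T` is the value of `S`
at `(r, s)`, as an operator on the reduction `k ⊗ L` of the lattice. -/
def EvalsTo (S : MvPowerSeries (Fin 2) U) (T : Module.End k (k ⊗[ℤ] L)) : Prop :=
  ∃ c : (Fin 2 →₀ ℕ) → Module.End ℤ L, LocFin c ∧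
    (∀ d x, (c d x : V) = Φ (MvPowerSeries.coeff d S) x) ∧
    T = lsum fun d => (r ^ d 0 * s ^ d 1) • (c d).baseChange k

variable {Φ L r s}

theorem EvalsTo.unique {S : MvPowerSeries (Fin 2) U} {T T' : Module.End k (k ⊗[ℤ] L)}
    (h : EvalsTo Φ L r s S T) (h' : EvalsTo Φ L r s S T') : T = T' := by
  obtain ⟨c, -, hc, rfl⟩ := h
  obtain ⟨c', -, hc', rfl⟩ := h'
  have : c = c' := funext fun d => LinearMap.ext fun x =>
    Subtype.ext ((hc d x).trans (hc' d x).symm)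
  rw [this]

theorem EvalsTo.one : EvalsTo Φ L r s 1 1 := by
  classical
  have h := locFin_single (R := ℤ) (W := L) (0 : Fin 2 →₀ ℕ) 1
  refine ⟨_, h.1, fun d x => ?_, LinearMap.ext fun w => ?_⟩
  · rw [MvPowerSeries.coeff_one]; split_ifs <;> simp
  · rw [lsum_eq_single (locFin_baseChange h.1 _) 0 fun d hd => by simp [hd]]
    simp

theorem EvalsTo.mul {S S' : MvPowerSeries (Fin 2) U} {T T' : Module.End k (k ⊗[ℤ] L)}
    (h : EvalsTo Φ L r s S T) (h' : EvalsTo Φ L r s S' T') : EvalsTo Φ L r s (S * S') (T * T') := by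
  classical
  obtain ⟨c, hfc, hc, rfl⟩ := h
  obtain ⟨c', hfc', hc', rfl⟩ := h'
  refine ⟨_, (lsum_mul_antidiagonal hfc hfc').1, fun d x => ?_, ?_⟩
  · rw [MvPowerSeries.coeff_mul, map_sum, LinearMap.sum_apply, LinearMap.sum_apply,
      Submodule.coe_sum]
    refine sum_congr rfl fun p _ => ?_
    rw [Module.End.mul_apply, hc, hc', map_mul, Module.End.mul_apply]
  · rw [(lsum_mul_antidiagonal (locFin_baseChange hfc _) (locFin_baseChange hfc' _)).2]
    congr 1; ext1 d
    rw [← LinearMap.baseChangeHom_apply, map_sum, smul_sum]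
    refine sum_congr rfl fun p hp => ?_
    rw [HasAntidiagonal.mem_antidiagonal] at hp
    rw [smul_mul_smul_comm, ← LinearMap.baseChange_mul, LinearMap.baseChangeHom_apply, ← hp]
    congr 1
    simp only [Finsupp.add_apply, pow_add]
    ring

theorem EvalsTo.list_prod {α : Type*} {S : α → MvPowerSeries (Fin 2) U}
    {T : α → Module.End k (k ⊗[ℤ] L)} (l : List α) (h : ∀ x ∈ l, EvalsTo Φ L r s (S x) (T x)) :
    EvalsTo Φ L r s (l.map S).prod (l.map T).prod := by
  induction l with
  | nil => exact EvalsTo.one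
  | cons x l ih =>
    rw [List.map_cons, List.map_cons, List.prod_cons, List.prod_cons]
    exact (h x (by simp)).mul (ih fun y hy => h y (by simp [hy]))

/-- The exponent of the `n`-th term of a formal exponential. -/
def expDegree (p q n : ℕ) : Fin 2 →₀ ℕ := Finsupp.equivFunOnFinite.symm ![n * p, n * q]

theorem expDegree_injective {p q : ℕ} (hpq : 0 < p + q) : Function.Injective (expDegree p q) := by
  intro a b hab
  have h0 : a * p = b * p := DFunLike.congr_fun hab 0
  have h1 : a * q = b * q := DFunLike.congr_fun hab 1
  exact Nat.eq_of_mul_eq_mul_right hpq (by rw [mul_add, mul_add, h0, h1])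

section

variable {ι : Type*} [DecidableEq ι] {A : Matrix ι ι ℤ} {p q : ℕ} (hpq : 0 < p + q) (z : ℤ)
  (E : LieAlg A)

include hpq in
theorem coeff_formalExp_expDegree (n : ℕ) :
    MvPowerSeries.coeff (expDegree p q n) (formalExp A p q z E) =
      ((n.factorial : ℚ)⁻¹) • (z • UniversalEnvelopingAlgebra.ι ℚ E) ^ n := by
  change ∑ n' ∈ range (n * p + n * q + 1), (if n * p = n' * p ∧ n * q = n' * q then
      ((n'.factorial : ℚ)⁻¹) • (z • UniversalEnvelopingAlgebra.ι ℚ E) ^ n' else 0) = _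
  rw [sum_eq_single n]
  · rw [if_pos ⟨rfl, rfl⟩]
  · intro b _ hb
    rw [if_neg]
    rintro ⟨h0, h1⟩
    exact hb (Nat.eq_of_mul_eq_mul_right hpq (by rw [mul_add, mul_add, h0, h1]))
  · intro h
    exact absurd (mem_range.mpr (by nlinarith)) h

theorem coeff_formalExp_of_notMem {d : Fin 2 →₀ ℕ} (hd : d ∉ Set.range (expDegree p q)) :
    MvPowerSeries.coeff d (formalExp A p q z E) = 0 := by
  change ∑ n ∈ range (d 0 + d 1 + 1), (if d 0 = n * p ∧ d 1 = n * q then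
      ((n.factorial : ℚ)⁻¹) • (z • UniversalEnvelopingAlgebra.ι ℚ E) ^ n else 0) = _
  refine sum_eq_zero fun n _ => if_neg ?_
  rintro ⟨h0, h1⟩
  refine hd ⟨n, ?_⟩
  ext a
  fin_cases a
  · exact h0.symm
  · exact h1.symm

include hpq in
/-- A formal exponential evaluates to an operator of a root group. -/
theorem evalsTo_formalExp (ρ : LieAlg A →ₗ⁅ℚ⁆ Module.End ℚ V) {E : LieAlg A}
    (hE : Admissible L (ρ E)) :
    EvalsTo (UniversalEnvelopingAlgebra.lift ℚ ρ) L r s (formalExp A p q z E)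
      (rootOp L (ρ E) (z * r ^ p * s ^ q)) := by
  classical
  have hinj := expDegree_injective hpq
  set c : (Fin 2 →₀ ℕ) → Module.End ℤ L :=
    Function.extend (expDegree p q) (fun n => z ^ n • dpL L (ρ E) n) 0 with hc
  have hc1 (n : ℕ) : c (expDegree p q n) = z ^ n • dpL L (ρ E) n := hinj.extend_apply _ _ n
  have hc2 {d} (hd : d ∉ Set.range (expDegree p q)) : c d = 0 := Function.extend_apply' _ _ _ hd
  have hfin : LocFin c := fun x => by
    obtain ⟨N, hN⟩ := (isDividedPowers_dpL hE).nil x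
    refine ((Set.finite_Iio N).image (expDegree p q)).subset fun d hd => ?_
    by_cases hd' : d ∈ Set.range (expDegree p q)
    · obtain ⟨n, rfl⟩ := hd'
      refine ⟨n, Set.mem_Iio.mpr (not_le.mp fun hn => hd ?_), rfl⟩
      change c _ x = 0
      rw [hc1, LinearMap.smul_apply, hN n hn, smul_zero]
    · exact absurd (by change c d x = 0; rw [hc2 hd']; rfl) hd
  refine ⟨c, hfin, fun d x => ?_, LinearMap.ext fun w => ?_⟩
  · by_cases hd : d ∈ Set.range (expDegree p q)
    · obtain ⟨n, rfl⟩ := hd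
      rw [coeff_formalExp_expDegree hpq, hc1, map_smul, map_pow, map_zsmul,
        UniversalEnvelopingAlgebra.lift_ι_apply, LinearMap.smul_apply, Submodule.coe_smul,
        coe_dpL hE, dpQ, smul_pow, LinearMap.smul_apply, LinearMap.smul_apply,
        LinearMap.smul_apply, smul_comm]
    · rw [coeff_formalExp_of_notMem z E hd, hc2 hd, map_zero]; rfl
  · rw [rootOp, dexp, lsum_apply ((isDividedPowers_baseChange (isDividedPowers_dpL hE)).locFin _),
      lsum_apply (locFin_baseChange hfin _)]
    have h := finsum_mem_range hinj (f := fun d : Fin 2 →₀ ℕ =>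
      ((r ^ d 0 * s ^ d 1) • (c d).baseChange k) w)
    rw [finsum_congr fun d => show _ = ((r ^ d 0 * s ^ d 1) • (c d).baseChange k) w from ?_] at h
    · rw [h]
      refine finsum_congr fun n => ?_
      rw [hc1]
      change (_ • (dpL L (ρ E) n).baseChange k) w =
        ((r ^ (n * p) * s ^ (n * q)) • (z ^ n • dpL L (ρ E) n).baseChange k) w
      have hz : (z ^ n • dpL L (ρ E) n).baseChange k w =
          ((z ^ n : ℤ) : k) • (dpL L (ρ E) n).baseChange k w := by
        rw [LinearMap.baseChange_smul, LinearMap.smul_apply]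
        exact (algebraMap_smul k (z ^ n) _).symm
      rw [LinearMap.smul_apply, LinearMap.smul_apply, hz, smul_smul]
      congr 2
      push_cast
      ring
    · by_cases hd : d ∈ Set.range (expDegree p q)
      · rw [finsum_eq_if, if_pos hd]
      · simp [hc2 hd]

/-- The commutator formulas hold for the operators of the root groups. -/
theorem rootOp_commutator [Fintype ι] (ρ : LieAlg A →ₗ⁅ℚ⁆ Module.End ℚ V) {c d : ι → ℤ}
    {E F : LieAlg A} {l : List (CommTerm A)}
    (hl : CommutatorFormula A c d E F l)
    (hρ : ∀ c E, IsRootVector A c E → Admissible L (ρ E)) (hE : IsRootVector A c E)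
    (hF : IsRootVector A d F) (r s : k) :
    rootOp L (ρ E) r * rootOp L (ρ F) s * rootOp L (ρ E) (-r) * rootOp L (ρ F) (-s) =
      (l.map fun x => rootOp L (ρ x.G.1) (x.z * r ^ x.p * s ^ x.q)).prod := by
  have h0 (x : CommTerm A) (hx : x ∈ l) : EvalsTo (UniversalEnvelopingAlgebra.lift ℚ ρ) L r s
      (formalExp A x.p x.q x.z x.G.1) (rootOp L (ρ x.G.1) (x.z * r ^ x.p * s ^ x.q)) := by
    have hp := (hl.1 x hx).1
    have hG := (hl.1 x hx).2.2
    exact evalsTo_formalExp (by omega) x.z ρ (hρ _ _ hG)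
  have h1 := EvalsTo.list_prod l h0
  rw [← hl.2] at h1
  have hE' (z : ℤ) := evalsTo_formalExp (p := 1) (q := 0) (r := r) (s := s)
    (by norm_num) z ρ (hρ _ _ hE)
  have hF' (z : ℤ) := evalsTo_formalExp (p := 0) (q := 1) (r := r) (s := s)
    (by norm_num) z ρ (hρ _ _ hF)
  have h2 := (((hE' 1).mul (hF' 1)).mul (hE' (-1))).mul (hF' (-1))
  simpa using h2.unique h1

end

end Evaluation

/-! ### Diagonal operators -/

section Diagonal

open Finset TensorProduct

variable {ι : Type*} [DecidableEq ι] {A : Matrix ι ι ℤ} {m : ι → ℕ}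

open Classical in
/-- A vector of the lattice has finitely many homogeneous components, and they belong to the
lattice. -/
theorem exists_homog_component {x : HW A m} (hx : x ∈ hwLattice A m) :
    (content '' Function.support (x : List ι → ℚ)).Finite ∧
      ∀ ν, ∃ y ∈ hwLattice A m, ∀ u, (y : List ι → ℚ) u =
        if content u = ν then (x : List ι → ℚ) u else 0 := by
  induction hx using Submodule.span_induction with
  | mem x hx =>
    obtain ⟨l, rfl⟩ := hx
    obtain ⟨μ, hμ⟩ := exists_isHomog_dpWord (A := A) (m := m) l
    refine ⟨(Set.finite_singleton μ).subset ?_, fun ν => ?_⟩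
    · rintro _ ⟨u, hu, rfl⟩; exact hμ u hu
    · rcases eq_or_ne μ ν with rfl | h
      · refine ⟨_, dpWord_mem l, fun u => ?_⟩
        split_ifs with hu
        · rfl
        · by_contra h0; exact hu (hμ u h0)
      · refine ⟨0, zero_mem _, fun u => ?_⟩
        split_ifs with hu
        · by_contra h0; exact h ((hμ u (Ne.symm h0)).symm.trans hu)
        · rfl
  | zero =>
    refine ⟨by simp, fun ν => ⟨0, zero_mem _, fun u => by simp⟩⟩
  | add x y _ _ hx hy =>
    refine ⟨(hx.1.union hy.1).subset ?_, fun ν => ?_⟩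
    · rintro _ ⟨u, hu, rfl⟩
      by_contra h
      rw [Set.mem_union, not_or] at h
      have h1 : (x : List ι → ℚ) u = 0 := by by_contra h0; exact h.1 ⟨u, h0, rfl⟩
      have h2 : (y : List ι → ℚ) u = 0 := by by_contra h0; exact h.2 ⟨u, h0, rfl⟩
      exact hu (by rw [Submodule.coe_add, Pi.add_apply, h1, h2, add_zero])
    · obtain ⟨x', hx', h1⟩ := hx.2 ν
      obtain ⟨y', hy', h2⟩ := hy.2 ν
      refine ⟨x' + y', add_mem hx' hy', fun u => ?_⟩
      rw [Submodule.coe_add, Pi.add_apply, h1, h2]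
      split_ifs <;> simp
  | smul c x _ hx =>
    refine ⟨hx.1.subset ?_, fun ν => ?_⟩
    · rintro _ ⟨u, hu, rfl⟩
      refine ⟨u, fun h => hu ?_, rfl⟩
      rw [Submodule.coe_smul_of_tower, Pi.smul_apply, h, smul_zero]
    · obtain ⟨x', hx', h1⟩ := hx.2 ν
      refine ⟨c • x', Submodule.smul_mem _ _ hx', fun u => ?_⟩
      rw [Submodule.coe_smul_of_tower, Pi.smul_apply, h1, Submodule.coe_smul_of_tower]
      split_ifs <;> simp

open Classical in
/-- The projection of the lattice to its homogeneous component of degree `ν`. -/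
def homogProj (ν : ι → ℤ) : Module.End ℤ (hwLattice A m) :=
  have key (x : hwLattice A m) := (exists_homog_component x.2).2 ν
  { toFun := fun x => ⟨(key x).choose, (key x).choose_spec.1⟩
    map_add' := fun x y => Subtype.ext <| Subtype.ext <| funext fun u => by
      have h1 := (key x).choose_spec.2 u
      have h2 := (key y).choose_spec.2 u
      have h3 := (key (x + y)).choose_spec.2 u
      refine h3.trans ?_
      change _ = ((key x).choose : List ι → ℚ) u + ((key y).choose : List ι → ℚ) u
      rw [h1, h2]
      split_ifs <;> simp
    map_smul' := fun c x => Subtype.ext <| Subtype.ext <| funext fun u => by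
      have h1 := (key x).choose_spec.2 u
      have h3 := (key (c • x)).choose_spec.2 u
      refine h3.trans ?_
      change _ = c • ((key x).choose : List ι → ℚ) u
      rw [h1]
      split_ifs
      · rfl
      · simp }

open Classical in
theorem homogProj_apply (ν : ι → ℤ) (x : hwLattice A m) (u : List ι) :
    ((homogProj ν x : HW A m) : List ι → ℚ) u =
      if content u = ν then ((x : HW A m) : List ι → ℚ) u else 0 :=
  ((exists_homog_component x.2).2 ν).choose_spec.2 u

theorem locFin_homogProj : LocFin (homogProj (A := A) (m := m)) := fun x => by
  refine (exists_homog_component x.2).1.subset fun ν hν => ?_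
  by_contra h
  refine hν (Subtype.ext (Subtype.ext (funext fun u => ?_)))
  rw [homogProj_apply]
  split_ifs with hu
  · by_contra h0; exact h ⟨u, h0, hu⟩
  · rfl

open Classical in
theorem homogProj_of_isHomog {ν μ : ι → ℤ} {x : hwLattice A m}
    (hx : IsHomog ν ((x : HW A m) : List ι → ℚ)) :
    homogProj μ x = if μ = ν then x else 0 := by
  refine Subtype.ext (Subtype.ext (funext fun u => ?_))
  rw [homogProj_apply]
  by_cases h0 : ((x : HW A m) : List ι → ℚ) u = 0
  · rw [h0]; split_ifs <;> simp [h0]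
  · rw [hx u h0]; split_ifs with h1 h2 h2
    · rfl
    · exact absurd h1.symm h2
    · exact absurd h2.symm h1
    · rfl

variable (k : Type*) [Field k] (A m)

/-- The reduction of the lattice to the field `k`. -/
abbrev HWRed : Type _ := k ⊗[ℤ] hwLattice A m

variable {k A m}

/-- The operator that multiplies the vectors of degree `ν` by `χ ν`. -/
def dg (χ : (ι → ℤ) → k) : Module.End k (HWRed A m k) :=
  lsum fun ν => χ ν • (homogProj ν).baseChange k

theorem dg_tmul (χ : (ι → ℤ) → k) {ν : ι → ℤ} {x : hwLattice A m}
    (hx : IsHomog ν ((x : HW A m) : List ι → ℚ)) (b : k) :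
    dg χ (b ⊗ₜ[ℤ] x) = χ ν • b ⊗ₜ[ℤ] x := by
  rw [dg, lsum_eq_single (locFin_baseChange locFin_homogProj χ) ν]
  · rw [LinearMap.smul_apply, LinearMap.baseChange_tmul, homogProj_of_isHomog hx, if_pos rfl]
  · intro μ hμ
    rw [LinearMap.smul_apply, LinearMap.baseChange_tmul, homogProj_of_isHomog hx, if_neg hμ,
      tmul_zero, smul_zero]

/-- Operators on the reduction are determined by their values at homogeneous vectors. -/
theorem HWRed.ext {f g : Module.End k (HWRed A m k)}
    (h : ∀ ν (x : hwLattice A m), IsHomog ν ((x : HW A m) : List ι → ℚ) →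
      f (1 ⊗ₜ[ℤ] x) = g (1 ⊗ₜ[ℤ] x)) : f = g := by
  refine LinearMap.ext fun w => ?_
  induction w using TensorProduct.induction_on with
  | zero => rw [map_zero, map_zero]
  | add v w hv hw => rw [map_add, map_add, hv, hw]
  | tmul b x =>
    have : b ⊗ₜ[ℤ] x = b • (1 : k) ⊗ₜ[ℤ] x := by rw [smul_tmul', smul_eq_mul, mul_one]
    rw [this, map_smul, map_smul]
    congr 1
    obtain ⟨x, hx⟩ := x
    induction hx using Submodule.span_induction with
    | mem x hx =>
      obtain ⟨l, rfl⟩ := hx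
      obtain ⟨ν, hν⟩ := exists_isHomog_dpWord (A := A) (m := m) l
      exact h ν _ hν
    | zero =>
      rw [show (⟨0, zero_mem _⟩ : hwLattice A m) = 0 from rfl, tmul_zero, map_zero, map_zero]
    | add x y hx hy h1 h2 =>
      rw [show (⟨x + y, add_mem hx hy⟩ : hwLattice A m) = ⟨x, hx⟩ + ⟨y, hy⟩ from rfl, tmul_add,
        map_add, map_add, h1 (by rw [smul_tmul', smul_eq_mul, mul_one]),
        h2 (by rw [smul_tmul', smul_eq_mul, mul_one])]
    | smul c x hx h1 =>
      rw [show (⟨c • x, Submodule.smul_mem _ _ hx⟩ : hwLattice A m) = c • ⟨x, hx⟩ from rfl,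
        tmul_smul, map_zsmul, map_zsmul, h1 (by rw [smul_tmul', smul_eq_mul, mul_one])]

theorem dg_mul (χ χ' : (ι → ℤ) → k) : dg (m := m) (A := A) (χ * χ') = dg χ * dg χ' :=
  HWRed.ext fun ν x hx => by
    rw [Module.End.mul_apply, dg_tmul _ hx, dg_tmul _ hx, map_smul, dg_tmul _ hx, smul_smul,
      Pi.mul_apply, mul_comm]

theorem dg_const (c : k) : dg (m := m) (A := A) (fun _ => c) = c • 1 :=
  HWRed.ext fun ν x hx => by rw [dg_tmul _ hx]; rfl

variable (A m) in
/-- The diagonal operators with non-zero entries, as a homomorphism to the group of units. -/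
def dgUnit : ((ι → ℤ) → kˣ) →* (Module.End k (HWRed A m k))ˣ :=
  MonoidHom.toHomUnits
    { toFun := fun χ => dg fun ν => (χ ν : k)
      map_one' := (dg_const 1).trans (one_smul _ _)
      map_mul' := fun χ χ' => dg_mul (fun ν => (χ ν : k)) fun ν => (χ' ν : k) }

theorem coe_dgUnit (χ : (ι → ℤ) → kˣ) :
    (dgUnit A m χ : Module.End k (HWRed A m k)) = dg fun ν => (χ ν : k) := rfl

theorem dg_mul_baseChange {T : Module.End ℤ (hwLattice A m)} {σ : (ι → ℤ) → ι → ℤ}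
    (hT : ∀ ν (x : hwLattice A m), IsHomog ν ((x : HW A m) : List ι → ℚ) →
      IsHomog (σ ν) ((T x : HW A m) : List ι → ℚ)) (χ : (ι → ℤ) → k) :
    dg χ * T.baseChange k = T.baseChange k * dg (χ ∘ σ) :=
  HWRed.ext fun ν x hx => by
    rw [Module.End.mul_apply, Module.End.mul_apply, LinearMap.baseChange_tmul,
      dg_tmul _ (hT ν x hx), dg_tmul _ hx, map_smul, LinearMap.baseChange_tmul]; rfl

theorem dg_mul_rootOp {X : Module.End ℚ (HW A m)} (hX : Admissible (hwLattice A m) X) {β : ι → ℤ}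
    (hβ : ∀ (n : ℕ) ν (x : HW A m), IsHomog ν (x : List ι → ℚ) →
      IsHomog (ν + (n : ℤ) • β) (dpQ X n x : List ι → ℚ))
    {χ : (ι → ℤ) → k} {c : k} (hχ : ∀ ν, χ (ν + β) = c * χ ν) (r : k) :
    dg χ * rootOp (hwLattice A m) X r = rootOp (hwLattice A m) X (c * r) * dg χ := by
  have hχ' (n : ℕ) (ν : ι → ℤ) : χ (ν + (n : ℤ) • β) = c ^ n * χ ν := by
    induction n with
    | zero => simp
    | succ n ih =>
      rw [show ν + ((n + 1 : ℕ) : ℤ) • β = ν + (n : ℤ) • β + β by push_cast; module, hχ, ih,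
        pow_succ']; ring
  refine HWRed.ext fun ν x hx => ?_
  have hD := isDividedPowers_baseChange (k := k) (isDividedPowers_dpL hX)
  refine dexp_intertwine hD hD (dg χ).toAddMonoidHom _ fun n => ?_
  change dg χ (r ^ n • (dpL _ X n).baseChange k (1 ⊗ₜ[ℤ] x)) =
    (c * r) ^ n • (dpL _ X n).baseChange k (dg χ (1 ⊗ₜ[ℤ] x))
  have hn := hβ n ν x hx
  rw [← coe_dpL hX] at hn
  rw [map_smul, LinearMap.baseChange_tmul, dg_tmul _ hn, dg_tmul _ hx, map_smul,
    LinearMap.baseChange_tmul, hχ', smul_smul, smul_smul]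
  congr 1
  ring

end Diagonal

/-! ### The action of the simple reflections on degrees -/

section Reflection

open Finset

variable {ι : Type*} [DecidableEq ι] {A : Matrix ι ι ℤ} {m : ι → ℕ}

/-- The span of the homogeneous vectors whose degrees differ from `ν` by a multiple of the simple
root with index `i`. -/
def stringSpan (i : ι) (ν : ι → ℤ) : Submodule ℚ (HW A m) :=
  Submodule.span ℚ {x | ∃ j : ℤ, IsHomog (ν + j • Pi.single i 1) (x : List ι → ℚ)}

theorem hwE_mem_stringSpan {i : ι} {ν : ι → ℤ} :
    ∀ x ∈ stringSpan (A := A) (m := m) i ν, hwE A m i x ∈ stringSpan i ν :=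
  Submodule.span_le (p := (stringSpan i ν).comap (hwE A m i)).mpr <| by
    rintro x ⟨j, hj⟩
    refine Submodule.subset_span ⟨j - 1, ?_⟩
    rw [sub_smul, one_smul, ← add_sub_assoc]
    exact hj.opE i

theorem hwF_mem_stringSpan {i : ι} {ν : ι → ℤ} :
    ∀ x ∈ stringSpan (A := A) (m := m) i ν, hwF A m i x ∈ stringSpan i ν :=
  Submodule.span_le (p := (stringSpan i ν).comap (hwF A m i)).mpr <| by
    rintro x ⟨j, hj⟩
    refine Submodule.subset_span ⟨j + 1, ?_⟩
    rw [add_smul, one_smul, ← add_assoc]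
    exact hj.opF i

theorem exists_content_of_mem_stringSpan {i : ι} {ν : ι → ℤ} {x : HW A m}
    (hx : x ∈ stringSpan i ν) (u : List ι) (hu : (x : List ι → ℚ) u ≠ 0) :
    ∃ j : ℤ, content u = ν + j • Pi.single i 1 := by
  by_contra h
  refine hu ?_
  induction hx using Submodule.span_induction with
  | mem x hx =>
    obtain ⟨j, hj⟩ := hx
    by_contra h0; exact h ⟨j, hj u h0⟩
  | zero => rfl
  | add x y _ _ hx hy =>
    rw [Submodule.coe_add, Pi.add_apply]
    by_cases h0 : (x : List ι → ℚ) u = 0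
    · by_cases h1 : (y : List ι → ℚ) u = 0
      · rw [h0, h1, add_zero]
      · exact absurd (hy h1) h1
    · exact absurd (hx h0) h0
  | smul c x _ hx =>
    rw [Submodule.coe_smul, Pi.smul_apply]
    by_cases h0 : (x : List ι → ℚ) u = 0
    · rw [h0, smul_zero]
    · exact absurd (hx h0) h0

theorem dexp_dpQ_mem {V : Type*} [AddCommGroup V] [Module ℚ V] {X : Module.End ℚ V} (hX : LocNil X)
    {S : Submodule ℚ V} (hS : ∀ x ∈ S, X x ∈ S) (r : ℚ) : ∀ x ∈ S, dexp (dpQ X) r x ∈ S := by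
  intro x hx
  obtain ⟨N, hN⟩ := (isDividedPowers_dpQ hX).nil x
  rw [dexp, lsum_eq_sum ((isDividedPowers_dpQ hX).locFin r) (S := range N)]
  · refine sum_mem fun n hn => S.smul_mem _ (S.smul_mem _ ?_)
    clear hn
    induction n with
    | zero => exact hx
    | succ n ih => rw [pow_succ']; exact hS _ ih
  · intro n hn
    rw [LinearMap.smul_apply, hN n (by simpa using hn), smul_zero]

variable [Fintype ι]

variable (A m) in
/-- The simple reflection with index `i`, acting on degrees: if `λ` is the highest weight, then it
sends the weight `λ - ν` to `λ - reflDegree A m i ν`. -/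
def reflDegree (i : ι) (ν : ι → ℤ) : ι → ℤ := ν + weightAt A m i ν • Pi.single i 1

theorem weightAt_add_single (i j : ι) (ν : ι → ℤ) (c : ℤ) :
    weightAt A m i (ν + c • Pi.single j 1) = weightAt A m i ν - A i j * c := by
  simp [weightAt, mul_add, sum_add_distrib, Pi.single_apply]
  ring

variable [IsGCM A]

theorem weightAt_reflDegree (i : ι) (ν : ι → ℤ) :
    weightAt A m i (reflDegree A m i ν) = -weightAt A m i ν := by
  rw [reflDegree, weightAt_add_single, IsGCM.diag (A := A)]; ring

/-- The lift of a simple reflection permutes the homogeneous vectors as the reflection permutes the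
degrees: it changes the degree by a multiple of the simple root, and the multiple is determined
since the eigenvalue of `h i` changes its sign. -/
theorem isHomog_weylQ {i : ι} {ν : ι → ℤ} {x : HW A m} (hx : IsHomog ν (x : List ι → ℚ)) :
    IsHomog (reflDegree A m i ν) (weylQ (hwE A m i) (hwF A m i) x : List ι → ℚ) := by
  intro u hu
  have hE := locNil_hwE (A := A) (m := m) i
  have hF := locNil_hwF (A := A) (m := m) i
  have hmem : weylQ (hwE A m i) (hwF A m i) x ∈ stringSpan i ν := by
    refine dexp_dpQ_mem hE hwE_mem_stringSpan _ _ (dexp_dpQ_mem hF hwF_mem_stringSpan _ _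
      (dexp_dpQ_mem hE hwE_mem_stringSpan _ _ (Submodule.subset_span ⟨0, ?_⟩)))
    simpa using hx
  obtain ⟨j, hj⟩ := exists_content_of_mem_stringSpan hmem u hu
  have hH := LinearMap.congr_fun (weylQ_conj hE hF (by simpa using lie_hwE_hwF i i)
    (lie_hwH_hwE_self i) (lie_hwH_hwF_self i)).2 x
  rw [Module.End.mul_apply, hx.hwH_apply, map_smul] at hH
  have hu' := congr_fun (congr_arg (Subtype.val : HW A m → List ι → ℚ) hH) u
  have : (weightAt A m i ν : ℚ) * (weylQ (hwE A m i) (hwF A m i) x : List ι → ℚ) u =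
      -(weightAt A m i (content u) * (weylQ (hwE A m i) (hwF A m i) x : List ι → ℚ) u) := by
    rw [← wordWeight_eq, ← opH_apply]; exact hu'
  rw [← neg_mul] at this
  have h1 := mul_right_cancel₀ hu this
  rw [hj, weightAt_add_single, IsGCM.diag (A := A)] at h1
  have h2 : weightAt A m i ν = -(weightAt A m i ν - 2 * j) := by exact_mod_cast h1
  rw [hj, reflDegree, show j = weightAt A m i ν by omega]

end Reflection

/-! ### The action of `SL₂` on the reduced lattices -/

section SL2Action

open Finset TensorProduct

attribute [local instance] LieRing.ofAssociativeRing

variable {ι : Type*} [Fintype ι] [DecidableEq ι] (A : Matrix ι ι ℤ) (m : ι → ℕ) [IsGCM A]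
  {k : Type*} [Field k]

theorem admissible_rootVector (E : RootVector A) :
    Admissible (hwLattice A m) (hwRep A m E.1) := admissible_of_isRootVector E.2.choose_spec

/-- The operators of the root group of `E`, as invertible operators. -/
def rootUnit (E : RootVector A) (r : k) : (Module.End k (HWRed A m k))ˣ where
  val := rootOp (hwLattice A m) (hwRep A m E.1) r
  inv := rootOp (hwLattice A m) (hwRep A m E.1) (-r)
  val_inv := rootOp_mul_neg (admissible_rootVector A m E) r
  inv_val := rootOp_neg_mul (admissible_rootVector A m E) r

theorem coe_rootUnit (E : RootVector A) (r : k) :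
    (rootUnit A m E r : Module.End k (HWRed A m k)) =
      rootOp (hwLattice A m) (hwRep A m E.1) r := rfl

theorem coe_rootUnit_e (i : ι) (r : k) :
    (rootUnit A m (RootVector.e i) r : Module.End k (HWRed A m k)) =
      rootOp (hwLattice A m) (hwE A m i) r := by
  rw [← hwRep_e]; rfl

theorem coe_rootUnit_f (i : ι) (r : k) :
    (rootUnit A m (RootVector.f i) r : Module.End k (HWRed A m k)) =
      rootOp (hwLattice A m) (hwF A m i) r := by
  rw [← hwRep_f]; rfl

theorem rootUnit_add (E : RootVector A) (r s : k) :
    rootUnit A m E (r + s) = rootUnit A m E r * rootUnit A m E s :=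
  Units.ext (rootOp_add (admissible_rootVector A m E) r s)

theorem rootUnit_neg (E : RootVector A) (r : k) :
    rootUnit A m E (-r) = (rootUnit A m E r)⁻¹ := Units.ext rfl

theorem rootUnit_opp (E : RootVector A) (r : k) :
    rootUnit A m E.opp r = rootUnit A m E (-r) :=
  Units.ext <| by
    rw [coe_rootUnit, coe_rootUnit, ← rootOp_neg (admissible_rootVector A m E)]
    exact congrArg (rootOp (hwLattice A m) · r) (map_neg (hwRep A m) E.1)

theorem rootUnit_commutator {c d : ι → ℤ} {E F : RootVector A} {l : List (CommTerm A)}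
    (hE : IsRootVector A c E.1) (hF : IsRootVector A d F.1)
    (hl : CommutatorFormula A c d E.1 F.1 l) (r s : k) :
    rootUnit A m E r * rootUnit A m F s * (rootUnit A m E r)⁻¹ * (rootUnit A m F s)⁻¹ =
      (l.map fun x => rootUnit A m x.G (x.z * r ^ x.p * s ^ x.q)).prod := by
  refine Units.ext ?_
  rw [← Units.coeHom_apply (List.prod _), map_list_prod, List.map_map]
  exact rootOp_commutator (hwRep A m) hl (fun c E => admissible_of_isRootVector) hE hF r s

theorem dgUnit_mul_rootUnit_e {i : ι} {χ : (ι → ℤ) → kˣ} {c : kˣ}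
    (hχ : ∀ ν, χ (ν - Pi.single i 1) = c * χ ν) (r : k) :
    dgUnit A m χ * rootUnit A m (RootVector.e i) r =
      rootUnit A m (RootVector.e i) (c * r) * dgUnit A m χ := by
  refine Units.ext ?_
  rw [Units.val_mul, Units.val_mul, coe_rootUnit_e, coe_rootUnit_e, coe_dgUnit]
  refine dg_mul_rootOp (β := -Pi.single i 1) (admissible_hwE i) (fun n ν x hx => ?_) (fun ν => ?_) r
  · rw [smul_neg, ← sub_eq_add_neg]; exact hx.hwE_pow i n
  · rw [← sub_eq_add_neg, hχ, Units.val_mul]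

theorem dgUnit_mul_rootUnit_f {i : ι} {χ : (ι → ℤ) → kˣ} {c : kˣ}
    (hχ : ∀ ν, χ (ν + Pi.single i 1) = c * χ ν) (r : k) :
    dgUnit A m χ * rootUnit A m (RootVector.f i) r =
      rootUnit A m (RootVector.f i) (c * r) * dgUnit A m χ := by
  refine Units.ext ?_
  rw [Units.val_mul, Units.val_mul, coe_rootUnit_f, coe_rootUnit_f, coe_dgUnit]
  exact dg_mul_rootOp (admissible_hwF i) (fun n ν x hx => hx.hwF_pow i n)
    (fun ν => by rw [hχ, Units.val_mul]) r

variable (k) in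
/-- The element of the normalizer of the torus that lifts the simple reflection with index `i`. -/
def weylUnit (i : ι) : (Module.End k (HWRed A m k))ˣ :=
  rootUnit A m (RootVector.e i) 1 * rootUnit A m (RootVector.f i) (-1) *
    rootUnit A m (RootVector.e i) 1

theorem coe_weylUnit (i : ι) :
    (weylUnit A m k i : Module.End k (HWRed A m k)) =
      (weylL (hwLattice A m) (hwE A m i) (hwF A m i)).baseChange k := by
  rw [baseChange_weylL (admissible_hwE i) (admissible_hwF i), weylUnit, Units.val_mul,
    Units.val_mul, coe_rootUnit_e, coe_rootUnit_f]

theorem dgUnit_mul_weylUnit (i : ι) (χ : (ι → ℤ) → kˣ) :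
    dgUnit A m χ * weylUnit A m k i = weylUnit A m k i * dgUnit A m (χ ∘ reflDegree A m i) := by
  refine Units.ext ?_
  rw [Units.val_mul, Units.val_mul, coe_weylUnit, coe_dgUnit, coe_dgUnit]
  refine dg_mul_baseChange (σ := reflDegree A m i) (fun ν x hx => ?_) _
  rw [coe_weylL (admissible_hwE i) (admissible_hwF i)]
  exact isHomog_weylQ hx

theorem weylUnit_mul_rootUnit (i : ι) (E : RootVector A) (r : k) :
    weylUnit A m k i * rootUnit A m E r = rootUnit A m (E.refl i) r * weylUnit A m k i := by
  refine Units.ext ?_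
  rw [Units.val_mul, Units.val_mul, coe_weylUnit, coe_rootUnit, coe_rootUnit]
  refine rootOp_intertwine (TQ := weylQ (hwE A m i) (hwF A m i)) (admissible_rootVector A m E)
    (admissible_rootVector A m (E.refl i)) (coe_weylL (admissible_hwE i) (admissible_hwF i)) ?_ r
  rw [← hwRep_e, ← hwRep_f]
  exact weylQ_mul_rep _ i (by rw [hwRep_e]; exact locNil_hwE i)
    (by rw [hwRep_f]; exact locNil_hwF i) _

theorem weylUnit_mul_rootUnit_e (i : ι) (r : k) :
    weylUnit A m k i * rootUnit A m (RootVector.e i) r =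
      rootUnit A m (RootVector.f i) (-r) * weylUnit A m k i := by
  refine Units.ext ?_
  rw [Units.val_mul, Units.val_mul, coe_weylUnit, coe_rootUnit_e, coe_rootUnit_f,
    ← rootOp_neg (admissible_hwF i)]
  exact rootOp_intertwine (TQ := weylQ (hwE A m i) (hwF A m i)) (admissible_hwE i)
    (admissible_hwF i).neg (coe_weylL (admissible_hwE i) (admissible_hwF i))
    (weylQ_conj (locNil_hwE i) (locNil_hwF i) (by simpa using lie_hwE_hwF i i)
      (lie_hwH_hwE_self i) (lie_hwH_hwF_self i)).1 r

/-- The action of the coroot with index `i`. -/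
def corootUnit (i : ι) : kˣ →* (Module.End k (HWRed A m k))ˣ :=
  (dgUnit A m).comp (MonoidHom.pi fun ν => zpowGroupHom (weightAt A m i ν))

theorem corootUnit_apply (i : ι) (u : kˣ) :
    corootUnit A m i u = dgUnit A m fun ν => u ^ weightAt A m i ν := rfl

theorem weylUnit_mul_corootUnit (i : ι) (u : kˣ) :
    weylUnit A m k i * corootUnit A m i u = corootUnit A m i u⁻¹ * weylUnit A m k i := by
  rw [corootUnit_apply, corootUnit_apply, dgUnit_mul_weylUnit]
  congr 2
  ext1 ν
  simp only [Function.comp, weightAt_reflDegree, inv_zpow, zpow_neg, inv_inv]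

/-- The product `x (u) y (-u⁻¹) x (u)` is the product of the values of the coroot at `u` and of the
element that lifts the simple reflection. -/
theorem rootUnit_mul_rootUnit_mul_rootUnit (i : ι) (u : kˣ) :
    rootUnit A m (RootVector.e i) (u : k) * rootUnit A m (RootVector.f i) (-((u⁻¹ : kˣ) : k)) *
      rootUnit A m (RootVector.e i) (u : k) = corootUnit A m i u * weylUnit A m k i := by
  -- Both sides are the conjugate of the lift of the reflection by this diagonal operator.
  set χ : (ι → ℤ) → kˣ := fun ν => u ^ (-ν i) with hχ
  set g := dgUnit A m χ with hg
  have hE (r : k) := dgUnit_mul_rootUnit_e A m (i := i) (χ := χ) (c := u) (fun ν => by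
    simp only [hχ, Pi.sub_apply, Pi.single_eq_same, neg_sub]
    rw [sub_eq_add_neg, zpow_add, zpow_one]) r
  have hF (r : k) := dgUnit_mul_rootUnit_f A m (i := i) (χ := χ) (c := u⁻¹) (fun ν => by
    simp only [hχ, Pi.add_apply, Pi.single_eq_same, neg_add_rev]
    rw [zpow_add, zpow_neg_one]) r
  have hw : g * weylUnit A m k i = weylUnit A m k i * corootUnit A m i u⁻¹ * g := by
    rw [hg, dgUnit_mul_weylUnit, corootUnit_apply, mul_assoc, ← map_mul]
    congr 2
    ext1 ν
    simp only [Function.comp, hχ, reflDegree, Pi.mul_apply, Pi.add_apply, Pi.smul_apply,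
      Pi.single_eq_same, smul_eq_mul, mul_one, neg_add_rev]
    rw [zpow_add, inv_zpow, zpow_neg]
  rw [weylUnit_mul_corootUnit, inv_inv] at hw
  rw [← mul_left_inj g, ← hw, weylUnit, ← mul_assoc, ← mul_assoc, hE, mul_assoc _ g, hF,
    ← mul_assoc, mul_assoc _ g, hE, mul_one, mul_neg, mul_one, ← mul_assoc]

theorem sl2Relations (i : ι) :
    SL2Relations (rootUnit A m (RootVector.e i) : k → _) (corootUnit A m i) (weylUnit A m k i) where
  x_add := rootUnit_add A m _
  h_x u r := by
    have := dgUnit_mul_rootUnit_e A m (i := i) (χ := fun ν => u ^ weightAt A m i ν) (c := u ^ 2)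
      (fun ν => by
        have := weightAt_add_single (A := A) (m := m) i i ν (-1)
        rw [neg_one_smul, ← sub_eq_add_neg, IsGCM.diag (A := A)] at this
        rw [this, sub_eq_add_neg, zpow_add, mul_comm]; rfl) r
    rw [Units.val_pow_eq_pow_val] at this
    exact this
  w_h := weylUnit_mul_corootUnit A m i
  w_w := by
    have h := rootUnit_mul_rootUnit_mul_rootUnit A m (k := k) i (-1)
    rw [inv_neg, inv_one, Units.val_neg, Units.val_one, neg_neg, rootUnit_neg] at h
    have h2 : (rootUnit A m (RootVector.e i) (1 : k))⁻¹ * rootUnit A m (RootVector.f i) (1 : k) *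
        (rootUnit A m (RootVector.e i) (1 : k))⁻¹ = (weylUnit A m k i)⁻¹ := by
      rw [weylUnit, mul_inv_rev, mul_inv_rev, rootUnit_neg, inv_inv, mul_assoc]
    rw [h2] at h
    have h3 : corootUnit A m i (-1 : kˣ) * corootUnit A m i (-1) = 1 := by
      rw [← map_mul, neg_mul_neg, one_mul, map_one]
    rw [← mul_right_inj (corootUnit A m i (-1 : kˣ)), h3, ← mul_assoc, ← h, inv_mul_cancel]
  w_x_w u := by
    rw [mul_assoc (rootUnit A m (RootVector.e i) (-(u : k))),
      ← rootUnit_mul_rootUnit_mul_rootUnit, weylUnit_mul_rootUnit_e,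
      rootUnit_neg A m _ (u : k), rootUnit_neg]
    simp only [mul_assoc, inv_mul_cancel_left, mul_inv_cancel_left]

/-- The action of the `i`-th copy of `SL₂` on the reduced lattice. -/
def slUnit (i : ι) : SL(2, k) →* (Module.End k (HWRed A m k))ˣ := (sl2Relations A m i).toHom

theorem slUnit_upper (i : ι) (r : k) :
    slUnit A m i (upper r) = rootUnit A m (RootVector.e i) r := (sl2Relations A m i).toHom_upper r

theorem slUnit_diagSL (i : ι) (u : kˣ) : slUnit A m i (diagSL u) = corootUnit A m i u :=
  (sl2Relations A m i).toHom_diagSL u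

theorem slUnit_weylSL (i : ι) : slUnit A m i (weylSL : SL(2, k)) = weylUnit A m k i :=
  (sl2Relations A m i).toHom_weylSL

theorem slUnit_lower (i : ι) (r : k) :
    slUnit A m i (lower r) = rootUnit A m (RootVector.f i) r := by
  rw [← weylSL_conj_upper, map_mul, map_mul, map_inv, slUnit_weylSL, slUnit_upper,
    weylUnit_mul_rootUnit_e, neg_neg, mul_inv_cancel_right]

end SL2Action

/-! ### The elements of `SL₂` that act diagonally -/

section Detection

open Finset TensorProduct

attribute [local instance] LieRing.ofAssociativeRing

variable {ι : Type*} [DecidableEq ι] {A : Matrix ι ι ℤ} {m : ι → ℕ} {k : Type*} [Field k]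

variable (A m k) in
/-- The highest weight vector of the reduced lattice. -/
def hwvRed : HWRed A m k := 1 ⊗ₜ[ℤ] ⟨hwv A m, hwv_mem⟩

/-- The coefficient of the highest weight vector is an integer for the vectors of the lattice. -/
theorem exists_intCast_apply_nil {x : HW A m} (hx : x ∈ hwLattice A m) :
    ∃ n : ℤ, (n : ℚ) = (x : List ι → ℚ) [] := by
  induction hx using Submodule.span_induction with
  | mem x hx =>
    obtain ⟨l, rfl⟩ := hx
    induction l with
    | nil => exact ⟨1, by simp [dpWord, hwv, hwVec]⟩
    | cons p l ih =>
      obtain ⟨i, n⟩ := p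
      change ∃ z : ℤ, (z : ℚ) = (dpQ (hwF A m i) n (dpWord A m l) : List ι → ℚ) []
      cases n with
      | zero => simpa [dpQ] using ih
      | succ n =>
        refine ⟨0, ?_⟩
        rw [dpQ, LinearMap.smul_apply, Submodule.coe_smul, Pi.smul_apply, pow_succ',
          Module.End.mul_apply, coe_hwF, opF_nil, smul_zero, Int.cast_zero]
  | zero => exact ⟨0, by simp⟩
  | add x y _ _ hx hy =>
    obtain ⟨a, ha⟩ := hx
    obtain ⟨b, hb⟩ := hy
    exact ⟨a + b, by rw [Int.cast_add, ha, hb]; rfl⟩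
  | smul c x _ hx =>
    obtain ⟨a, ha⟩ := hx
    exact ⟨c * a, by
      rw [Int.cast_mul, ha, Submodule.coe_smul_of_tower, Pi.smul_apply, zsmul_eq_mul]⟩

/-- The coefficient of the highest weight vector is an integral linear form on the lattice with
value `1` at this vector, and it survives the reduction. -/
theorem hwvRed_ne_zero : hwvRed A m k ≠ 0 := by
  let ev : hwLattice A m →ₗ[ℤ] ℚ :=
    { toFun := fun x => ((x : HW A m) : List ι → ℚ) []
      map_add' := fun _ _ => rfl
      map_smul' := fun _ _ => rfl }
  let ε : hwLattice A m →ₗ[ℤ] ℤ :=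
    (LinearEquiv.ofInjective (Algebra.linearMap ℤ ℚ) Int.cast_injective).symm.toLinearMap ∘ₗ
      ev.codRestrict (LinearMap.range (Algebra.linearMap ℤ ℚ)) fun x =>
        exists_intCast_apply_nil x.2
  have hε : ε ⟨hwv A m, hwv_mem⟩ = 1 := by
    rw [LinearMap.comp_apply, LinearEquiv.coe_coe, LinearEquiv.symm_apply_eq]
    refine Subtype.ext ?_
    change (hwVec : List ι → ℚ) [] = ((1 : ℤ) : ℚ)
    simp [hwVec]
  intro h
  have := congrArg (TensorProduct.rid ℤ k) (congrArg (ε.lTensor k) h)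
  rw [hwvRed, LinearMap.lTensor_tmul, hε, map_zero, map_zero, TensorProduct.rid_tmul,
    one_smul] at this
  exact one_ne_zero this

theorem dgUnit_hwvRed (χ : (ι → ℤ) → kˣ) :
    (dgUnit A m χ : Module.End k (HWRed A m k)) (hwvRed A m k) = (χ 0 : k) • hwvRed A m k :=
  dg_tmul _ isHomog_hwv 1

theorem dgUnit_const_mul (z : kˣ) (T : (Module.End k (HWRed A m k))ˣ) :
    dgUnit A m (fun _ => z) * T = T * dgUnit A m fun _ => z := by
  refine Units.ext ?_
  rw [Units.val_mul, Units.val_mul, coe_dgUnit, dg_const, smul_one_mul, mul_smul_one]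

variable [Fintype ι] [IsGCM A]

theorem dpQ_hwE_dpQ_hwF_hwv (i : ι) :
    dpQ (hwE A m i) (m i) (dpQ (hwF A m i) (m i) (hwv A m)) = hwv A m := by
  have hμ := (isHomog_hwv (A := A) (m := m)).hwH_apply i
  rw [← dpZ_natCast (hwF A m i), kostant (by simpa using lie_hwE_hwF i i) (lie_hwH_hwE_self i)
    (lie_hwH_hwF_self i) hμ, sum_eq_single (m i, 0)]
  · simp [weightAt, dpZ, dpQ, Ring.choose_natCast]
  · rintro ⟨a, b⟩ hab hne
    rw [HasAntidiagonal.mem_antidiagonal] at hab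
    obtain ⟨b, rfl⟩ : ∃ b', b = b' + 1 := Nat.exists_eq_succ_of_ne_zero fun h => hne (by
      simp only at hab; simp [h, ← hab])
    have : dpQ (hwE A m i) (b + 1) (hwv A m) = 0 := by
      rw [dpQ, LinearMap.smul_apply, pow_succ, Module.End.mul_apply, hwE_hwv, map_zero, smul_zero]
    simp only [this, map_zero, smul_zero]
  · intro h; exact absurd (by simp) h

theorem rootUnit_e_hwvRed (i : ι) (r : k) :
    (rootUnit A m (RootVector.e i) r : Module.End k (HWRed A m k)) (hwvRed A m k) =
      hwvRed A m k := by
  have hE := admissible_hwE (A := A) (m := m) i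
  rw [coe_rootUnit_e, rootOp, dexp, lsum_eq_single
    ((isDividedPowers_baseChange (isDividedPowers_dpL hE)).locFin r) 0]
  · simp [(isDividedPowers_dpL hE).zero]
  · intro n hn
    obtain ⟨n, rfl⟩ := Nat.exists_eq_succ_of_ne_zero hn
    have : dpL (hwLattice A m) (hwE A m i) (n + 1) ⟨hwv A m, hwv_mem⟩ = 0 := Subtype.ext <| by
      rw [coe_dpL hE, dpQ, LinearMap.smul_apply, pow_succ, Module.End.mul_apply, hwE_hwv, map_zero,
        smul_zero]; rfl
    rw [LinearMap.smul_apply, hwvRed, LinearMap.baseChange_tmul, this, tmul_zero, smul_zero]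

open Classical in
/-- The component of degree `0` of `exp (r e) f ^ (m) v`, with the divided power `f ^ (m)` for the
highest weight `m` of `v`; it depends on `r` if `m ≠ 0`. -/
theorem dg_zero_rootUnit_e (i : ι) (r : k) :
    dg (fun ν => if ν = 0 then (1 : k) else 0)
      ((rootUnit A m (RootVector.e i) r : Module.End k (HWRed A m k))
        (1 ⊗ₜ[ℤ] ⟨dpQ (hwF A m i) (m i) (hwv A m), dpQ_hwF_mem i _ _ hwv_mem⟩)) =
      r ^ m i • hwvRed A m k := by
  have hE := admissible_hwE (A := A) (m := m) i
  have hfin := (isDividedPowers_baseChange (k := k) (isDividedPowers_dpL hE)).locFin r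
  set y : hwLattice A m := ⟨dpQ (hwF A m i) (m i) (hwv A m), dpQ_hwF_mem i _ _ hwv_mem⟩ with hy
  have hdeg (n : ℕ) : IsHomog (0 + (m i : ℤ) • Pi.single i 1 - (n : ℤ) • Pi.single i 1)
      ((dpL (hwLattice A m) (hwE A m i) n y : HW A m) : List ι → ℚ) := by
    rw [coe_dpL hE]
    exact (isHomog_hwv.hwF_pow i (m i)).hwE_pow i n
  rw [coe_rootUnit_e, rootOp, dexp, lsum_apply hfin]
  refine ((dg _).toAddMonoidHom.map_finsum (hfin _)).trans ?_
  rw [finsum_eq_single _ (m i)]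
  · change dg _ (r ^ m i • (dpL _ _ _).baseChange k (1 ⊗ₜ[ℤ] y)) = _
    rw [map_smul, LinearMap.baseChange_tmul, dg_tmul _ (hdeg _), if_pos (by module), one_smul]
    congr 2
    exact Subtype.ext ((coe_dpL hE _ _).trans (dpQ_hwE_dpQ_hwF_hwv i))
  · intro n hn
    change dg _ (r ^ n • (dpL _ _ _).baseChange k (1 ⊗ₜ[ℤ] y)) = _
    rw [map_smul, LinearMap.baseChange_tmul, dg_tmul _ (hdeg _), if_neg, zero_smul, smul_zero]
    intro h
    have := congrFun h i
    simp at this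
    omega

/-- An element of `SL₂` that acts by a diagonal operator is diagonal, provided that the highest
weight does not vanish at `h i`. -/
theorem exists_eq_diagSL {i : ι} (hm : m i ≠ 0) {g : SL(2, k)} {χ : (ι → ℤ) → kˣ}
    (h : slUnit A m i g = dgUnit A m χ) : ∃ a : kˣ, g = diagSL a := by
  classical
  set δ : (ι → ℤ) → k := fun ν => if ν = 0 then (1 : k) else 0 with hδ
  have hmi : (0 : ι → ℤ) + (m i : ℤ) • Pi.single i 1 ≠ 0 := fun h0 => by
    have := congrFun h0 i
    simp at this
    exact hm this
  by_cases hc : g 1 0 = 0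
  · have ha : g 0 0 ≠ 0 := fun h0 => by
      have := g.det_coe; rw [Matrix.det_fin_two, hc, h0] at this; simp at this
    have hg := eq_diag_mul_upper g hc ha
    set a := Units.mk0 (g 0 0) ha
    set b := g 0 1 / g 0 0
    -- A diagonal operator preserves degrees, whereas the component of degree `0` of the image of
    -- `f ^ (m i) v` under `upper b` is `b ^ m i v`.
    suffices b = 0 by
      refine ⟨a, ?_⟩
      rw [hg, this, show upper (0 : k) = 1 from ?_, mul_one]
      ext p q; fin_cases p <;> fin_cases q <;> simp [coe_upper]
    have h1 : rootUnit A m (RootVector.e i) b =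
        dgUnit A m ((fun ν => a ^ weightAt A m i ν)⁻¹ * χ) := by
      rw [map_mul, map_inv, ← h, ← corootUnit_apply, hg, map_mul, slUnit_diagSL, slUnit_upper,
        inv_mul_cancel_left]
    have h2 := dg_zero_rootUnit_e (A := A) (m := m) i b
    rw [h1, coe_dgUnit, dg_tmul _ (isHomog_hwv.hwF_pow i (m i)), map_smul,
      dg_tmul _ (isHomog_hwv.hwF_pow i (m i)), if_neg hmi, zero_smul, smul_zero] at h2
    exact eq_zero_of_pow_eq_zero (((smul_eq_zero.mp h2.symm).resolve_right hwvRed_ne_zero))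
  · exfalso
    have hg := eq_upper_mul_weyl g hc
    set a := g 0 0 / g 1 0
    set d := g 1 1 / g 1 0
    set u := -Units.mk0 (g 1 0) hc
    -- The lift of the reflection would fix the line of the highest weight vector, but the image of
    -- this vector has degree `m i` times the simple root.
    have h1 : weylUnit A m k i = (rootUnit A m (RootVector.e i) a)⁻¹ * dgUnit A m χ *
        (rootUnit A m (RootVector.e i) d)⁻¹ * (corootUnit A m i u)⁻¹ := by
      rw [← h, hg]
      simp only [map_mul, slUnit_upper, slUnit_weylSL, slUnit_diagSL]
      group
    have h2 : ∃ κ : k, (weylUnit A m k i : Module.End k (HWRed A m k)) (hwvRed A m k) =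
        κ • hwvRed A m k := by
      rw [h1, ← rootUnit_neg, ← rootUnit_neg, ← map_inv, corootUnit_apply]
      simp only [Units.val_mul, Module.End.mul_apply, dgUnit_hwvRed, map_smul, rootUnit_e_hwvRed,
        smul_smul]
      exact ⟨_, rfl⟩
    obtain ⟨κ, hκ⟩ := h2
    have h3 : dg δ ((weylUnit A m k i : Module.End k (HWRed A m k)) (hwvRed A m k)) = 0 := by
      have hw := isHomog_weylQ (i := i) (isHomog_hwv (A := A) (m := m))
      rw [coe_weylUnit, hwvRed, LinearMap.baseChange_tmul, dg_tmul (ν := reflDegree A m i 0)]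
      · rw [hδ]
        simp only
        rw [if_neg, zero_smul]
        simpa [reflDegree, weightAt] using hmi
      · rw [coe_weylL (admissible_hwE i) (admissible_hwF i)]; exact hw
    rw [hκ, map_smul] at h3
    have h4 : dg δ (hwvRed A m k) = hwvRed A m k := by
      rw [hwvRed, dg_tmul _ isHomog_hwv, hδ]; simp
    rw [h4, ← hκ] at h3
    have h5 := congrArg (((weylUnit A m k i)⁻¹ : (Module.End k (HWRed A m k))ˣ) :
      Module.End k (HWRed A m k)) h3
    rw [← Module.End.mul_apply, ← Units.val_mul, inv_mul_cancel, map_zero] at h5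
    exact hwvRed_ne_zero h5

end Detection

end KacMoody

/-! ### Representations of the Kac-Moody group -/

namespace KacMoodyDatum

section Representation

open KacMoody

variable {ι Λ : Type*} [Fintype ι] [DecidableEq ι] [AddCommGroup Λ] [Module.Free ℤ Λ]
  [Module.Finite ℤ Λ] (D : KacMoodyDatum ι Λ) (k : Type*) [Field k]

instance isGCM : IsGCM D.A where
  diag := D.diag
  offDiag := D.offDiag
  zero_symm := D.zero_symm

/-- The weight `lam - ∑ i, ν i α i` of the vectors of degree `ν`. -/
def weight (lam : Λ) (ν : ι → ℤ) : Λ := lam - ∑ i, ν i • D.α i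

theorem weight_zero (lam : Λ) : D.weight lam 0 = lam := by simp [weight]

theorem weight_add_single (lam : Λ) (ν : ι → ℤ) (i : ι) (c : ℤ) :
    D.weight lam (ν + c • Pi.single i 1) = D.weight lam ν - c • D.α i := by
  simp only [weight, Pi.add_apply, Pi.smul_apply, add_smul, Finset.sum_add_distrib]
  rw [sub_add_eq_sub_sub, Finset.sum_eq_single (a := i) (s := Finset.univ)
    (f := fun j => (c • (Pi.single i (1 : ℤ) : ι → ℤ) j) • D.α j)]
  · simp
  · intro j _ hj; simp [hj]
  · simp

theorem h_weight (lam : Λ) (ν : ι → ℤ) (i : ι) :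
    D.h i (D.weight lam ν) = D.h i lam - ∑ j, D.A i j * ν j := by
  simp [weight, D.pairing, mul_comm]

variable {k}

/-- The character by which the torus element `τ` acts on the vectors of degree `ν`. -/
def torusChar (lam : Λ) : Torus k Λ →* ((ι → ℤ) → kˣ) :=
  MonoidHom.pi fun ν => MonoidHom.eval (.ofAdd (D.weight lam ν))

theorem torusChar_apply (lam : Λ) (τ : Torus k Λ) (ν : ι → ℤ) :
    D.torusChar lam τ ν = τ (.ofAdd (D.weight lam ν)) := rfl

theorem torusChar_add_single (lam : Λ) (τ : Torus k Λ) (ν : ι → ℤ) (i : ι) (c : ℤ) :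
    D.torusChar lam τ (ν + c • Pi.single i 1) =
      τ (.ofAdd (D.α i)) ^ (-c) * D.torusChar lam τ ν := by
  rw [torusChar_apply, weight_add_single, sub_eq_neg_add, ofAdd_add, map_mul, ← neg_smul,
    ofAdd_zsmul, map_zpow]; rfl

variable {c : ι → ℤ} {lam : Λ} {m : ι → ℕ} (hm : ∀ i, (m i : ℤ) = c i + D.h i lam)
include hm

theorem weightAt_eq (i : ι) (ν : ι → ℤ) : weightAt D.A m i ν = c i + D.h i (D.weight lam ν) := by
  rw [weightAt, hm, h_weight]; ring

/-- The value of the coroot agrees with the value of the cocharacter up to a scalar. -/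
theorem corootUnit_eq (i : ι) (u : kˣ) :
    corootUnit D.A m i u = dgUnit D.A m (fun _ => u ^ c i) *
      dgUnit D.A m (D.torusChar lam (cocharacter (D.h i) u)) := by
  rw [corootUnit_apply, ← map_mul]
  congr 1
  ext1 ν
  rw [D.weightAt_eq hm, zpow_add]; rfl

/-- Conjugation by the lift of a simple reflection acts on the torus by the reflection of `Λ`, up
to a scalar. -/
theorem dgUnit_mul_weylUnit (i : ι) (τ : Torus k Λ) :
    dgUnit D.A m (D.torusChar lam (torusMap (D.reflection i) τ)) * weylUnit D.A m k i =
      dgUnit D.A m (fun _ => τ (.ofAdd (D.α i)) ^ c i) *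
        (weylUnit D.A m k i * dgUnit D.A m (D.torusChar lam τ)) := by
  rw [KacMoody.dgUnit_mul_weylUnit, ← mul_assoc, dgUnit_const_mul, mul_assoc, ← map_mul]
  congr 2
  ext1 ν
  change τ (.ofAdd (D.reflection i (D.weight lam (reflDegree D.A m i ν)))) =
    τ (.ofAdd (D.α i)) ^ c i * τ (.ofAdd (D.weight lam ν))
  rw [reflDegree, weight_add_single, ← map_zpow, ← ofAdd_zsmul, ← map_mul, ← ofAdd_add,
    D.weightAt_eq hm]
  congr 2
  simp only [reflection, LinearMap.sub_apply, LinearMap.id_apply, LinearMap.smulRight_apply,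
    map_sub, map_smul, D.pairing, D.diag]
  module

end Representation

section Family

open KacMoody

variable {ι Λ J : Type*} [Fintype ι] [DecidableEq ι] [AddCommGroup Λ] [Module.Free ℤ Λ]
  [Module.Finite ℤ Λ] (D : KacMoodyDatum ι Λ) (k : Type*) [Field k] (lam : J → Λ) (m : J → ι → ℕ)

/-- The invertible operators on a family of reduced lattices. -/
abbrev OpFamily : Type _ := ∀ j, (Module.End k (HWRed D.A (m j) k))ˣ

/-- The scalars, embedded diagonally. -/
def scalars : kˣ →* D.OpFamily k m :=
  MonoidHom.pi fun j => (dgUnit D.A (m j)).comp (MonoidHom.pi fun _ => MonoidHom.id kˣ)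

theorem scalars_apply (z : kˣ) (j : J) : D.scalars k m z j = dgUnit D.A (m j) fun _ => z := rfl

instance normal_range_scalars : (D.scalars k m).range.Normal where
  conj_mem := by
    rintro _ ⟨z, rfl⟩ g
    refine ⟨z, ?_⟩
    ext1 j
    rw [Pi.mul_apply, Pi.mul_apply, Pi.inv_apply, scalars_apply, ← dgUnit_const_mul,
      mul_inv_cancel_right]

/-- The operators by which the generators act. -/
def genOp : D.Gen k → D.OpFamily k m
  | .torus τ => fun j => dgUnit D.A (m j) (D.torusChar (lam j) τ)
  | .sl i g => fun j => slUnit D.A (m j) i g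
  | .root E r => fun j => rootUnit D.A (m j) E r

/-- The quotient of the invertible operators by the scalars. -/
abbrev ProjFamily : Type _ := D.OpFamily k m ⧸ (D.scalars k m).range

variable {k lam m}

theorem proj_eq_of_scalar {x y : D.OpFamily k m} (z : kˣ) (h : x = D.scalars k m z * y) :
    (x : D.ProjFamily k m) = y := by
  have hz : (D.scalars k m z : D.ProjFamily k m) = 1 :=
    (QuotientGroup.eq_one_iff _).mpr ⟨z, rfl⟩
  rw [h, QuotientGroup.mk_mul, hz, one_mul]

variable {c : ι → ℤ} (hm : ∀ j i, (m j i : ℤ) = c i + D.h i (lam j))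
include hm

/-- The defining relations hold up to scalars. The scalars are needed because the numbers
`m i = c i + h i lam` differ by `c i` from the values of the weight `lam` of the torus, which
affects only the relations `sl_diag` and `weyl_torus`; they are common to the family since `c`
is. -/
theorem lift_genOp_rel {u v : FreeGroup (D.Gen k)} (huv : D.Rel k u v) :
    FreeGroup.lift (fun x => (D.genOp k lam m x : D.ProjFamily k m)) u =
      FreeGroup.lift (fun x => (D.genOp k lam m x : D.ProjFamily k m)) v := by
  have key (w : FreeGroup (D.Gen k)) :
      FreeGroup.lift (fun x => (D.genOp k lam m x : D.ProjFamily k m)) w =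
        (FreeGroup.lift (D.genOp k lam m) w : D.ProjFamily k m) := by
    have : FreeGroup.lift (fun x => (D.genOp k lam m x : D.ProjFamily k m)) =
        (QuotientGroup.mk' _).comp (FreeGroup.lift (D.genOp k lam m)) := by
      ext x; simp
    rw [this]; rfl
  rw [key, key]
  have hT (τ : Torus k Λ) : FreeGroup.lift (D.genOp k lam m) (D.genT k τ) =
    fun j => dgUnit D.A (m j) (D.torusChar (lam j) τ) := FreeGroup.lift_apply_of
  have hS (i : ι) (g : SL(2, k)) : FreeGroup.lift (D.genOp k lam m) (D.genS k i g) =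
    fun j => slUnit D.A (m j) i g := FreeGroup.lift_apply_of
  have hX (E : RootVector D.A) (r : k) : FreeGroup.lift (D.genOp k lam m) (D.genX k E r) =
    fun j => rootUnit D.A (m j) E r := FreeGroup.lift_apply_of
  cases huv with
  | torus_mul τ τ' =>
    rw [map_mul, hT, hT, hT]; congr 1; ext1 j; rw [map_mul, map_mul]; rfl
  | sl_mul i g g' =>
    rw [map_mul, hS, hS, hS]; congr 1; ext1 j; rw [map_mul]; rfl
  | root_add E r r' =>
    rw [map_mul, hX, hX, hX]; congr 1; ext1 j; exact rootUnit_add _ _ E r r'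
  | root_opp E r => rw [hX, hX]; congr 1; ext1 j; exact rootUnit_opp _ _ E r
  | root_e i r => rw [hX, hS]; congr 1; ext1 j; exact (slUnit_upper _ _ i r).symm
  | root_f i r => rw [hX, hS]; congr 1; ext1 j; exact (slUnit_lower _ _ i r).symm
  | sl_diag i u =>
    rw [hS, hT]
    refine D.proj_eq_of_scalar (u ^ c i) (funext fun j => ?_)
    rw [slUnit_diagSL, D.corootUnit_eq (hm j)]; rfl
  | torus_root_e i τ r =>
    rw [map_mul, map_mul, map_inv, hT, hS, hS]
    congr 1; ext1 j
    rw [Pi.mul_apply, Pi.mul_apply, Pi.inv_apply, slUnit_upper, slUnit_upper, mul_inv_eq_iff_eq_mul]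
    refine dgUnit_mul_rootUnit_e _ _ (fun ν => ?_) r
    have := D.torusChar_add_single (lam j) τ ν i (-1)
    rwa [neg_one_smul, ← sub_eq_add_neg, neg_neg, zpow_one] at this
  | torus_root_f i τ r =>
    rw [map_mul, map_mul, map_inv, hT, hS, hS]
    congr 1; ext1 j
    rw [Pi.mul_apply, Pi.mul_apply, Pi.inv_apply, slUnit_lower, slUnit_lower, mul_inv_eq_iff_eq_mul]
    refine dgUnit_mul_rootUnit_f _ _ (fun ν => ?_) r
    have := D.torusChar_add_single (lam j) τ ν i 1
    rwa [one_smul, zpow_neg_one] at this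
  | weyl_torus i τ =>
    rw [map_mul, map_mul, map_inv, hT, hS, hT]
    symm
    refine D.proj_eq_of_scalar (τ (.ofAdd (D.α i)) ^ c i) (funext fun j => ?_)
    rw [Pi.mul_apply, Pi.mul_apply, Pi.mul_apply, Pi.inv_apply, slUnit_weylSL, ← mul_assoc,
      eq_mul_inv_iff_mul_eq]
    exact D.dgUnit_mul_weylUnit (hm j) i τ
  | weyl_root i E r =>
    rw [map_mul, map_mul, map_inv, hS, hX, hX]
    congr 1; ext1 j
    rw [Pi.mul_apply, Pi.mul_apply, Pi.inv_apply, slUnit_weylSL, mul_inv_eq_iff_eq_mul]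
    exact weylUnit_mul_rootUnit _ _ i E r
  | commutator a b E F l hE hF hab hl r s =>
    simp only [map_mul, map_inv, map_list_prod, List.map_map, hX]
    congr 1; ext1 j
    refine (rootUnit_commutator D.A (m j) hE hF hl r s).trans ?_
    rw [← Pi.evalMonoidHom_apply (fun j => (Module.End k (HWRed D.A (m j) k))ˣ) j (List.prod _),
      map_list_prod, List.map_map]
    rfl

/-- The projective representation of the Kac-Moody group on a family of reduced lattices. -/
def projRep : D.KMGroup k →* D.ProjFamily k m :=
  PresentedGroup.toGroup (f := fun x => (D.genOp k lam m x : D.ProjFamily k m)) <| by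
    rintro _ ⟨u, v, huv, rfl⟩
    rw [map_mul, map_inv, D.lift_genOp_rel hm huv, mul_inv_cancel]

theorem projRep_η (τ : Torus k Λ) : D.projRep hm (D.η k τ) =
    ((fun j => dgUnit D.A (m j) (D.torusChar (lam j) τ) : D.OpFamily k m) : D.ProjFamily k m) :=
  PresentedGroup.toGroup.of _

theorem projRep_φ (i : ι) (g : SL(2, k)) : D.projRep hm (D.φ k i g) =
    ((fun j => slUnit D.A (m j) i g : D.OpFamily k m) : D.ProjFamily k m) :=
  PresentedGroup.toGroup.of _

end Family

section Kernel

open KacMoody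

variable {ι Λ : Type*} [Fintype ι] [DecidableEq ι] [AddCommGroup Λ] [Module.Free ℤ Λ]
  [Module.Finite ℤ Λ] (D : KacMoodyDatum ι Λ) {k : Type*} [Field k]

/-- If `η τ` and `φ i g` are inverse to each other, then `g` acts diagonally, so `g = diagSL a`.
Since the action is only projective, the value of the character `x` at the element `τ h(a)` of the
torus is found by comparing two modules whose highest weights differ by `x`. -/
theorem exists_eq_diagSL_of_η_mul_φ {i : ι} {τ : Torus k Λ} {g : SL(2, k)}
    (h : D.η k τ * D.φ k i g = 1) (x : Λ) :
    ∃ a : kˣ, g = diagSL a ∧ (τ * cocharacter (D.h i) a) (.ofAdd x) = 1 := by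
  -- The summand `|h i x|` of `c i` makes both highest weights dominant, and the summand `1` makes
  -- the module with `lam = 0` non-trivial.
  set c : ι → ℤ := fun i => 1 + |D.h i x| with hc
  set lam : Bool → Λ := fun j => if j then x else 0 with hlam
  set m : Bool → ι → ℕ := fun j i => (c i + D.h i (lam j)).toNat with hmdef
  have hm (j : Bool) (i : ι) : (m j i : ℤ) = c i + D.h i (lam j) := by
    refine Int.toNat_of_nonneg ?_
    have := neg_abs_le (D.h i x)
    have := abs_nonneg (D.h i x)
    cases j <;> simp [hc, hlam] <;> omega
  have hm0 : m false i ≠ 0 := by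
    have h1 := hm false i
    have := abs_nonneg (D.h i x)
    simp only [hc, hlam, Bool.false_eq_true, if_false, map_zero, add_zero] at h1
    omega
  have h1 := congrArg (D.projRep hm) h
  rw [map_mul, map_one, projRep_η, projRep_φ, ← QuotientGroup.mk_mul,
    QuotientGroup.eq_one_iff] at h1
  obtain ⟨z, hz⟩ := h1
  have hz (j : Bool) : dgUnit D.A (m j) (fun _ => z) =
    dgUnit D.A (m j) (D.torusChar (lam j) τ) * slUnit D.A (m j) i g := congrFun hz j
  have hd : slUnit D.A (m false) i g =
      dgUnit D.A (m false) ((D.torusChar (lam false) τ)⁻¹ * fun _ => z) := by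
    rw [map_mul, map_inv, hz, inv_mul_cancel_left]
  obtain ⟨a, rfl⟩ := exists_eq_diagSL hm0 hd
  refine ⟨a, rfl, ?_⟩
  have h2 (j : Bool) : z = (τ * cocharacter (D.h i) a) (.ofAdd (lam j)) * a ^ c i := by
    have h3 := hz j
    rw [slUnit_diagSL, D.corootUnit_eq (hm j), ← map_mul, ← map_mul] at h3
    have h4 := LinearMap.congr_fun (congrArg Units.val h3) (hwvRed D.A (m j) k)
    rw [dgUnit_hwvRed, dgUnit_hwvRed] at h4
    have h5 := Units.ext (smul_left_injective k hwvRed_ne_zero h4)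
    rw [h5]
    simp only [Pi.mul_apply, torusChar_apply, weight_zero, MonoidHom.mul_apply]
    rw [mul_comm (a ^ c i), mul_assoc]
  have h3 := h2 false
  have h4 := h2 true
  simp only [hlam, Bool.false_eq_true, if_false, if_true, ofAdd_zero, map_one, one_mul] at h3 h4
  rw [h3] at h4
  exact mul_eq_right.mp h4.symm

/-- The torus and the image of `φ i` intersect only as the relation `sl_diag` forces them to. -/
theorem η_mul_φ_eq_one_iff {i : ι} {τ : Torus k Λ} {g : SL(2, k)} :
    D.η k τ * D.φ k i g = 1 ↔ ∃ a : kˣ, g = diagSL a ∧ τ = cocharacter (D.h i) a⁻¹ := by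
  constructor
  · intro h
    obtain ⟨a, rfl, -⟩ := D.exists_eq_diagSL_of_η_mul_φ h 0
    refine ⟨a, rfl, MonoidHom.ext fun x => ?_⟩
    obtain ⟨b, hb, hx⟩ := D.exists_eq_diagSL_of_η_mul_φ h x.toAdd
    obtain rfl : a = b := Units.ext (congrFun (congrFun (congrArg Subtype.val hb) 0) 0)
    change τ x * a ^ D.h i x.toAdd = 1 at hx
    change τ x = a⁻¹ ^ D.h i x.toAdd
    rw [inv_zpow, ← eq_inv_of_mul_eq_one_left hx]
  · rintro ⟨a, rfl, rfl⟩
    have h1 : D.φ k i (diagSL a) = D.η k (cocharacter (D.h i) a) := Rel.mk_eq D k (.sl_diag i a)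
    have h2 : cocharacter (D.h i) a⁻¹ * cocharacter (D.h i) a = 1 :=
      MonoidHom.ext fun x => by
        change a⁻¹ ^ D.h i x.toAdd * a ^ D.h i x.toAdd = 1
        rw [inv_zpow, inv_mul_cancel]
    rw [h1, ← map_mul, h2, map_one]

end Kernel

end KacMoodyDatum

/-! ### Products of the torus and `SL₂` -/

namespace KacMoody

theorem exists_mulEquiv_of_ker_eq {G H K : Type*} [Group G] [Group H] [Group K] {f : G →* H}
    {g : G →* K} (hf : Function.Surjective f) (hg : Function.Surjective g) (h : f.ker = g.ker) :
    ∃ γ : H ≃* K, ∀ x, γ (f x) = g x := by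
  refine ⟨(QuotientGroup.quotientKerEquivOfSurjective f hf).symm.trans
    ((QuotientGroup.quotientMulEquivOfEq h).trans
      (QuotientGroup.quotientKerEquivOfSurjective g hg)), fun x => ?_⟩
  have : (QuotientGroup.quotientKerEquivOfSurjective f hf).symm (f x) = (x : G ⧸ f.ker) := by
    rw [MulEquiv.symm_apply_eq]; rfl
  rw [MulEquiv.trans_apply, this]; rfl

section Conjugation

variable {k : Type*} [Field k]

/-- The matrices `(r 0; 0 1)`. -/
def dilation : kˣ →* GL (Fin 2) k :=
  MonoidHom.mk' (fun r => Matrix.GeneralLinearGroup.mkOfDetNeZero !![(r : k), 0; 0, 1] (by simp))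
    fun r s => by
      ext p q
      fin_cases p <;> fin_cases q <;>
        simp [Matrix.GeneralLinearGroup.mkOfDetNeZero, Matrix.mul_apply, Fin.sum_univ_two]

theorem coe_dilation (r : kˣ) :
    (dilation r : Matrix (Fin 2) (Fin 2) k) = !![(r : k), 0; 0, 1] := rfl

/-- The conjugate of `g` by `dilation r`. -/
def dilationConj (r : kˣ) (g : SL(2, k)) : SL(2, k) :=
  ⟨!![g 0 0, r * g 0 1; ((r⁻¹ : kˣ) : k) * g 1 0, g 1 1], by
    have := g.det_coe
    rw [Matrix.det_fin_two] at this
    rw [Matrix.det_fin_two_of]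
    linear_combination this - (g 0 1 * g 1 0) * r.mul_inv⟩

theorem coe_dilationConj (r : kˣ) (g : SL(2, k)) :
    (dilationConj r g : Matrix (Fin 2) (Fin 2) k) =
      !![g 0 0, r * g 0 1; ((r⁻¹ : kˣ) : k) * g 1 0, g 1 1] := rfl

theorem dilation_mul_toGL (r : kˣ) (g : SL(2, k)) :
    dilation r * Matrix.SpecialLinearGroup.toGL g =
      Matrix.SpecialLinearGroup.toGL (dilationConj r g) * dilation r := by
  ext p q
  fin_cases p <;> fin_cases q <;>
    simp [coe_dilation, coe_dilationConj, Matrix.mul_apply, Fin.sum_univ_two, mul_comm]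

theorem toGL_dilationConj (r : kˣ) (g : SL(2, k)) :
    Matrix.SpecialLinearGroup.toGL (dilationConj r g) =
      dilation r * Matrix.SpecialLinearGroup.toGL g * (dilation r)⁻¹ :=
  eq_mul_inv_of_mul_eq (dilation_mul_toGL r g).symm

theorem dilationConj_mul_left (r s : kˣ) (g : SL(2, k)) :
    dilationConj (r * s) g = dilationConj r (dilationConj s g) := by
  apply Matrix.SpecialLinearGroup.toGL_injective
  simp only [toGL_dilationConj, map_mul]
  group

theorem dilationConj_one (g : SL(2, k)) : dilationConj 1 g = g := by
  ext p q; fin_cases p <;> fin_cases q <;> simp [dilationConj]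

/-- The action of `kˣ` on `SL₂(k)` by conjugation with the matrices `dilation r`. -/
def dilationAut : kˣ →* MulAut SL(2, k) where
  toFun r :=
    { toFun := dilationConj r
      invFun := dilationConj r⁻¹
      left_inv := fun g => by rw [← dilationConj_mul_left, inv_mul_cancel, dilationConj_one]
      right_inv := fun g => by rw [← dilationConj_mul_left, mul_inv_cancel, dilationConj_one]
      map_mul' := fun g g' => by
        apply Matrix.SpecialLinearGroup.toGL_injective
        simp only [toGL_dilationConj, map_mul]
        group }
  map_one' := MulEquiv.ext dilationConj_one
  map_mul' r s := MulEquiv.ext (dilationConj_mul_left r s)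

theorem dilationConj_upper (u : kˣ) (r : k) : dilationConj u (upper r) = upper (u * r) := by
  ext p q; fin_cases p <;> fin_cases q <;> simp [dilationConj, coe_upper]

theorem dilationConj_lower (u : kˣ) (r : k) :
    dilationConj u (lower r) = lower (((u⁻¹ : kˣ) : k) * r) := by
  ext p q; fin_cases p <;> fin_cases q <;> simp [dilationConj, coe_lower]

/-- The action of the torus on `SL₂(k)` through the character `α`. -/
def torusAut {Λ : Type*} [AddCommGroup Λ] (α : Λ) : Torus k Λ →* MulAut SL(2, k) :=
  dilationAut.comp (MonoidHom.eval (.ofAdd α))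

end Conjugation

section PGL

variable {k : Type*} [Field k]

variable (M : (Fin 2 → ℤ) ≃ₗ[ℤ] (Fin 2 → ℤ)) {α : Fin 2 → ℤ} (hα : M ![1, 0] = α)

/-- The homomorphism `τ ↦ etaBar (τ ∘ M)`. -/
def etaBarHom : Torus k (Fin 2 → ℤ) →* PGL(2, k) × kˣ :=
  ((Matrix.ProjGenLinGroup.mk.comp dilation).comp (MonoidHom.eval (.ofAdd (M ![1, 0])))).prod
    (MonoidHom.eval (.ofAdd (M ![0, 1])))

/-- The homomorphism `(g, τ) ↦ [g] etaBar (τ ∘ M)` from the semidirect product of `SL₂(k)` and the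
torus to `PGL₂(k) × kˣ`. -/
def pglMap : SL(2, k) ⋊[torusAut α] Torus k (Fin 2 → ℤ) →* PGL(2, k) × kˣ :=
  SemidirectProduct.lift (Matrix.SpecialLinearGroup.toPGL.prod 1) (etaBarHom M) fun τ => by
    subst hα
    refine MonoidHom.ext fun g => ?_
    refine Prod.ext ?_ ?_
    · change Matrix.ProjGenLinGroup.mk (Matrix.SpecialLinearGroup.toGL (dilationConj _ g)) =
        Matrix.ProjGenLinGroup.mk (dilation _) * Matrix.ProjGenLinGroup.mk _ *
          (Matrix.ProjGenLinGroup.mk (dilation _))⁻¹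
      rw [toGL_dilationConj, map_mul, map_mul, map_inv]
    · change (1 : kˣ) = τ _ * 1 * (τ _)⁻¹
      simp

theorem pglMap_apply (x : SL(2, k) ⋊[torusAut α] Torus k (Fin 2 → ℤ)) :
    pglMap M hα x = (Matrix.ProjGenLinGroup.mk (Matrix.SpecialLinearGroup.toGL x.left *
      dilation (x.right (.ofAdd α))), x.right (.ofAdd (M ![0, 1]))) := by
  subst hα
  refine Prod.ext ?_ ?_
  · exact (map_mul Matrix.ProjGenLinGroup.mk _ _).symm
  · exact one_mul _

theorem torus_apply (τ : Torus k (Fin 2 → ℤ)) (x : Fin 2 → ℤ) :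
    τ (.ofAdd (M x)) = τ (.ofAdd (M ![1, 0])) ^ x 0 * τ (.ofAdd (M ![0, 1])) ^ x 1 := by
  have : x = x 0 • ![1, 0] + x 1 • ![0, 1] := by ext p; fin_cases p <;> simp
  rw [← map_zpow τ, ← map_zpow τ, ← map_mul τ, ← ofAdd_zsmul, ← ofAdd_zsmul, ← ofAdd_add,
    ← map_zsmul, ← map_zsmul, ← map_add, ← this]

theorem pglMap_surjective : Function.Surjective (pglMap (k := k) M hα) := by
  subst hα
  rintro ⟨x, z⟩
  obtain ⟨B, rfl⟩ := Matrix.ProjGenLinGroup.mk_surjective x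
  -- A matrix of determinant `δ` is the product of a matrix of determinant one and of `dilation δ`.
  set δ : kˣ := Matrix.GeneralLinearGroup.det B with hδ
  have hdet : (B : Matrix (Fin 2) (Fin 2) k) 0 0 * (B : Matrix (Fin 2) (Fin 2) k) 1 1 -
      (B : Matrix (Fin 2) (Fin 2) k) 0 1 * (B : Matrix (Fin 2) (Fin 2) k) 1 0 = δ := by
    rw [hδ, Matrix.GeneralLinearGroup.val_det_apply, Matrix.det_fin_two]
  let g : SL(2, k) := ⟨!![B 0 0 * ((δ⁻¹ : kˣ) : k), B 0 1; B 1 0 * ((δ⁻¹ : kˣ) : k), B 1 1], by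
    rw [Matrix.det_fin_two_of, ← δ.mul_inv, ← hdet]; ring⟩
  have hg : (Matrix.SpecialLinearGroup.toGL g : Matrix (Fin 2) (Fin 2) k) =
    !![B 0 0 * ((δ⁻¹ : kˣ) : k), B 0 1; B 1 0 * ((δ⁻¹ : kˣ) : k), B 1 1] := rfl
  let τ : Torus k (Fin 2 → ℤ) := MonoidHom.mk' (fun x =>
    δ ^ (M.symm x.toAdd) 0 * z ^ (M.symm x.toAdd) 1) fun x y => by
      simp only [toAdd_mul, map_add, Pi.add_apply, zpow_add]
      exact mul_mul_mul_comm _ _ _ _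
  have h0 : τ (.ofAdd (M ![1, 0])) = δ := by simp [τ]
  have h1 : τ (.ofAdd (M ![0, 1])) = z := by simp [τ]
  refine ⟨⟨g, τ⟩, ?_⟩
  rw [pglMap_apply]
  dsimp only
  rw [h0, h1]
  congr 2
  ext p q
  fin_cases p <;> fin_cases q <;>
    simp [hg, coe_dilation, Matrix.mul_apply, Fin.sum_univ_two]

/-- If `h` is twice the first coordinate with respect to the basis given by `M`, then the kernel of
`pglMap` is that of `leviMap`. -/
theorem pglMap_eq_one_iff {h : Module.Dual ℤ (Fin 2 → ℤ)} (hM : ∀ x, h (M x) = 2 * x 0)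
    (x : SL(2, k) ⋊[torusAut α] Torus k (Fin 2 → ℤ)) :
    pglMap M hα x = 1 ↔ ∃ a : kˣ, x.left = diagSL a ∧ x.right = cocharacter h a⁻¹ := by
  subst hα
  obtain ⟨g, τ⟩ := x
  rw [pglMap_apply, Prod.ext_iff]
  dsimp only [Prod.fst_one, Prod.snd_one]
  rw [eq_comm, ← map_one Matrix.ProjGenLinGroup.mk, Matrix.ProjGenLinGroup.mk_eq_mk_iff]
  constructor
  · rintro ⟨⟨u, hu⟩, hτ⟩
    have entry (p q : Fin 2) :=
      congrArg (fun X : GL (Fin 2) k => (X : Matrix (Fin 2) (Fin 2) k) p q) hu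
    set r := τ (.ofAdd (M ![1, 0])) with hr
    have e00 : (u : k) = g 0 0 * r := by
      simpa [coe_dilation, Matrix.mul_apply, Fin.sum_univ_two] using entry 0 0
    have e01 : g 0 1 = 0 := by
      simpa [coe_dilation, Matrix.mul_apply, Fin.sum_univ_two] using (entry 0 1).symm
    have e10 : g 1 0 = 0 := by
      simpa [coe_dilation, Matrix.mul_apply, Fin.sum_univ_two] using (entry 1 0).symm
    have e11 : (u : k) = g 1 1 := by
      simpa [coe_dilation, Matrix.mul_apply, Fin.sum_univ_two] using entry 1 1
    have hd : g 0 0 * g 1 1 = 1 := by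
      have := g.det_coe; rw [Matrix.det_fin_two, e01] at this; simpa using this
    have h00 : g 0 0 = ((u⁻¹ : kˣ) : k) := by
      rw [← e11] at hd
      rw [Units.val_inv_eq_inv_val]
      exact eq_inv_of_mul_eq_one_left hd
    refine ⟨u⁻¹, ?_, MonoidHom.ext fun y => ?_⟩
    · ext p q; fin_cases p <;> fin_cases q <;> simp [coe_diagSL, e01, e10, ← e11, h00]
    · have hru : r = u ^ (2 : ℤ) := by
        have h2 : u = u⁻¹ * r := Units.ext (by rw [e00, h00]; rfl)
        rw [zpow_two]
        nth_rewrite 2 [h2]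
        rw [mul_inv_cancel_left]
      have hy := torus_apply M τ (M.symm y.toAdd)
      rw [LinearEquiv.apply_symm_apply, hτ, one_zpow, mul_one, ← hr, hru, ← zpow_mul, ← hM,
        LinearEquiv.apply_symm_apply] at hy
      change τ y = (u⁻¹)⁻¹ ^ h y.toAdd
      rw [inv_inv]; exact hy
  · rintro ⟨a, rfl, rfl⟩
    have h0 : cocharacter h a⁻¹ (.ofAdd (M ![1, 0])) = a⁻¹ ^ (2 : ℤ) := by
      change a⁻¹ ^ h (M ![1, 0]) = _
      rw [hM]; rfl
    refine ⟨⟨a⁻¹, ?_⟩, ?_⟩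
    · have hc := a.mul_inv
      rw [h0, zpow_two]
      ext p q
      have hdiag := coe_diagSL a
      generalize a⁻¹ = c at hc hdiag
      fin_cases p <;> fin_cases q <;>
        simp [coe_dilation, hdiag, Matrix.mul_apply, Fin.sum_univ_two, ← mul_assoc, hc]
    · change a⁻¹ ^ h (M ![0, 1]) = _
      rw [hM]; simp

end PGL

end KacMoody

namespace KacMoodyDatum

open KacMoody

/-! ### The Lévi subgroup as a quotient -/

section Levi

variable {ι Λ : Type*} [Fintype ι] [DecidableEq ι] [AddCommGroup Λ] [Module.Free ℤ Λ]
  [Module.Finite ℤ Λ] (D : KacMoodyDatum ι Λ) (k : Type*) [Field k]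

theorem φ_torusAut (i : ι) (τ : Torus k Λ) (g : SL(2, k)) :
    D.φ k i (torusAut (D.α i) τ g) = D.η k τ * D.φ k i g * (D.η k τ)⁻¹ := by
  induction g using sl2_induction' with
  | hmul g g' hg hg' => rw [map_mul, map_mul, map_mul, hg, hg']; group
  | hinv g hg => rw [map_inv, map_inv, map_inv, hg]; group
  | hx r =>
    exact (congrArg _ (dilationConj_upper _ r)).trans (Rel.mk_eq D k (.torus_root_e i τ r)).symm
  | hy r =>
    exact (congrArg _ (dilationConj_lower _ r)).trans (Rel.mk_eq D k (.torus_root_f i τ r)).symm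

/-- The homomorphism from `SL₂(k)` to the Lévi subgroup. -/
def φLevi (i : ι) : SL(2, k) →* D.levi k i :=
  (D.φ k i).codRestrict (D.levi k i) fun g => Subgroup.mem_sup_right ⟨g, rfl⟩

/-- The homomorphism `(g, τ) ↦ φ i g * η τ` from the semidirect product of `SL₂(k)` and the torus to
the Lévi subgroup. -/
def leviMap (i : ι) : SL(2, k) ⋊[torusAut (D.α i)] Torus k Λ →* D.levi k i :=
  SemidirectProduct.lift (D.φLevi k i) (D.ηLevi k i) fun τ =>
    MonoidHom.ext fun g => Subtype.ext (D.φ_torusAut k i τ g)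

theorem leviMap_surjective (i : ι) : Function.Surjective (D.leviMap k i) := by
  have h : D.levi k i ≤ ((D.levi k i).subtype.comp (D.leviMap k i)).range := by
    refine sup_le ?_ ?_
    · rintro _ ⟨τ, rfl⟩
      exact ⟨.inr τ, congrArg Subtype.val (SemidirectProduct.lift_inr _ _ _ τ)⟩
    · rintro _ ⟨g, rfl⟩
      exact ⟨.inl g, congrArg Subtype.val (SemidirectProduct.lift_inl _ _ _ g)⟩
  intro x
  obtain ⟨y, hy⟩ := h x.2
  exact ⟨y, Subtype.ext hy⟩

theorem leviMap_eq_one_iff (i : ι) (x : SL(2, k) ⋊[torusAut (D.α i)] Torus k Λ) :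
    D.leviMap k i x = 1 ↔
      ∃ a : kˣ, x.left = diagSL a ∧ x.right = cocharacter (D.h i) a⁻¹ := by
  rw [← D.η_mul_φ_eq_one_iff, ← Subtype.coe_inj]
  exact mul_eq_one_comm

end Levi

section NotMonic

variable {k : Type*} [Field k]

/-- A non-trivial element of the kernel of `φ i` is `diagSL a` with `a ≠ 1` and `a ^ h x = 1` for
all `x ∈ Λ`. Here `x = α` gives `a ^ 2 = 1`, so `a = -1 ≠ 1`, and then all the exponents are
even. -/
theorem even_h_of_not_isMonic {ι Λ : Type*} [Fintype ι] [DecidableEq ι] [AddCommGroup Λ]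
    [Module.Free ℤ Λ] [Module.Finite ℤ Λ] (D : KacMoodyDatum ι Λ) {i : ι}
    (hi : ¬ D.IsMonic k i) (x : Λ) : Even (D.h i x) := by
  rw [IsMonic, injective_iff_map_eq_one] at hi
  push Not at hi
  obtain ⟨g, hg, hg1⟩ := hi
  obtain ⟨a, rfl, ha⟩ := (D.η_mul_φ_eq_one_iff (τ := 1)).mp (by rw [map_one, one_mul, hg])
  have hx (x : Λ) : a⁻¹ ^ D.h i x = 1 := (DFunLike.congr_fun ha (.ofAdd x)).symm
  have h1 : (a : k) ≠ 1 := fun h => hg1 (by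
    obtain rfl : a = 1 := Units.ext h
    ext p q; fin_cases p <;> fin_cases q <;> simp [coe_diagSL])
  have h2 : (a : k) = -1 := by
    have := hx (D.α i)
    rw [D.pairing, D.diag, inv_zpow, inv_eq_one] at this
    have h3 : (a : k) ^ 2 = 1 := by
      have h4 : a ^ 2 = 1 := by exact_mod_cast this
      rw [← Units.val_pow_eq_pow_val, h4, Units.val_one]
    exact (sq_eq_one_iff.mp h3).resolve_left h1
  have h3 : (-1 : k) ≠ 1 := h2 ▸ h1
  by_contra hodd
  rw [Int.not_even_iff_odd] at hodd
  have := congrArg Units.val (hx x)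
  rw [Units.val_zpow_eq_zpow_val, Units.val_inv_eq_inv_val, h2, inv_neg, inv_one,
    hodd.neg_one_zpow] at this
  exact h3 this

end NotMonic

end KacMoodyDatum

/-! ### Data of rank two -/

/-- The automorphism of `ℤ²` with matrix `(n -t; m s)`, where `s n + t m = 1`. -/
def unimodularEquiv (n m s t : ℤ) (h : s * n + t * m = 1) : (Fin 2 → ℤ) ≃ₗ[ℤ] (Fin 2 → ℤ) where
  toFun x := ![n * x 0 - t * x 1, m * x 0 + s * x 1]
  map_add' x y := by ext p; fin_cases p <;> simp <;> ring
  map_smul' c x := by ext p; fin_cases p <;> simp <;> ring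
  invFun y := ![s * y 0 + t * y 1, -m * y 0 + n * y 1]
  left_inv x := by
    ext p; fin_cases p <;> simp
    · linear_combination x 0 * h
    · linear_combination x 1 * h
  right_inv y := by
    ext p; fin_cases p <;> simp
    · linear_combination y 0 * h
    · linear_combination y 1 * h

end

theorem mainTheorem8 {k : Type*} [Field k] [Finite k]
    (a b : ℤ) (ha : 0 < a) (hb : 0 < b) (hab : 4 ≤ a * b) (n m s t : Fin 2 → ℤ)
    (hA : !![s 0, t 0; s 1, t 1] * !![n 0, n 1; m 0, m 1] = !![2, -a; -b, 2])
    (i : Fin 2)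
    (hi : ¬ (KacMoodyDatum.rankTwo a b ha hb n m s t hA).IsMonic k i) :
    Even (s i) ∧ Even (t i) ∧
    ∃ (M : (Fin 2 → ℤ) ≃ₗ[ℤ] (Fin 2 → ℤ))
      (γ : (KacMoodyDatum.rankTwo a b ha hb n m s t hA).levi k i ≃* PGL(2, k) × kˣ),
      LinearMap.toMatrix' (M : (Fin 2 → ℤ) →ₗ[ℤ] (Fin 2 → ℤ)) =
        !![n i, -(t i / 2); m i, s i / 2] ∧
      (∀ τ : KacMoody.Torus k (Fin 2 → ℤ),
        γ ((KacMoodyDatum.rankTwo a b ha hb n m s t hA).ηLevi k i τ) =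
          etaBar (KacMoody.torusMap (M : (Fin 2 → ℤ) →ₗ[ℤ] (Fin 2 → ℤ)) τ)) ∧
      ∀ x : Fin 2 → ℤ,
        M.symm ((KacMoodyDatum.rankTwo a b ha hb n m s t hA).reflection i (M x)) =
          ![-x 0, x 1] := by
  set D := KacMoodyDatum.rankTwo a b ha hb n m s t hA with hD
  have hh (x : Fin 2 → ℤ) : D.h i x = s i * x 0 + t i * x 1 := rfl
  have hα : D.α i = ![n i, m i] := rfl
  have heven := D.even_h_of_not_isMonic hi
  have hs : Even (s i) := by simpa [hh] using heven ![1, 0]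
  have ht : Even (t i) := by simpa [hh] using heven ![0, 1]
  refine ⟨hs, ht, ?_⟩
  obtain ⟨s', hs'⟩ := hs.two_dvd
  obtain ⟨t', ht'⟩ := ht.two_dvd
  have hs2 : s i / 2 = s' := by omega
  have ht2 : t i / 2 = t' := by omega
  have hdet : s' * n i + t' * m i = 1 := by
    have h2 := D.pairing i i
    rw [D.diag, hα, hh, hs', ht'] at h2
    simp only [Matrix.cons_val_zero, Matrix.cons_val_one] at h2
    linarith
  set M := unimodularEquiv (n i) (m i) s' t' hdet with hM
  have hMx (x : Fin 2 → ℤ) : M x = ![n i * x 0 - t' * x 1, m i * x 0 + s' * x 1] := rfl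
  have hMα : M ![1, 0] = D.α i := by rw [hMx, hα]; simp
  have hhM (x : Fin 2 → ℤ) : D.h i (M x) = 2 * x 0 := by
    rw [hh, hMx, hs', ht']
    simp only [Matrix.cons_val_zero, Matrix.cons_val_one]
    linear_combination 2 * x 0 * hdet
  obtain ⟨γ, hγ⟩ := KacMoody.exists_mulEquiv_of_ker_eq (D.leviMap_surjective k i)
    (KacMoody.pglMap_surjective M hMα) <| Subgroup.ext fun x => by
      rw [MonoidHom.mem_ker, MonoidHom.mem_ker, D.leviMap_eq_one_iff,
        KacMoody.pglMap_eq_one_iff M hMα hhM]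
  refine ⟨M, γ, ?_, fun τ => ?_, fun x => ?_⟩
  · rw [hs2, ht2]
    ext p q
    fin_cases p <;> fin_cases q <;> simp [LinearMap.toMatrix'_apply, hMx]
  · have := hγ (.inr τ)
    rw [KacMoodyDatum.leviMap, KacMoody.pglMap, SemidirectProduct.lift_inr,
      SemidirectProduct.lift_inr] at this
    exact this
  · rw [LinearEquiv.symm_apply_eq]
    change M x - D.h i (M x) • D.α i = _
    rw [hhM, ← hMα, ← map_zsmul, ← map_sub]
    congr 1
    ext p; fin_cases p <;> simp
    ring
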